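/- Let $\mathbb F$ be a field. The 0-Hecke algebra $H_n(0)$ is the $\mathbb F$-algebra generated by $\pi_1,\dots,\pi_{n-1}$ with relations $\pi_i^2=\pi_i$, $\pi_i\pi_{i+1}\pi_i=\pi_{i+1}\pi_i\pi_{i+1}$, and $\pi_i\pi_j=\pi_j\pi_i$ for $|i-j|>1$; put $\overline\pi_i=\pi_i-1$. Let $H_{m,n}(0)\subseteq H_{m+n}(0)$ be the subalgebra generated by the $\pi_i$ with $i\ne m$; the map $\pi_i\otimes 1\mapsto\pi_i$, $1\otimes\pi_j\mapsto\pi_{m+j}$ is an isomorphism $H_m(0)\otimes H_n(0)\cong H_{m,n}(0)$. A generalized ribbon $\alpha=\alpha^1\oplus\cdots\oplus\alpha^k$ is a skew diagram whose connected components $\alpha^i$ are ribbons (compositions, whose parts are the row lengths from bottom to top), with $\alpha^{i+1}$ strictly to the northeast of $\alpha^i$. Let $[\alpha]$ be the set of the ribbons obtained by replacing each $\oplus$ by either $\cdot$ (concatenation of compositions) or $\rhd$ (near-concatenation, adding the adjacent parts). A semistandard tableau of shape $\alpha$ is a filling of the boxes with integers whose rows weakly increase from left to right and whose columns strictly increase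 from top to bottom; its reading word is obtained by reading the rows from bottom to top, each from left to right, and it is standard if this word is a permutation of $1,\dots,|\alpha|$. Let $\mathbf P_\alpha$ be the $H_n(0)$-module, $n=|\alpha|$, with basis the standard tableaux of shape $\alpha$, in which $\overline\pi_i\tau$ is $-\tau$, $0$ or $s_i(\tau)$ ($i$ and $i+1$ exchanged) according to whether $i$ is in a higher row of $\tau$ than $i+1$, in the same row, or in a lower row. A decomposition $\alpha=\beta\sqcup\gamma$ is a filling of the boxes of $\alpha$ with the symbols $\beta<\gamma$ that weakly increases along rows (left to right) and columns (top to bottom); $\beta$ and $\gamma$ also denote the generalized ribbons formed by the boxes with the respective symbol. (1) If $\alpha$ is a generalized ribbon of size $m+n$, then, as modules over $H_{m,n}(0)\cong H_m(0)\otimes H_n(0)$, $$\mathbf P_\alpha\downarrow^{H_{m+n}(0)}_{H_{m,n}(0)}\ \cong\bigoplus_{\substack{\alpha=\beta\sqcup\gamma\\ |\beta|=m,\ |\gamma|=n}}\mathbf P_\beta\otimes\mathbf P_\gamma\ \cong\bigoplus_{\substack{\alpha=\beta\sqcup\gamma\\ |\beta|=m,\ \beta'\in[\beta]\\ |\gamma|=n,\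 \gamma'\in[\gamma]}}\mathbf P_{\beta'}\otimes\mathbf P_{\gamma'},$$ the sums being over decompositions (fillings). (2) Let $K_0(H_\bullet(0))=\bigoplus_{n\ge0}K_0(H_n(0))$, where $K_0$ is the Grothendieck group of finitely generated projective modules. The external tensor product induces isomorphisms $K_0(H_m(0))\otimes K_0(H_n(0))\cong K_0(H_m(0)\otimes H_n(0))$. With these identifications, induction $$[M]\cdot[N]=\big[(M\otimes N)\uparrow_{H_m(0)\otimes H_n(0)}^{H_{m+n}(0)}\big]$$ and restriction $$\Delta[M]=\sum_{i+j=n}\big[M\downarrow^{H_n(0)}_{H_i(0)\otimes H_j(0)}\big]\qquad(M\text{ over }H_n(0))$$ (all the modules involved being finitely generated and projective) make $K_0(H_\bullet(0))$ a Hopf algebra over $\mathbb Z$. Let $\mathrm{NSym}=\mathbb Z\langle\mathbf h_1,\mathbf h_2,\dots\rangle$ be the free associative ring with $\Delta\mathbf h_k=\sum_{i+j=k}\mathbf h_i\otimes\mathbf h_j$, $\mathbf h_0=1$. It embeds into the ring of formal power series in noncommuting variables $\mathbf x_i$ ($i\in\mathbb Z$) by $\mathbf h_k\mapsto\sum_{i_1\le\cdots\le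 i_k}\mathbf x_{i_1}\cdots\mathbf x_{i_k}$. For a composition $\alpha=(\alpha_1,\dots,\alpha_\ell)$ put $\mathbf h_\alpha=\mathbf h_{\alpha_1}\cdots\mathbf h_{\alpha_\ell}$ and $\mathbf s_\alpha=\sum_\beta(-1)^{\ell(\alpha)-\ell(\beta)}\mathbf h_\beta$, the sum being over the compositions $\beta$ refined by $\alpha$, where $\ell$ denotes the number of parts. Then there is a unique additive map $\mathbf{ch}:K_0(H_\bullet(0))\to\mathrm{NSym}$ with $\mathbf{ch}[\mathbf P_\alpha]=\mathbf s_\alpha$ for all compositions $\alpha$, and it is an isomorphism of Hopf algebras. For every generalized ribbon $\alpha$ the module $\mathbf P_\alpha$ is projective, and $\mathbf{ch}[\mathbf P_\alpha]$ is (the element of $\mathrm{NSym}$ whose power series is) $\mathbf s_\alpha:=\sum_\tau\mathbf x_{w_1}\cdots\mathbf x_{w_n}$, summed over all semistandard tableaux $\tau$ of shape $\alpha$, $w_1\cdots w_n$ being the reading word of $\tau$. -/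

import Mathlib

open scoped TensorProduct DirectSum
universe u
noncomputable section
namespace HZero

/-! ### The 0-Hecke algebra of type A -/

/-- Defining relations of `H_n(0)`; the index `i : Fin (n - 1)` stands for the generator
`π_{i+1}`. -/
inductive HeckeRel (F : Type u) [Field F] (n : ℕ) :
    FreeAlgebra F (Fin (n - 1)) → FreeAlgebra F (Fin (n - 1)) → Prop
  | idem (i : Fin (n - 1)) :
      HeckeRel F n (FreeAlgebra.ι F i * FreeAlgebra.ι F i) (FreeAlgebra.ι F i)
  | braid (i j : Fin (n - 1)) (h : (i : ℕ) + 1 = j) :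
      HeckeRel F n (FreeAlgebra.ι F i * FreeAlgebra.ι F j * FreeAlgebra.ι F i)
        (FreeAlgebra.ι F j * FreeAlgebra.ι F i * FreeAlgebra.ι F j)
  | comm (i j : Fin (n - 1)) (h : (i : ℕ) + 1 < j) :
      HeckeRel F n (FreeAlgebra.ι F i * FreeAlgebra.ι F j)
        (FreeAlgebra.ι F j * FreeAlgebra.ι F i)

/-- The 0-Hecke algebra `H_n(0)` over the field `F`, by generators and relations. -/
def H (F : Type u) [Field F] (n : ℕ) : Type u := RingQuot (HeckeRel F n)

instance (F : Type u) [Field F] (n : ℕ) : Ring (H F n) :=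
  inferInstanceAs (Ring (RingQuot (HeckeRel F n)))

instance (F : Type u) [Field F] (n : ℕ) : Algebra F (H F n) :=
  inferInstanceAs (Algebra F (RingQuot (HeckeRel F n)))

section
variable {F : Type u} [Field F]

/-- The generator `π_{i+1}` of `H_n(0)`. -/
def pi (F : Type u) [Field F] {n : ℕ} (i : Fin (n - 1)) : H F n :=
  RingQuot.mkAlgHom F (HeckeRel F n) (FreeAlgebra.ι F i)

theorem pi_idem {n : ℕ} (i : Fin (n - 1)) : pi F i * pi F i = pi F i := by
  have := RingQuot.mkAlgHom_rel F (HeckeRel.idem (F := F) i)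
  rw [map_mul] at this
  exact this

theorem pi_braid {n : ℕ} (i j : Fin (n - 1)) (h : (i : ℕ) + 1 = j) :
    pi F i * pi F j * pi F i = pi F j * pi F i * pi F j := by
  have := RingQuot.mkAlgHom_rel F (HeckeRel.braid (F := F) i j h)
  simp only [map_mul] at this
  exact this

theorem pi_comm {n : ℕ} (i j : Fin (n - 1)) (h : (i : ℕ) + 1 < j) :
    pi F i * pi F j = pi F j * pi F i := by
  have := RingQuot.mkAlgHom_rel F (HeckeRel.comm (F := F) i j h)
  simp only [map_mul] at this
  exact this

/-- Elements of an `F`-algebra satisfying the defining relations give an algebra homomorphism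
out of `H_n(0)`. -/
def H.lift {n : ℕ} {A : Type*} [Ring A] [Algebra F A] (f : Fin (n - 1) → A)
    (h1 : ∀ i, f i * f i = f i)
    (h2 : ∀ i j : Fin (n - 1), (i : ℕ) + 1 = j → f i * f j * f i = f j * f i * f j)
    (h3 : ∀ i j : Fin (n - 1), (i : ℕ) + 1 < j → f i * f j = f j * f i) : H F n →ₐ[F] A :=
  RingQuot.liftAlgHom F ⟨FreeAlgebra.lift F f, by
    intro x y hxy
    cases hxy with
    | idem i => simpa using h1 i
    | braid i j h => simpa using h2 i j h
    | comm i j h => simpa using h3 i j h⟩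

@[simp] theorem H.lift_pi {n : ℕ} {A : Type*} [Ring A] [Algebra F A] (f : Fin (n - 1) → A)
    (h1 h2 h3) (i : Fin (n - 1)) : H.lift (F := F) f h1 h2 h3 (pi F i) = f i := by
  have h := RingQuot.liftAlgHom_mkAlgHom_apply F (s := HeckeRel F n) (FreeAlgebra.lift F f)
    (by
      intro x y hxy
      cases hxy with
      | idem i => simpa using h1 i
      | braid i j h => simpa using h2 i j h
      | comm i j h => simpa using h3 i j h) (FreeAlgebra.ι F i)
  rw [FreeAlgebra.lift_ι_apply] at h
  exact h

theorem H.induction {n : ℕ} {C : H F n → Prop} (halg : ∀ r, C (algebraMap F _ r))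
    (hpi : ∀ i, C (pi F i)) (hmul : ∀ a b, C a → C b → C (a * b))
    (hadd : ∀ a b, C a → C b → C (a + b)) (a : H F n) : C a := by
  obtain ⟨x, rfl⟩ := RingQuot.mkAlgHom_surjective F (HeckeRel F n) a
  induction x using FreeAlgebra.induction with
  | grade0 r => rw [AlgHom.commutes]; exact halg r
  | grade1 i => exact hpi i
  | mul a b ha hb => rw [map_mul]; exact hmul _ _ ha hb
  | add a b ha hb => rw [map_add]; exact hadd _ _ ha hb

/-- `H_m(0) → H_{m+n}(0)`, `π_i ↦ π_i`. -/
def parLeft {m n N : ℕ} (h : m + n = N) : H F m →ₐ[F] H F N :=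
  H.lift (fun i => pi F ⟨i, by omega⟩) (fun _ => pi_idem _)
    (fun _ _ hij => pi_braid _ _ hij) (fun _ _ hij => pi_comm _ _ hij)

/-- `H_n(0) → H_{m+n}(0)`, `π_j ↦ π_{m+j}`. -/
def parRight {m n N : ℕ} (h : m + n = N) : H F n →ₐ[F] H F N :=
  H.lift (fun i => pi F ⟨m + i, by omega⟩) (fun _ => pi_idem _)
    (fun i j hij => pi_braid _ _ (by simp only; omega))
    (fun i j hij => pi_comm _ _ (by simp only; omega))

theorem par_commute {m n N : ℕ} (h : m + n = N) (x : H F m) (y : H F n) :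
    Commute (parLeft h x) (parRight h y) := by
  induction x using H.induction with
  | halg r => rw [AlgHom.commutes]; exact Algebra.commutes _ _
  | hmul a b ha hb => rw [map_mul]; exact ha.mul_left hb
  | hadd a b ha hb => rw [map_add]; exact ha.add_left hb
  | hpi i =>
    induction y using H.induction with
    | halg r => rw [AlgHom.commutes]; exact (Algebra.commutes _ _).symm
    | hmul a b ha hb => rw [map_mul]; exact ha.mul_right hb
    | hadd a b ha hb => rw [map_add]; exact ha.add_right hb
    | hpi j =>
      simp only [parLeft, parRight, H.lift_pi]
      exact pi_comm _ _ (by have := i.2; simp only; omega)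

/-- The homomorphism `H_m(0) ⊗ H_n(0) → H_{m+n}(0)` with `π_i ⊗ 1 ↦ π_i` and
`1 ⊗ π_j ↦ π_{m+j}`; its image is the parabolic subalgebra `H_{m,n}(0)`. -/
def par (F : Type u) [Field F] {m n N : ℕ} (h : m + n = N) : H F m ⊗[F] H F n →ₐ[F] H F N :=
  Algebra.TensorProduct.lift (parLeft h) (parRight h) (par_commute h)

/-- The parabolic subalgebra `H_{m,n}(0)` of `H_{m+n}(0)`, generated by all `π_i` with `i ≠ m`
(the index `i : Fin (N - 1)` stands for `π_{i+1}`). -/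
def parabolic (F : Type u) [Field F] (m N : ℕ) : Subalgebra F (H F N) :=
  Algebra.adjoin F {x | ∃ i : Fin (N - 1), (i : ℕ) + 1 ≠ m ∧ x = pi F i}
end

/-! ### Generalized ribbons and tableaux -/

/-- The position of a box of a generalized ribbon relative to the preceding one, the boxes being
listed in reading order (rows from bottom to top, each row from left to right): immediately to its
right, immediately above it, or starting a new connected component strictly to the northeast. -/
inductive Step
  | right
  | up
  | gap
  deriving DecidableEq

/-- A generalized ribbon `α = α¹ ⊕ ⋯ ⊕ αᵏ` of size `n`. The boxes are `0, …, n - 1` in reading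
order, and `step p` places box `p + 1` relative to box `p`. -/
@[ext] structure GenRibbon (n : ℕ) where
  step : Fin (n - 1) → Step

namespace GenRibbon
variable {n : ℕ} (α : GenRibbon n)

/-- The row of a box, counted from bottom to top. -/
def row (p : Fin n) : ℕ :=
  (Finset.univ.filter fun q : Fin (n - 1) => (q : ℕ) < p ∧ α.step q ≠ Step.right).card

/-- The column of a box, counted from left to right. -/
def col (p : Fin n) : ℕ :=
  (Finset.univ.filter fun q : Fin (n - 1) => (q : ℕ) < p ∧ α.step q ≠ Step.up).card

/-- Semistandard fillings: rows weakly increase from left to right and columns strictly increase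
from top to bottom. The word `T 0, T 1, …` is the reading word. -/
def IsSemistandard {X : Type*} [LinearOrder X] (T : Fin n → X) : Prop :=
  (∀ p q, α.row p = α.row q → α.col p < α.col q → T p ≤ T q) ∧
  (∀ p q, α.col p = α.col q → α.row q < α.row p → T p < T q)

/-- Standard tableaux: semistandard tableaux whose reading word is a permutation
(with entries `0, …, n - 1` in place of `1, …, n`); `perm p` is the entry of the box `p`. -/
@[ext] structure StdTableau : Type where
  perm : Equiv.Perm (Fin n)
  semistandard : α.IsSemistandard perm

/-- `α` is a ribbon, i.e. it has at most one connected component. -/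
def IsRibbon : Prop := ∀ p, α.step p ≠ Step.gap

/-- The set `[α]` of the ribbons obtained from `α = α¹ ⊕ ⋯ ⊕ αᵏ` by replacing each `⊕` by
`·` (the next component is put on top of the last box of the preceding one) or by `▷` (it is put
to the right of that box). -/
def resolutions : Set (GenRibbon n) :=
  {β | β.IsRibbon ∧ ∀ p, α.step p ≠ Step.gap → β.step p = α.step p}

/-- The ribbon of a composition, whose rows from bottom to top have lengths the parts of `c`. -/
def ofComposition {n : ℕ} (c : Composition n) : GenRibbon n where
  step p := if (⟨(p : ℕ) + 1, by omega⟩ : Fin (n + 1)) ∈ c.boundaries then Step.up else Step.right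

/-- The generalized ribbon formed by the boxes in the range of `e`: consecutive boxes of `α` keep
their relative position, and skipped boxes separate components. -/
def restrict {k : ℕ} (e : Fin k ↪o Fin n) : GenRibbon k where
  step p :=
    if h : ((e ⟨p, by omega⟩ : Fin n) : ℕ) + 1 = e ⟨(p : ℕ) + 1, by omega⟩ then
      α.step ⟨e ⟨p, by omega⟩, by have := (e ⟨(p : ℕ) + 1, by omega⟩).2; omega⟩
    else Step.gap

/-- Decompositions `α = β ⊔ γ` with `|β| = m` and `|γ| = k`, given by the set `S` of boxes filled
with the symbol `β`, the boxes of the complement being filled with `γ`. With `β < γ`, the filling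
weakly increases along rows (left to right) and along columns (top to bottom). -/
structure Decomp (m k : ℕ) where
  S : Finset (Fin n)
  row_le : ∀ p q, α.row p = α.row q → α.col p < α.col q → q ∈ S → p ∈ S
  col_le : ∀ p q, α.col p = α.col q → α.row q < α.row p → q ∈ S → p ∈ S
  card_left : S.card = m
  card_right : Sᶜ.card = k

/-- The part `β` of a decomposition `α = β ⊔ γ`. -/
def Decomp.left {α : GenRibbon n} {m k : ℕ} (d : α.Decomp m k) : GenRibbon m :=
  α.restrict (d.S.orderEmbOfFin d.card_left)

/-- The part `γ` of a decomposition `α = β ⊔ γ`. -/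
def Decomp.right {α : GenRibbon n} {m k : ℕ} (d : α.Decomp m k) : GenRibbon k :=
  α.restrict (d.Sᶜ.orderEmbOfFin d.card_right)

end GenRibbon

/-! ### The module `P_α` -/

section tableauModule

open Equiv

variable (F : Type u) [Field F]

/-- The operator on formal combinations of all fillings underlying `π̄`; `ρ` is the row function
of the shape, and `a`, `b` are the entries concerned. -/
def permOp {n : ℕ} (ρ : Fin n → ℕ) (a b : Fin n) :
    (Perm (Fin n) →₀ F) →ₗ[F] (Perm (Fin n) →₀ F) :=
  Finsupp.linearCombination F fun σ : Perm (Fin n) =>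
    if ρ (σ.symm b) < ρ (σ.symm a) then -Finsupp.single σ (1 : F)
    else if ρ (σ.symm a) = ρ (σ.symm b) then 0
    else Finsupp.single (σ.trans (swap a b)) (1 : F)

theorem permOp_single {n : ℕ} (ρ : Fin n → ℕ) (a b : Fin n) (σ : Perm (Fin n)) :
    permOp F ρ a b (Finsupp.single σ 1) =
    if ρ (σ.symm b) < ρ (σ.symm a) then -Finsupp.single σ (1 : F)
    else if ρ (σ.symm a) = ρ (σ.symm b) then 0
    else Finsupp.single (σ.trans (swap a b)) (1 : F) := by
  simp [permOp]

theorem permOp_sq {n : ℕ} (ρ : Fin n → ℕ) (a b : Fin n) :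
    permOp F ρ a b * permOp F ρ a b = -permOp F ρ a b := by
  ext1 σ
  ext1
  simp only [LinearMap.comp_apply, Module.End.mul_apply, Finsupp.lsingle_apply, LinearMap.neg_apply]
  by_cases h1 : ρ (σ.symm b) < ρ (σ.symm a)
  · simp [permOp_single, h1]
  · by_cases h2 : ρ (σ.symm a) = ρ (σ.symm b)
    · simp [permOp_single, h2]
    · have h3 : ρ (σ.symm a) < ρ (σ.symm b) := by omega
      simp [permOp_single, h1, h2, h3]

theorem lt_tri (x y : ℕ) : (x < y ∧ ¬ y < x ∧ x ≠ y ∧ y ≠ x) ∨ x = y ∨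
    (y < x ∧ ¬ x < y ∧ x ≠ y ∧ y ≠ x) := by omega

theorem permOp_braid {n : ℕ} (ρ : Fin n → ℕ) (a b c : Fin n) (hab : a ≠ b) (hbc : b ≠ c)
    (hac : a ≠ c) :
    permOp F ρ a b * permOp F ρ b c * permOp F ρ a b =
      permOp F ρ b c * permOp F ρ a b * permOp F ρ b c := by
  ext1 σ
  ext1
  have e1 : swap a b a = b := swap_apply_left _ _
  have e2 : swap a b b = a := swap_apply_right _ _
  have e3 : swap a b c = c := swap_apply_of_ne_of_ne hac.symm hbc.symm
  have e4 : swap b c b = c := swap_apply_left _ _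
  have e5 : swap b c c = b := swap_apply_right _ _
  have e6 : swap b c a = a := swap_apply_of_ne_of_ne hab hac
  have key : ((σ.trans (swap a b)).trans (swap b c)).trans (swap a b) =
      ((σ.trans (swap b c)).trans (swap a b)).trans (swap b c) := by
    ext1 x
    simp only [trans_apply]
    generalize σ x = y
    by_cases ya : y = a
    · subst ya; simp [e1, e3, e4, e6]
    by_cases yb : y = b
    · subst yb; simp [e1, e2, e3, e4, e6]
    by_cases yc : y = c
    · subst yc; simp [e2, e3, e5, e6]
    · simp [swap_apply_of_ne_of_ne, ya, yb, yc]
  simp only [LinearMap.comp_apply, Module.End.mul_apply, Finsupp.lsingle_apply]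
  rcases lt_tri (ρ (σ.symm a)) (ρ (σ.symm b)) with h | h | h <;>
  rcases lt_tri (ρ (σ.symm b)) (ρ (σ.symm c)) with h' | h' | h' <;>
  rcases lt_tri (ρ (σ.symm a)) (ρ (σ.symm c)) with h'' | h'' | h'' <;>
  first
  | omega
  | simp [permOp_single, e1, e2, e3, e4, e5, e6, h, h', h'', key]

theorem permOp_comm {n : ℕ} (ρ : Fin n → ℕ) (a b c d : Fin n) (hac : a ≠ c) (had : a ≠ d)
    (hbc : b ≠ c) (hbd : b ≠ d) :
    permOp F ρ a b * permOp F ρ c d = permOp F ρ c d * permOp F ρ a b := by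
  ext1 σ
  ext1
  have e1 : swap a b c = c := swap_apply_of_ne_of_ne hac.symm hbc.symm
  have e2 : swap a b d = d := swap_apply_of_ne_of_ne had.symm hbd.symm
  have e3 : swap c d a = a := swap_apply_of_ne_of_ne hac had
  have e4 : swap c d b = b := swap_apply_of_ne_of_ne hbc hbd
  have key : (σ.trans (swap a b)).trans (swap c d) = (σ.trans (swap c d)).trans (swap a b) := by
    ext1 x
    simp only [trans_apply]
    generalize σ x = y
    by_cases ya : y = a
    · subst ya; simp [e3, e4]
    by_cases yb : y = b
    · subst yb; simp [e3, e4]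
    by_cases yc : y = c
    · subst yc; simp [e1, e2]
    by_cases yd : y = d
    · subst yd; simp [e1, e2]
    · simp [swap_apply_of_ne_of_ne, ya, yb, yc, yd]
  simp only [LinearMap.comp_apply, Module.End.mul_apply, Finsupp.lsingle_apply]
  rcases lt_tri (ρ (σ.symm a)) (ρ (σ.symm b)) with h | h | h <;>
  rcases lt_tri (ρ (σ.symm c)) (ρ (σ.symm d)) with h' | h' | h' <;>
  simp [permOp_single, e1, e2, e3, e4, h, h', key]

namespace GenRibbon
variable {n : ℕ} {α : GenRibbon n}

/-- The row (counted from bottom to top) of the box of `T` containing the entry `e`. -/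
def StdTableau.rowOf (T : α.StdTableau) (e : Fin n) : ℕ := α.row (T.perm.symm e)

/-- The standard tableau `s_i(T)`, for entries `a = i`, `b = i + 1` with `a` in a lower row
than `b`. -/
def StdTableau.swapEntries (T : α.StdTableau) (a b : Fin n) (hab : (a : ℕ) + 1 = b)
    (h : T.rowOf a < T.rowOf b) : α.StdTableau :=
  ⟨T.perm.trans (swap a b), by
    obtain ⟨T, hT1, hT2⟩ := T
    simp only [StdTableau.rowOf] at h
    have aux : ∀ p q, T p < T q → ¬ (T p = a ∧ T q = b) → swap a b (T p) < swap a b (T q) := by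
      intro p q hpq hne
      rw [Fin.ext_iff, Fin.ext_iff] at hne
      rw [Fin.lt_def] at hpq ⊢
      simp only [swap_apply_def, Fin.ext_iff]
      split_ifs <;> omega
    refine ⟨fun p q hr hc => ?_, fun p q hc hr => ?_⟩
    · refine (aux p q ((hT1 p q hr hc).lt_of_ne fun e => ?_) ?_).le
      · rw [T.injective e] at hc; exact lt_irrefl _ hc
      · rintro ⟨rfl, rfl⟩
        simp [hr] at h
    · refine aux p q (hT2 p q hc hr) ?_
      rintro ⟨rfl, rfl⟩
      simp only [symm_apply_apply] at h
      omega⟩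

/-- The entry `i + 1`, written `i` in the numbering starting from `0`. -/
def lo (i : Fin (n - 1)) : Fin n := ⟨i, by omega⟩

/-- The entry `i + 2`, written `i + 1` in the numbering starting from `0`. -/
def hi (i : Fin (n - 1)) : Fin n := ⟨(i : ℕ) + 1, by omega⟩

variable (α) in
/-- The action of `π̄_{i+1} = π_{i+1} - 1` on formal combinations of standard tableaux of shape `α`:
a tableau `T` is sent to `-T`, to `0` or to `s_{i+1}(T)` according to whether the entry `lo i` is in
a higher row than `hi i`, in the same row, or in a lower row. -/
def piBar (i : Fin (n - 1)) : (α.StdTableau →₀ F) →ₗ[F] (α.StdTableau →₀ F) :=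
  Finsupp.linearCombination F fun T : α.StdTableau =>
    if h : T.rowOf (lo i) < T.rowOf (hi i) then
      Finsupp.single (T.swapEntries (lo i) (hi i) rfl h) (1 : F)
    else if T.rowOf (lo i) = T.rowOf (hi i) then 0
    else -Finsupp.single T (1 : F)

theorem piBar_single (i : Fin (n - 1)) (T : α.StdTableau) :
    piBar F α i (Finsupp.single T 1) = if h : T.rowOf (lo i) < T.rowOf (hi i) then
      Finsupp.single (T.swapEntries (lo i) (hi i) rfl h) (1 : F)
    else if T.rowOf (lo i) = T.rowOf (hi i) then 0
    else -Finsupp.single T (1 : F) := by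
  rw [piBar, Finsupp.linearCombination_single, one_smul]

/-- Forgetting that a tableau is standard. -/
def toPerm : (α.StdTableau →₀ F) →ₗ[F] (Perm (Fin n) →₀ F) :=
  Finsupp.lmapDomain F F (StdTableau.perm : α.StdTableau → Perm (Fin n))

theorem toPerm_injective : Function.Injective (toPerm F (α := α)) :=
  Finsupp.mapDomain_injective fun _ _ h => StdTableau.ext h

theorem toPerm_piBar (i : Fin (n - 1)) (x : α.StdTableau →₀ F) :
    toPerm F (piBar F α i x) = permOp F α.row (lo i) (hi i) (toPerm F x) := by
  suffices toPerm F ∘ₗ piBar F α i = permOp F α.row (lo i) (hi i) ∘ₗ toPerm F from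
    LinearMap.congr_fun this x
  refine Finsupp.lhom_ext' fun T => LinearMap.ext_ring ?_
  have e : ∀ T : α.StdTableau,
      toPerm F (α := α) (Finsupp.single T 1) = Finsupp.single T.perm 1 :=
    fun T => Finsupp.mapDomain_single
  have e3 : permOp F α.row (lo i) (hi i) (Finsupp.single T.perm 1) =
      if T.rowOf (hi i) < T.rowOf (lo i) then -Finsupp.single T.perm (1 : F)
      else if T.rowOf (lo i) = T.rowOf (hi i) then 0
      else Finsupp.single (T.perm.trans (swap (lo i) (hi i))) (1 : F) := permOp_single ..
  rw [LinearMap.comp_apply, LinearMap.comp_apply, LinearMap.comp_apply, LinearMap.comp_apply,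
    Finsupp.lsingle_apply, e, e3, piBar_single]
  rcases lt_tri (T.rowOf (lo i)) (T.rowOf (hi i)) with h | h | h
  · rw [dif_pos h.1, if_neg h.2.1, if_neg h.2.2.1, e]
    rfl
  · rw [dif_neg h.not_lt, if_pos h, if_neg h.not_gt, if_pos h, map_zero]
  · rw [dif_neg h.2.1, if_pos h.1, if_neg h.2.2.1, map_neg, e]

theorem piBar_sq (i : Fin (n - 1)) : piBar F α i * piBar F α i = -piBar F α i := by
  refine LinearMap.ext fun x => ?_
  apply toPerm_injective F
  simp only [Module.End.mul_apply, LinearMap.neg_apply, map_neg, toPerm_piBar]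
  exact LinearMap.congr_fun (permOp_sq F α.row (lo i) (hi i)) _

theorem piBar_braid (i j : Fin (n - 1)) (h : (i : ℕ) + 1 = j) :
    piBar F α i * piBar F α j * piBar F α i = piBar F α j * piBar F α i * piBar F α j := by
  refine LinearMap.ext fun x => ?_
  apply toPerm_injective F
  have e : lo j = hi i := Fin.ext h.symm
  simp only [Module.End.mul_apply, toPerm_piBar, e]
  refine LinearMap.congr_fun (permOp_braid F α.row (lo i) (hi i) (hi j) ?_ ?_ ?_) _ <;>
    simp [lo, hi, Fin.ext_iff] <;> omega

theorem piBar_comm (i j : Fin (n - 1)) (h : (i : ℕ) + 1 < j) :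
    piBar F α i * piBar F α j = piBar F α j * piBar F α i := by
  refine LinearMap.ext fun x => ?_
  apply toPerm_injective F
  simp only [Module.End.mul_apply, toPerm_piBar]
  refine LinearMap.congr_fun (permOp_comm F α.row (lo i) (hi i) (lo j) (hi j) ?_ ?_ ?_ ?_) _ <;>
    simp [lo, hi, Fin.ext_iff] <;> omega

variable (α) in
/-- The representation of `H_n(0)` on formal combinations of standard tableaux of shape `α`, in
which `π_i` acts by `π̄_i + 1`. -/
def rep : H F n →ₐ[F] Module.End F (α.StdTableau →₀ F) :=
  H.lift (fun i => piBar F α i + 1)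
    (fun i => by
      have h := piBar_sq F (α := α) i
      rw [mul_add, add_mul, h]
      simp only [mul_one, one_mul]
      abel)
    (fun i j hij => by
      have h := piBar_braid F (α := α) i j hij
      have h1 := piBar_sq F (α := α) i
      have h2 := piBar_sq F (α := α) j
      simp only [mul_add, add_mul, mul_one, one_mul, h, h1, h2]
      abel)
    (fun i j hij => by
      have h := piBar_comm F (α := α) i j hij
      simp only [mul_add, add_mul, mul_one, one_mul, h]
      abel)

/-- The `H_n(0)`-module `P_α`, with basis the standard tableaux of shape `α`. -/
def P (F : Type u) [Field F] {n : ℕ} (α : GenRibbon n) : Type u := α.StdTableau →₀ F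

instance : AddCommGroup (P F α) := inferInstanceAs (AddCommGroup (α.StdTableau →₀ F))
instance : Module F (P F α) := inferInstanceAs (Module F (α.StdTableau →₀ F))
instance : Module (H F n) (P F α) :=
  Module.compHom (α.StdTableau →₀ F) (rep F α).toRingHom

theorem P_smul_def (a : H F n) (x : P F α) : a • x = rep F α a x := rfl

instance : IsScalarTower F (H F n) (P F α) where
  smul_assoc r a x := by
    rw [P_smul_def, P_smul_def, map_smul]
    rfl
end GenRibbon

end tableauModule

/-! ### Restriction, external tensor products, induction -/

section modules

variable (F : Type u) [Field F]

/-- The restriction of an `A`-module `M` along an algebra homomorphism `φ : B → A`. -/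
def Res {A B : Type*} [Ring A] [Ring B] [Algebra F A] [Algebra F B] (_ : B →ₐ[F] A)
    (M : Type*) : Type _ := M

section
variable {F} {A B : Type*} [Ring A] [Ring B] [Algebra F A] [Algebra F B] (φ : B →ₐ[F] A)
  (M : Type*) [AddCommGroup M] [Module F M] [Module A M] [IsScalarTower F A M]

instance : AddCommGroup (Res F φ M) := inferInstanceAs (AddCommGroup M)
instance : Module F (Res F φ M) := inferInstanceAs (Module F M)
instance : Module B (Res F φ M) := Module.compHom M φ.toRingHom
end

/-- The external tensor product `M ⊗ N` of an `A`-module `M` and a `B`-module `N`, a module over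
`A ⊗ B`. -/
def ExtTensor (A B M N : Type*) [Ring A] [Ring B] [Algebra F A] [Algebra F B]
    [AddCommGroup M] [AddCommGroup N] [Module F M] [Module F N]
    [Module A M] [Module B N] : Type _ := M ⊗[F] N

section
variable (A B M N : Type*) [Ring A] [Ring B] [Algebra F A] [Algebra F B]
  [AddCommGroup M] [AddCommGroup N] [Module F M] [Module F N]
  [Module A M] [Module B N] [IsScalarTower F A M] [IsScalarTower F B N]

instance : AddCommGroup (ExtTensor F A B M N) := inferInstanceAs (AddCommGroup (M ⊗[F] N))
instance : Module F (ExtTensor F A B M N) := inferInstanceAs (Module F (M ⊗[F] N))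

/-- The action of `A ⊗ B` on `M ⊗ N`. -/
def extAction : A ⊗[F] B →ₐ[F] Module.End F (M ⊗[F] N) :=
  (Module.endTensorEndAlgHom (R := F) (S := F) (A := F) (M := M) (N := N)).comp
    (Algebra.TensorProduct.map (Algebra.lsmul F F M) (Algebra.lsmul F F N))

theorem extAction_tmul (a : A) (b : B) (x : M) (y : N) :
    extAction F A B M N (a ⊗ₜ b) (x ⊗ₜ y) = (a • x) ⊗ₜ (b • y) := rfl

instance : Module (A ⊗[F] B) (ExtTensor F A B M N) :=
  Module.compHom (M ⊗[F] N) (extAction F A B M N).toRingHom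
end

/-- The induced module `A ⊗_B X` of a `B`-module `X` along an algebra homomorphism `φ : B → A`:
the quotient of the left `A`-module `A ⊗_F X` by the relations `a φ(b) ⊗ x = a ⊗ b x`. -/
def Ind {A B : Type*} [Ring A] [Ring B] [Algebra F A] [Algebra F B] (φ : B →ₐ[F] A)
    (X : Type*) [AddCommGroup X] [Module F X] [Module B X] : Type _ :=
  (A ⊗[F] X) ⧸ Submodule.span A
    {t : A ⊗[F] X | ∃ (a : A) (b : B) (x : X), t = (a * φ b) ⊗ₜ[F] x - a ⊗ₜ[F] (b • x)}

section
variable {A B : Type*} [Ring A] [Ring B] [Algebra F A] [Algebra F B] (φ : B →ₐ[F] A)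
    (X : Type*) [AddCommGroup X] [Module F X] [Module B X]

instance : AddCommGroup (Ind F φ X) := by unfold Ind; infer_instance
instance : Module A (Ind F φ X) := by unfold Ind; infer_instance
end

end modules

/-! ### Grothendieck groups of finitely generated projective modules -/

/-- A finitely generated projective (left) module over an `F`-algebra `A`. -/
structure FGProj (F A : Type u) [Field F] [Ring A] [Algebra F A] : Type (u + 1) where
  carrier : Type u
  [addCommGroup : AddCommGroup carrier]
  [moduleBase : Module F carrier]
  [module : Module A carrier]
  [isScalarTower : IsScalarTower F A carrier]
  [finite : Module.Finite A carrier]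
  [projective : Module.Projective A carrier]

attribute [instance] FGProj.addCommGroup FGProj.moduleBase FGProj.module FGProj.isScalarTower
  FGProj.finite FGProj.projective

instance (F A : Type u) [Field F] [Ring A] [Algebra F A] : CoeSort (FGProj F A) (Type u) :=
  ⟨FGProj.carrier⟩

section K0
variable (F A : Type u) [Field F] [Ring A] [Algebra F A]

/-- The elements `[M] - [L] - [N]` for all short exact sequences `0 → L → M → N → 0` of finitely
generated projective modules. -/
def k0Relations : Set (FreeAbelianGroup (FGProj F A)) :=
  {r | ∃ (L M N : FGProj F A) (f : L →ₗ[A] M) (g : M →ₗ[A] N),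
    Function.Injective f ∧ Function.Surjective g ∧ Function.Exact f g ∧
    r = FreeAbelianGroup.of M - FreeAbelianGroup.of L - FreeAbelianGroup.of N}

/-- The Grothendieck group `K₀(A)` of the category of finitely generated projective `A`-modules.
(Isomorphic modules have the same class, as `0 → 0 → M → M' → 0` is exact for `M ≅ M'`.) -/
def K0 : Type (u + 1) := FreeAbelianGroup (FGProj F A) ⧸ AddSubgroup.closure (k0Relations F A)

instance : AddCommGroup (K0 F A) :=
  inferInstanceAs
    (AddCommGroup (FreeAbelianGroup (FGProj F A) ⧸ AddSubgroup.closure (k0Relations F A)))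

variable {F A}

/-- The class of a finitely generated projective module. -/
def K0.cls (M : FGProj F A) : K0 F A :=
  QuotientAddGroup.mk' (AddSubgroup.closure (k0Relations F A)) (FreeAbelianGroup.of M)

/-- `x.IsClassOf X`: the `A`-module `X` is finitely generated and projective, and `x` is its
class in `K₀(A)`. -/
def K0.IsClassOf (x : K0 F A) (X : Type*) [AddCommGroup X] [Module A X] : Prop :=
  ∃ M : FGProj F A, Nonempty (M ≃ₗ[A] X) ∧ x = K0.cls M

end K0

/-- The Grothendieck group `K₀(H_•(0)) = ⨁ₙ K₀(H_n(0))` of the tower of 0-Hecke algebras. -/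
abbrev K0Tower (F : Type u) [Field F] : Type (u + 1) := ⨁ n : ℕ, K0 F (H F n)

/-- The inclusion `K₀(H_n(0)) → K₀(H_•(0))`. -/
def K0Tower.of (F : Type u) [Field F] (n : ℕ) : K0 F (H F n) →+ K0Tower F :=
  DirectSum.of (fun n : ℕ => K0 F (H F n)) n

/-- The map `K₀(H_i(0)) ⊗ K₀(H_j(0)) → K₀(H_•(0)) ⊗ K₀(H_•(0))`. -/
def K0Tower.of₂ (F : Type u) [Field F] (i j : ℕ) :
    K0 F (H F i) ⊗[ℤ] K0 F (H F j) →ₗ[ℤ] K0Tower F ⊗[ℤ] K0Tower F :=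
  TensorProduct.map (K0Tower.of F i).toIntLinearMap (K0Tower.of F j).toIntLinearMap

/-- Hopf algebra axioms for a ring `A` with an `R`-coalgebra structure: comultiplication and
counit are multiplicative and unital, and `S` is an antipode. -/
structure IsHopf (R A : Type*) [CommRing R] [Ring A] [Algebra R A] [Coalgebra R A]
    (S : A →ₗ[R] A) : Prop where
  comul_one : Coalgebra.comul (R := R) (1 : A) = 1
  comul_mul : ∀ a b : A,
    Coalgebra.comul (R := R) (a * b) = Coalgebra.comul (R := R) a * Coalgebra.comul (R := R) b
  counit_one : Coalgebra.counit (R := R) (1 : A) = 1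
  counit_mul : ∀ a b : A,
    Coalgebra.counit (R := R) (a * b) = Coalgebra.counit (R := R) a * Coalgebra.counit (R := R) b
  antipode_left : LinearMap.mul' R A ∘ₗ S.rTensor A ∘ₗ Coalgebra.comul =
    Algebra.linearMap R A ∘ₗ Coalgebra.counit
  antipode_right : LinearMap.mul' R A ∘ₗ S.lTensor A ∘ₗ Coalgebra.comul =
    Algebra.linearMap R A ∘ₗ Coalgebra.counit

/-! ### Noncommutative symmetric functions -/

section NSym

/-- Formal power series with integer coefficients in noncommuting variables `x_i`, `i ∈ X`;
`f w` is the coefficient of the word `w`. -/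
def NCSeries (X : Type*) : Type _ := List X → ℤ

namespace NCSeries
variable {X : Type*}

@[ext] theorem ext {f g : NCSeries X} (h : ∀ w, f w = g w) : f = g := funext h

instance : AddCommGroup (NCSeries X) := inferInstanceAs (AddCommGroup (List X → ℤ))

instance : One (NCSeries X) := ⟨fun w => if w.length = 0 then 1 else 0⟩

/-- The Cauchy product: sum over all factorizations of a word. -/
instance : Mul (NCSeries X) :=
  ⟨fun f g w => ∑ i ∈ Finset.range (w.length + 1), f (w.take i) * g (w.drop i)⟩

theorem add_apply (f g : NCSeries X) (w : List X) : (f + g) w = f w + g w := rfl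
theorem zero_apply (w : List X) : (0 : NCSeries X) w = 0 := rfl
theorem one_apply (w : List X) : (1 : NCSeries X) w = if w.length = 0 then 1 else 0 := rfl
theorem mul_apply (f g : NCSeries X) (w : List X) :
    (f * g) w = ∑ i ∈ Finset.range (w.length + 1), f (w.take i) * g (w.drop i) := rfl

theorem mul_assoc' (f g h : NCSeries X) : f * g * h = f * (g * h) := by
  ext w
  simp only [mul_apply, Finset.sum_mul, Finset.mul_sum]
  rw [Finset.sum_sigma', Finset.sum_sigma']
  refine Finset.sum_bij' (fun p _ => ⟨p.2, p.1 - p.2⟩) (fun p _ => ⟨p.1 + p.2, p.1⟩) ?_ ?_ ?_ ?_ ?_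
  · rintro ⟨i, j⟩ hp
    simp only [Finset.mem_sigma, Finset.mem_range, List.length_take, List.length_drop] at hp ⊢
    omega
  · rintro ⟨i, j⟩ hp
    simp only [Finset.mem_sigma, Finset.mem_range, List.length_take, List.length_drop] at hp ⊢
    omega
  · rintro ⟨i, j⟩ hp
    simp only [Finset.mem_sigma, Finset.mem_range, List.length_take] at hp
    have : j + (i - j) = i := by omega
    simp [this]
  · rintro ⟨i, j⟩ hp
    simp
  · rintro ⟨i, j⟩ hp
    simp only [Finset.mem_sigma, Finset.mem_range, List.length_take] at hp
    have h1 : min j i = j := by omega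
    have h2 : j + (i - j) = i := by omega
    simp only [List.take_take, List.drop_drop, h1, h2, List.drop_take, mul_assoc]

instance : Ring (NCSeries X) where
  __ := (inferInstance : AddCommGroup (NCSeries X))
  mul_assoc := mul_assoc'
  one_mul f := by
    ext w
    rw [mul_apply, Finset.sum_eq_single 0]
    · simp [one_apply]
    · intro i hi h0
      have : (w.take i).length ≠ 0 := by
        simp only [Finset.mem_range, List.length_take] at hi ⊢
        omega
      rw [one_apply, if_neg this, zero_mul]
    · simp
  mul_one f := by
    ext w
    rw [mul_apply, Finset.sum_eq_single w.length]
    · simp [one_apply]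
    · intro i hi h0
      have : (w.drop i).length ≠ 0 := by
        simp only [Finset.mem_range, List.length_drop] at hi ⊢
        omega
      rw [one_apply, if_neg this, mul_zero]
    · simp
  zero_mul f := by ext w; simp [mul_apply, zero_apply]
  mul_zero f := by ext w; simp [mul_apply, zero_apply]
  left_distrib f g h := by
    ext w
    simp only [mul_apply, add_apply, mul_add, Finset.sum_add_distrib]
  right_distrib f g h := by
    ext w
    simp only [mul_apply, add_apply, add_mul, Finset.sum_add_distrib]

end NCSeries

/-- The ring `NSym`: the free associative ring `ℤ⟨h₁, h₂, …⟩`. -/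
def NSym : Type := FreeAlgebra ℤ ℕ+

namespace NSym

instance : Ring NSym := inferInstanceAs (Ring (FreeAlgebra ℤ ℕ+))

/-- The free generators of `NSym`. -/
def gen (k : ℕ+) : NSym := FreeAlgebra.ι ℤ k

/-- The complete homogeneous noncommutative symmetric function `h_k`, with `h_0 = 1`. -/
def h : ℕ → NSym
  | 0 => 1
  | k + 1 => gen k.succPNat

@[simp] theorem h_zero : h 0 = 1 := rfl

theorem h_pnat (k : ℕ+) : h k = gen k := by
  obtain ⟨n, rfl⟩ : ∃ n : ℕ, k = n.succPNat := ⟨k.natPred, (PNat.succPNat_natPred k).symm⟩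
  rfl

/-- The universal property of the free ring `NSym`. -/
def lift {A : Type*} [Ring A] [Algebra ℤ A] (f : ℕ+ → A) : NSym →ₐ[ℤ] A :=
  { (FreeAlgebra.lift ℤ f : FreeAlgebra ℤ ℕ+ →ₐ[ℤ] A).toRingHom with
    commutes' := fun r => by
      rw [eq_intCast, eq_intCast]
      exact map_intCast (FreeAlgebra.lift ℤ f : FreeAlgebra ℤ ℕ+ →ₐ[ℤ] A) r }

theorem lift_gen {A : Type*} [Ring A] [Algebra ℤ A] (f : ℕ+ → A) (k : ℕ+) : lift f (gen k) = f k :=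
  FreeAlgebra.lift_ι_apply (R := ℤ) _ _

theorem lift_h {A : Type*} [Ring A] [Algebra ℤ A] (f : ℕ → A) (h0 : f 0 = 1) (k : ℕ) :
    lift (fun k : ℕ+ => f k) (h k) = f k := by
  rcases k with _ | k
  · rw [h_zero, map_one, h0]
  · exact lift_gen _ _

theorem induction {C : NSym → Prop} (hint : ∀ r : ℤ, C (r : NSym)) (hh : ∀ k, C (h k))
    (hmul : ∀ a b, C a → C b → C (a * b)) (hadd : ∀ a b, C a → C b → C (a + b)) (a : NSym) :
    C a := by
  refine FreeAlgebra.induction ℤ ℕ+ (motive := C) ?_ ?_ hmul hadd a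
  · intro r
    have : (algebraMap ℤ (FreeAlgebra ℤ ℕ+) r) = ((r : ℤ) : FreeAlgebra ℤ ℕ+) :=
      eq_intCast (algebraMap ℤ (FreeAlgebra ℤ ℕ+)) r
    rw [this]
    exact hint r
  · intro k
    have := hh k
    rw [h_pnat] at this
    exact this

theorem algHom_ext {A : Type*} [Ring A] [Algebra ℤ A] {f g : NSym →ₐ[ℤ] A} (H : ∀ k, f (h k) = g (h k)) :
    f = g := by
  ext a
  induction a using induction with
  | hint r => simp
  | hh k => exact H k
  | hmul a b ha hb => rw [map_mul, map_mul, ha, hb]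
  | hadd a b ha hb => rw [map_add, map_add, ha, hb]

/-- The coproduct, `Δ h_k = ∑_{0 ≤ i ≤ k} h_i ⊗ h_{k-i}`. -/
def comulHom : NSym →ₐ[ℤ] NSym ⊗[ℤ] NSym :=
  lift fun k : ℕ+ => ∑ p ∈ Finset.HasAntidiagonal.antidiagonal (k : ℕ), h p.1 ⊗ₜ[ℤ] h p.2

theorem comulHom_h (k : ℕ) : comulHom (h k) = ∑ p ∈ Finset.HasAntidiagonal.antidiagonal k, h p.1 ⊗ₜ[ℤ] h p.2 :=
  lift_h (fun k => ∑ p ∈ Finset.HasAntidiagonal.antidiagonal k, h p.1 ⊗ₜ[ℤ] h p.2)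
    (by simp [Algebra.TensorProduct.one_def]) k

/-- The counit, `ε(h_k) = 0` for `k ≥ 1`. -/
def counitHom : NSym →ₐ[ℤ] ℤ := lift fun _ => 0

theorem counitHom_h (k : ℕ) : counitHom (h k) = if k = 0 then 1 else 0 := by
  have := lift_h (fun k => if k = 0 then (1 : ℤ) else 0) rfl k
  have e : (fun k : ℕ+ => if (k : ℕ) = 0 then (1 : ℤ) else 0) = fun _ => 0 := by
    funext k; simp
  rw [e] at this
  exact this

theorem comul_coassoc :
    (Algebra.TensorProduct.assoc ℤ ℤ ℤ NSym NSym NSym).toAlgHom.comp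
      ((Algebra.TensorProduct.map comulHom (.id ℤ NSym)).comp comulHom) =
    (Algebra.TensorProduct.map (.id ℤ NSym) comulHom).comp comulHom := by
  apply algHom_ext
  intro k
  simp only [AlgHom.comp_apply, comulHom_h, map_sum, Algebra.TensorProduct.map_tmul,
    AlgHom.coe_id, id_eq, TensorProduct.sum_tmul, TensorProduct.tmul_sum]
  rw [Finset.sum_sigma', Finset.sum_sigma']
  refine Finset.sum_nbij' (fun x => ⟨(x.2.1, x.2.2 + x.1.2), (x.2.2, x.1.2)⟩)
    (fun x => ⟨(x.1.1 + x.2.1, x.2.2), (x.1.1, x.2.1)⟩) ?_ ?_ ?_ ?_ ?_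
  · rintro ⟨⟨i, j⟩, ⟨a, b⟩⟩ hx
    simp only [Finset.mem_sigma, Finset.HasAntidiagonal.mem_antidiagonal, and_true] at hx ⊢
    omega
  · rintro ⟨⟨i, j⟩, ⟨a, b⟩⟩ hx
    simp only [Finset.mem_sigma, Finset.HasAntidiagonal.mem_antidiagonal, and_true] at hx ⊢
    omega
  · rintro ⟨⟨i, j⟩, ⟨a, b⟩⟩ hx
    simp only [Finset.mem_sigma, Finset.HasAntidiagonal.mem_antidiagonal] at hx
    obtain ⟨rfl, rfl⟩ := hx
    rfl
  · rintro ⟨⟨i, j⟩, ⟨a, b⟩⟩ hx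
    simp only [Finset.mem_sigma, Finset.HasAntidiagonal.mem_antidiagonal] at hx
    obtain ⟨rfl, rfl⟩ := hx
    rfl
  · rintro ⟨⟨i, j⟩, ⟨a, b⟩⟩ hx
    rfl

theorem counit_left : (Algebra.TensorProduct.map counitHom (.id ℤ NSym)).comp comulHom =
    (Algebra.TensorProduct.lid ℤ NSym).symm := by
  apply algHom_ext
  intro k
  simp only [AlgHom.comp_apply, comulHom_h, map_sum, Algebra.TensorProduct.map_tmul, counitHom_h]
  rw [Finset.sum_eq_single (0, k)]
  · simp
  · rintro ⟨i, j⟩ hp hne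
    have : i ≠ 0 := by
      rintro rfl
      simp only [Finset.HasAntidiagonal.mem_antidiagonal, zero_add] at hp
      exact hne (by rw [hp])
    simp [this]
  · simp

theorem counit_right : (Algebra.TensorProduct.map (.id ℤ NSym) counitHom).comp comulHom =
    (Algebra.TensorProduct.rid ℤ ℤ NSym).symm := by
  apply algHom_ext
  intro k
  simp only [AlgHom.comp_apply, comulHom_h, map_sum, Algebra.TensorProduct.map_tmul, counitHom_h]
  rw [Finset.sum_eq_single (k, 0)]
  · simp
  · rintro ⟨i, j⟩ hp hne
    have : j ≠ 0 := by
      rintro rfl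
      simp only [Finset.HasAntidiagonal.mem_antidiagonal, add_zero] at hp
      exact hne (by rw [hp])
    simp [this]
  · simp

instance : Bialgebra ℤ NSym :=
  Bialgebra.ofAlgHom comulHom counitHom comul_coassoc counit_left counit_right

/-- The images `S(h_n)` of the generators under the antipode, determined by
`∑_{i + j = n} S(h_i) h_j = 0` for `n ≥ 1`. -/
def antipodeH : ℕ → NSym
  | 0 => 1
  | n + 1 => -∑ i : Fin (n + 1), antipodeH i * h (n + 1 - i)

theorem antipodeH_left (n : ℕ) :
    ∑ p ∈ Finset.HasAntidiagonal.antidiagonal n, antipodeH p.1 * h p.2 =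
      if n = 0 then 1 else 0 := by
  rcases n with _ | n
  · simp [antipodeH]
  · rw [Finset.Nat.sum_antidiagonal_succ', antipodeH,
      Finset.Nat.sum_antidiagonal_eq_sum_range_succ_mk,
      Finset.sum_range fun k => antipodeH k * h (n - k + 1)]
    simp only [h_zero, mul_one, Nat.add_eq_zero_iff, one_ne_zero, and_false, if_false]
    rw [neg_add_eq_zero]
    refine Finset.sum_congr rfl fun i _ => ?_
    congr 2
    omega

/-- The solution of `∑_{i + j = n} h_i S(h_j) = 0`, `n ≥ 1`; it equals `antipodeH`. -/
def antipodeH' : ℕ → NSym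
  | 0 => 1
  | n + 1 => -∑ i : Fin (n + 1), h (n + 1 - i) * antipodeH' i

theorem antipodeH'_right (n : ℕ) :
    ∑ p ∈ Finset.HasAntidiagonal.antidiagonal n, h p.1 * antipodeH' p.2 =
      if n = 0 then 1 else 0 := by
  rcases n with _ | n
  · simp [antipodeH']
  · rw [Finset.Nat.sum_antidiagonal_succ, antipodeH', ← Finset.Nat.sum_antidiagonal_swap,
      Finset.Nat.sum_antidiagonal_eq_sum_range_succ_mk]
    simp only [Prod.fst_swap, Prod.snd_swap]
    rw [Finset.sum_range fun k => h (n - k + 1) * antipodeH' k]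
    simp only [h_zero, one_mul, Nat.add_eq_zero_iff, one_ne_zero, and_false, if_false]
    rw [neg_add_eq_zero]
    refine Finset.sum_congr rfl fun i _ => ?_
    congr 2
    omega

theorem antipodeH_right (n : ℕ) :
    ∑ p ∈ Finset.HasAntidiagonal.antidiagonal n, h p.1 * antipodeH p.2 =
      if n = 0 then 1 else 0 := by
  let u : PowerSeries NSym := PowerSeries.mk h
  let v : PowerSeries NSym := PowerSeries.mk antipodeH
  have h1 : v * u = 1 := by
    ext n
    rw [PowerSeries.coeff_mul, PowerSeries.coeff_one]
    simpa [u, v] using antipodeH_left n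
  have h2 : u * PowerSeries.mk antipodeH' = 1 := by
    ext n
    rw [PowerSeries.coeff_mul, PowerSeries.coeff_one]
    simpa [u] using antipodeH'_right n
  have h3 : u * v = 1 := by
    rw [left_inv_eq_right_inv h1 h2, h2]
  have := congrArg (PowerSeries.coeff n) h3
  rw [PowerSeries.coeff_mul, PowerSeries.coeff_one] at this
  simpa [u, v] using this

/-- The antipode, an anti-homomorphism of rings. -/
def antipodeHom : NSym →ₐ[ℤ] NSymᵐᵒᵖ := lift fun k => MulOpposite.op (antipodeH k)

/-- The antipode as a linear map. -/
def antipode : NSym →ₗ[ℤ] NSym :=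
  (MulOpposite.opAddEquiv.symm.toAddMonoidHom.comp
    (antipodeHom : NSym →+ NSymᵐᵒᵖ)).toIntLinearMap

theorem antipode_h (k : ℕ) : antipode (h k) = antipodeH k :=
  congrArg MulOpposite.unop (lift_h (fun k => MulOpposite.op (antipodeH k)) (by simp [antipodeH]) k)

theorem antipode_mul (a b : NSym) : antipode (a * b) = antipode b * antipode a :=
  congrArg MulOpposite.unop (map_mul antipodeHom a b)

theorem antipode_one : antipode 1 = 1 :=
  congrArg MulOpposite.unop (map_one antipodeHom)

theorem convLeft_mul (x : NSym ⊗[ℤ] NSym) (b c : NSym) :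
    LinearMap.mul' ℤ NSym (antipode.rTensor NSym (x * (b ⊗ₜ c))) =
      antipode b * LinearMap.mul' ℤ NSym (antipode.rTensor NSym x) * c := by
  induction x with
  | zero => simp
  | tmul s t => simp [Algebra.TensorProduct.tmul_mul_tmul, antipode_mul, mul_assoc]
  | add x y hx hy => rw [add_mul, map_add, map_add, hx, hy, map_add, map_add, mul_add, add_mul]

theorem convRight_mul (x : NSym ⊗[ℤ] NSym) (b c : NSym) :
    LinearMap.mul' ℤ NSym (antipode.lTensor NSym ((b ⊗ₜ c) * x)) =
      b * LinearMap.mul' ℤ NSym (antipode.lTensor NSym x) * antipode c := by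
  induction x with
  | zero => simp
  | tmul s t => simp [Algebra.TensorProduct.tmul_mul_tmul, antipode_mul, mul_assoc]
  | add x y hx hy => rw [mul_add, map_add, map_add, hx, hy, map_add, map_add, mul_add, add_mul]

theorem antipode_left_aux (a : NSym) :
    LinearMap.mul' ℤ NSym (antipode.rTensor NSym (comulHom a)) = (counitHom a : NSym) := by
  induction a using induction with
  | hint r =>
    rw [map_intCast comulHom, map_intCast counitHom, ← zsmul_one, map_zsmul, map_zsmul,
      Algebra.TensorProduct.one_def, LinearMap.rTensor_tmul, antipode_one]
    simp
  | hh k => simp [comulHom_h, counitHom_h, antipode_h, antipodeH_left]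
  | hadd a b ha hb => simp only [map_add, ha, hb, Int.cast_add]
  | hmul a b ha hb =>
    have key : ∀ y : NSym ⊗[ℤ] NSym, LinearMap.mul' ℤ NSym (antipode.rTensor NSym (comulHom a * y)) =
        (counitHom a : NSym) * LinearMap.mul' ℤ NSym (antipode.rTensor NSym y) := by
      intro y
      induction y with
      | zero => simp
      | tmul s t =>
        rw [convLeft_mul, ha, ← Int.cast_comm, mul_assoc]
        rfl
      | add x y hx hy => rw [mul_add, map_add, map_add, hx, hy, map_add, map_add, mul_add]
    rw [map_mul, key, hb, map_mul, Int.cast_mul]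

theorem antipode_right_aux (a : NSym) :
    LinearMap.mul' ℤ NSym (antipode.lTensor NSym (comulHom a)) = (counitHom a : NSym) := by
  induction a using induction with
  | hint r =>
    rw [map_intCast comulHom, map_intCast counitHom, ← zsmul_one, map_zsmul, map_zsmul,
      Algebra.TensorProduct.one_def, LinearMap.lTensor_tmul, antipode_one]
    simp
  | hh k => simp [comulHom_h, counitHom_h, antipode_h, antipodeH_right]
  | hadd a b ha hb => simp only [map_add, ha, hb, Int.cast_add]
  | hmul a b ha hb =>
    have key : ∀ y : NSym ⊗[ℤ] NSym, LinearMap.mul' ℤ NSym (antipode.lTensor NSym (y * comulHom b)) =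
        LinearMap.mul' ℤ NSym (antipode.lTensor NSym y) * (counitHom b : NSym) := by
      intro y
      induction y with
      | zero => simp
      | tmul s t =>
        rw [convRight_mul, hb, mul_assoc, Int.cast_comm, ← mul_assoc]
        rfl
      | add x y hx hy => rw [add_mul, map_add, map_add, hx, hy, map_add, map_add, add_mul]
    rw [map_mul, key, ha, map_mul, Int.cast_mul]

/-- The Hopf algebra structure of `NSym`. -/
instance : HopfAlgebra ℤ NSym where
  antipode := antipode
  mul_antipode_rTensor_comul := LinearMap.ext antipode_left_aux
  mul_antipode_lTensor_comul := LinearMap.ext antipode_right_aux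

/-- `h_α = h_{α_1} ⋯ h_{α_ℓ}` for a composition `α`. -/
def hComp {n : ℕ} (α : Composition n) : NSym := (α.blocks.map h).prod

/-- The noncommutative ribbon Schur function
`s_α = ∑_{β ≼ α} (-1)^{ℓ(α) - ℓ(β)} h_β` of a composition `α`, where `β ≼ α` means that
`D(β) ⊆ D(α)`, i.e. that `α` refines `β`. -/
def s {n : ℕ} (α : Composition n) : NSym :=
  ∑ β ∈ Finset.univ.filter fun β : Composition n => β.boundaries ⊆ α.boundaries,
    (-1) ^ (α.length - β.length) * hComp β

/-- The series `∑_{i_1 ≤ ⋯ ≤ i_k} x_{i_1} ⋯ x_{i_k}` in the variables `x_i`, `i ∈ ℤ`. -/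
def hSeries (k : ℕ) : NCSeries ℤ := fun w => if w.length = k ∧ w.Pairwise (· ≤ ·) then 1 else 0

/-- The realization of `NSym` by noncommutative power series,
`h_k ↦ ∑_{i_1 ≤ ⋯ ≤ i_k} x_{i_1} ⋯ x_{i_k}`. -/
def realize : NSym →ₐ[ℤ] NCSeries ℤ := lift fun k => hSeries k

end NSym
end NSym

open Classical in
/-- The generating series `s_α` of the semistandard tableaux (with integer entries) of generalized
ribbon shape `α`, a tableau contributing its reading word: the coefficient of a word `w` is `1` if
`w` is the reading word of such a tableau, and `0` otherwise. -/
def GenRibbon.series {n : ℕ} (α : GenRibbon n) : NCSeries ℤ := fun w =>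
  if ∃ hw : w.length = n, α.IsSemistandard fun p : Fin n => w.get (p.cast hw.symm) then 1 else 0

end HZero

end

open HZero

noncomputable section
namespace HZero
namespace GenRibbon

/-! ### Rows, columns and standard tableaux -/

section shape
variable {n : ℕ} (α : GenRibbon n)

/-! List the boxes of a generalized ribbon in reading order. Semistandardness is then a condition on
consecutive boxes only: a step to the right forbids a descent of the reading word, an upward step
forces one, and a gap imposes nothing. When a gap of `α` is resolved, the standard tableaux of `α`
are therefore divided between the two resolutions, according to whether the word descends at the
gap. Those with a descent span a submodule, the others give a basis of the quotient, and one obtains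
an exact sequence `0 → P_up → P_α → P_right → 0` (`P.exact_ofUp_toRight`). Statements about all
shapes reduce along it (`upInduction`) to shapes whose components are rows.

For such row shapes `P_α` is cyclic. If all components are single boxes it is the regular module: it
has dimension `n!`, and a coset argument bounds the dimension of `H_n(0)` by `n!` (`regularEquiv`).
A general row shape gives a retract of the regular module through symmetrization along rows, so it
is projective; the exact sequences then split and every `P_α` is projective.

In a standard tableau of size `m + k` the boxes with the `m` smallest entries form the part `β` of a
decomposition, and the generators of the parabolic subalgebra rearrange the two parts separately.
This is the first description of the restriction (`resEquiv`). Applied to isolated boxes it also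
shows that `par` is injective.

The remaining module theory is governed by characters. Every nonzero `H_n(0)`-module contains a
common eigenvector, the characters `χ_D` correspond to the subsets `D` of `{1, …, n - 1}`, and `dim
Hom(P_α, χ_D)` is `1` or `0` according to whether `D` is an admissible descent set for `α`
(`mult_P`). The ribbons thus give projectives dual to the characters. An abstract argument
(`DualSystem`) concludes that projective modules are classified by these multiplicities and that
`K₀` is free with them as coordinates; the same holds for tensor products of such algebras. This
yields the second description of the restriction and the identification of `K₀(A ⊗ B)` with `K₀(A) ⊗
K₀(B)`.

A class is encoded by the series whose coefficient at a word `w` is its multiplicity at the descent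
set of `w`. This encoding is injective, sends `[P_α]` to the series of semistandard tableaux, and,
by Frobenius reciprocity, turns induction into the Cauchy product. On the other side,
inclusion-exclusion shows that the realization of `s_α` is the sum of the words with descent set
that of `α`. Comparing the two inside the ring of series makes `h_k ↦ [P_(k)]` and `[P_α] ↦ s_α`
mutually inverse ring isomorphisms.

The coalgebra structure and the antipode of `K₀` are transported from `NSym`. That the coproduct is
restriction need only be checked on row shapes, whose classes generate: there the characteristic is
a product of `h`'s, and expanding its coproduct amounts to cutting each row into an initial and a
final segment, which is the same as a decomposition (`NoUp.comul_ofShape`). -/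

theorem row_mono {p q : Fin n} (h : p ≤ q) : α.row p ≤ α.row q :=
  Finset.card_le_card fun r hr => by
    simp only [Finset.mem_filter, Finset.mem_univ, true_and] at hr ⊢
    exact ⟨by omega, hr.2⟩

theorem col_mono {p q : Fin n} (h : p ≤ q) : α.col p ≤ α.col q :=
  Finset.card_le_card fun r hr => by
    simp only [Finset.mem_filter, Finset.mem_univ, true_and] at hr ⊢
    exact ⟨by omega, hr.2⟩

theorem row_lt {p q : Fin n} {r : Fin (n - 1)} (h1 : (p : ℕ) ≤ r) (h2 : (r : ℕ) < q)
    (hr : α.step r ≠ Step.right) : α.row p < α.row q :=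
  Finset.card_lt_card <| (Finset.ssubset_iff_of_subset fun s hs => by
    simp only [Finset.mem_filter, Finset.mem_univ, true_and] at hs ⊢
    exact ⟨by omega, hs.2⟩).2 ⟨r, by simp [h2, hr], by simp [h1]⟩

theorem col_lt {p q : Fin n} {r : Fin (n - 1)} (h1 : (p : ℕ) ≤ r) (h2 : (r : ℕ) < q)
    (hr : α.step r ≠ Step.up) : α.col p < α.col q :=
  Finset.card_lt_card <| (Finset.ssubset_iff_of_subset fun s hs => by
    simp only [Finset.mem_filter, Finset.mem_univ, true_and] at hs ⊢
    exact ⟨by omega, hs.2⟩).2 ⟨r, by simp [h2, hr], by simp [h1]⟩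

theorem row_eq_iff {p q : Fin n} (h : p ≤ q) : α.row p = α.row q ↔
    ∀ r : Fin (n - 1), (p : ℕ) ≤ r → (r : ℕ) < q → α.step r = Step.right := by
  constructor
  · intro he r h1 h2
    by_contra hr
    exact (α.row_lt h1 h2 hr).ne he
  · intro H
    refine congrArg Finset.card (Finset.filter_congr fun r _ => ?_)
    constructor
    · exact fun hr => ⟨by omega, hr.2⟩
    · refine fun hr => ⟨?_, hr.2⟩
      by_contra hlt
      exact hr.2 (H r (by omega) hr.1)

theorem col_eq_iff {p q : Fin n} (h : p ≤ q) : α.col p = α.col q ↔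
    ∀ r : Fin (n - 1), (p : ℕ) ≤ r → (r : ℕ) < q → α.step r = Step.up := by
  constructor
  · intro he r h1 h2
    by_contra hr
    exact (α.col_lt h1 h2 hr).ne he
  · intro H
    refine congrArg Finset.card (Finset.filter_congr fun r _ => ?_)
    constructor
    · exact fun hr => ⟨by omega, hr.2⟩
    · refine fun hr => ⟨?_, hr.2⟩
      by_contra hlt
      exact hr.2 (H r (by omega) hr.1)

@[simp] theorem val_lo (q : Fin (n - 1)) : ((lo q : Fin n) : ℕ) = q := rfl
@[simp] theorem val_hi (q : Fin (n - 1)) : ((hi q : Fin n) : ℕ) = q + 1 := rfl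

theorem row_lo_eq_iff (q : Fin (n - 1)) : α.row (lo q) = α.row (hi q) ↔ α.step q = Step.right := by
  rw [row_eq_iff _ (by simp [Fin.le_def])]
  constructor
  · intro h; exact h q le_rfl (Nat.lt_succ_self _)
  · intro h r h1 h2
    have : r = q := Fin.ext (by simp at h1 h2; omega)
    rwa [this]

theorem col_lo_eq_iff (q : Fin (n - 1)) : α.col (lo q) = α.col (hi q) ↔ α.step q = Step.up := by
  rw [col_eq_iff _ (by simp [Fin.le_def])]
  constructor
  · intro h; exact h q le_rfl (Nat.lt_succ_self _)
  · intro h r h1 h2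
    have : r = q := Fin.ext (by simp at h1 h2; omega)
    rwa [this]

/-- Chains of relations between consecutive elements of an interval. -/
theorem rel_of_consecutive {X : Type*} (R : X → X → Prop) [IsTrans X R] (T : Fin n → X)
    {p q : Fin n} (h : p < q)
    (H : ∀ r : Fin (n - 1), (p : ℕ) ≤ r → (r : ℕ) < q → R (T (lo r)) (T (hi r))) :
    R (T p) (T q) := by
  obtain ⟨q, hq⟩ := q
  induction q with
  | zero => simp [Fin.lt_def] at h
  | succ q ih =>
    have hr := H ⟨q, by omega⟩ (by simp [Fin.lt_def] at h ⊢; omega) (by simp)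
    rcases Nat.lt_or_ge p q with h' | h'
    · exact _root_.trans (ih (by omega) h' fun r h1 h2 => H r h1 (by simp at h2 ⊢; omega)) hr
    · have : p = ⟨q, by omega⟩ := Fin.ext (by simp [Fin.lt_def] at h ⊢; omega)
      rw [this]
      exact hr

/-- Semistandardness is a condition on consecutive boxes. -/
theorem isSemistandard_iff {X : Type*} [LinearOrder X] (T : Fin n → X) : α.IsSemistandard T ↔
    ∀ q : Fin (n - 1), (α.step q = Step.right → T (lo q) ≤ T (hi q)) ∧
      (α.step q = Step.up → T (hi q) < T (lo q)) := by
  constructor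
  · rintro ⟨h1, h2⟩ q
    refine ⟨fun hq => h1 _ _ ((α.row_lo_eq_iff q).2 hq) ?_, fun hq => h2 _ _ ?_ ?_⟩
    · exact α.col_lt (r := q) le_rfl (Nat.lt_succ_self _) (by simp [hq])
    · exact ((α.col_lo_eq_iff q).2 hq).symm
    · exact α.row_lt (r := q) le_rfl (Nat.lt_succ_self _) (by simp [hq])
  · intro H
    refine ⟨fun p q hr hc => ?_, fun p q hc hr => ?_⟩
    · have hpq : p < q := by
        by_contra h
        exact (α.col_mono (not_lt.1 h)).not_gt hc
      exact rel_of_consecutive (· ≤ ·) T hpq fun r h1 h2 =>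
        (H r).1 ((α.row_eq_iff hpq.le).1 hr r h1 h2)
    · have hpq : q < p := by
        by_contra h
        exact (α.row_mono (not_lt.1 h)).not_gt hr
      exact rel_of_consecutive (fun x y => y < x) T hpq fun r h1 h2 =>
        (H r).2 ((α.col_eq_iff hpq.le).1 hc.symm r h1 h2)

end shape

namespace StdTableau
variable {n : ℕ} {α : GenRibbon n} (T : α.StdTableau)

theorem lt_of_right {q : Fin (n - 1)} (h : α.step q = Step.right) : T.perm (lo q) < T.perm (hi q) :=
  (((α.isSemistandard_iff _).1 T.semistandard q).1 h).lt_of_ne fun e => by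
    have := congrArg Fin.val (T.perm.injective e)
    simp at this

theorem lt_of_up {q : Fin (n - 1)} (h : α.step q = Step.up) : T.perm (hi q) < T.perm (lo q) :=
  ((α.isSemistandard_iff _).1 T.semistandard q).2 h

/-- The box containing an entry. -/
def box (e : Fin n) : Fin n := T.perm.symm e

theorem rowOf_eq (e : Fin n) : T.rowOf e = α.row (T.box e) := rfl

@[simp] theorem perm_box (e : Fin n) : T.perm (T.box e) = e := T.perm.apply_symm_apply e

theorem box_ne (i : Fin (n - 1)) : T.box (lo i) ≠ T.box (hi i) := fun e => by
  have := congrArg Fin.val (T.perm.symm.injective e)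
  simp at this

/-- Rows weakly increase in reading order, and entries increase along a row, so if the larger entry
comes first the two boxes cannot share a row. The box comparison, unlike the row comparison, depends
only on the filling and not on the shape. -/
theorem rowOf_gt (i : Fin (n - 1)) :
    T.rowOf (hi i) < T.rowOf (lo i) ↔ T.box (hi i) < T.box (lo i) := by
  constructor
  · intro h
    by_contra h'
    exact (α.row_mono (not_lt.1 h')).not_gt h
  · intro h
    refine (α.row_mono h.le).lt_of_ne fun he => ?_
    have := T.semistandard.1 _ _ he ?_
    · rw [← rowOf_eq] at he
      simp only [perm_box, Fin.le_def, val_lo, val_hi] at this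
      omega
    · exact α.col_lt (r := ⟨T.box (hi i), by omega⟩) le_rfl h
        (by rw [(α.row_eq_iff h.le).1 he _ le_rfl h]; simp)

/-- Entries increase strictly along a row and nothing lies between two consecutive integers, so
consecutive entries in one row occupy neighbouring boxes. The middle case of the action is thereby
detected by a single step of the shape. -/
theorem rowOf_eq_iff (i : Fin (n - 1)) : T.rowOf (lo i) = T.rowOf (hi i) ↔
    ∃ q : Fin (n - 1), α.step q = Step.right ∧ T.box (lo i) = lo q ∧ T.box (hi i) = hi q := by
  constructor
  · intro he
    have hlt : T.box (lo i) < T.box (hi i) := by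
      refine lt_of_le_of_ne ?_ (T.box_ne i)
      by_contra h'
      exact ((T.rowOf_gt i).2 (not_le.1 h')).ne he.symm
    have H := (α.row_eq_iff hlt.le).1 he
    refine ⟨⟨T.box (lo i), by omega⟩, H _ le_rfl hlt, rfl, ?_⟩
    set b : Fin n := hi ⟨T.box (lo i), by omega⟩ with hb
    have hbv : (b : ℕ) = T.box (lo i) + 1 := rfl
    by_contra hne
    have hlt' : b < T.box (hi i) := lt_of_le_of_ne (by rw [Fin.le_def]; omega) fun e => hne e.symm
    have h1 : T.perm (lo ⟨T.box (lo i), by omega⟩) < T.perm b := T.lt_of_right (H _ le_rfl hlt)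
    have h2 : T.perm b < T.perm (T.box (hi i)) :=
      rel_of_consecutive (· < ·) T.perm hlt' fun r h1 h2 => T.lt_of_right (H r (by omega) h2)
    have e1 : (lo ⟨T.box (lo i), by omega⟩ : Fin n) = T.box (lo i) := rfl
    rw [e1] at h1
    simp only [perm_box, Fin.lt_def, val_lo, val_hi] at h1 h2
    omega
  · rintro ⟨q, hq, h1, h2⟩
    rw [rowOf_eq, rowOf_eq, h1, h2, row_lo_eq_iff, hq]

theorem rowOf_lt (i : Fin (n - 1)) : T.rowOf (lo i) < T.rowOf (hi i) ↔
    T.box (lo i) < T.box (hi i) ∧ ¬ T.rowOf (lo i) = T.rowOf (hi i) := by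
  have h1 := T.rowOf_gt i
  have h2 : (T.box (lo i) : ℕ) ≠ T.box (hi i) := fun e => T.box_ne i (Fin.ext e)
  simp only [Fin.lt_def] at *
  omega

end StdTableau

/-- Exchanging consecutive entries does not change the order of the entries in other pairs. -/
theorem swap_lt_swap {n : ℕ} {a b : Fin n} (hab : (a : ℕ) + 1 = b) {x y : Fin n} (hxy : x < y)
    (hne : ¬ (x = a ∧ y = b)) : Equiv.swap a b x < Equiv.swap a b y := by
  rw [Fin.ext_iff, Fin.ext_iff] at hne
  rw [Fin.lt_def] at hxy ⊢
  simp only [Equiv.swap_apply_def, Fin.ext_iff]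
  split_ifs <;> omega

/-! ### The generators acting on the tableau basis -/

section action
variable (F : Type u) [Field F] {n : ℕ} {α : GenRibbon n}

variable (α) in
/-- The basis of `P_α` formed by the standard tableaux. -/
def P.basis : Module.Basis α.StdTableau F (P F α) :=
  (Finsupp.basisSingleOne : Module.Basis α.StdTableau F (α.StdTableau →₀ F))

/-- The basis vector of `P_α` given by a standard tableau. -/
def P.single (T : α.StdTableau) : P F α := P.basis F α T

theorem P.single_def (T : α.StdTableau) : P.single F T = Finsupp.single T (1 : F) :=
  congrFun (Finsupp.coe_basisSingleOne (R := F) (ι := α.StdTableau)) T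

theorem pi_smul (i : Fin (n - 1)) (x : P F α) :
    (pi F i : H F n) • x = (show P F α from piBar F α i x) + x := by
  rw [P_smul_def, rep, H.lift_pi]
  rfl

theorem pi_smul_single_of_gt (i : Fin (n - 1)) (T : α.StdTableau)
    (h : T.box (hi i) < T.box (lo i)) : (pi F i : H F n) • P.single F T = 0 := by
  have e : (piBar F α i (P.single F T) : α.StdTableau →₀ F) = -P.single F T := by
    refine ((congrArg (piBar F α i) (P.single_def F T)).trans (piBar_single F i T)).trans ?_
    rw [dif_neg ((T.rowOf_gt i).2 h).le.not_gt, if_neg ((T.rowOf_gt i).2 h).ne']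
    exact congrArg Neg.neg (P.single_def F T).symm
  exact (pi_smul F i _).trans ((congrArg (· + P.single F T) e).trans (neg_add_cancel _))

theorem pi_smul_single_of_eq (i : Fin (n - 1)) (T : α.StdTableau)
    (h : T.rowOf (lo i) = T.rowOf (hi i)) :
    (pi F i : H F n) • P.single F T = P.single F T := by
  have e : (piBar F α i (P.single F T) : α.StdTableau →₀ F) = 0 := by
    refine ((congrArg (piBar F α i) (P.single_def F T)).trans (piBar_single F i T)).trans ?_
    rw [dif_neg h.not_lt, if_pos h]
  exact (pi_smul F i _).trans ((congrArg (· + P.single F T) e).trans (zero_add _))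

theorem pi_smul_single_of_lt (i : Fin (n - 1)) (T : α.StdTableau)
    (h : T.rowOf (lo i) < T.rowOf (hi i)) : (pi F i : H F n) • P.single F T =
      P.single F (T.swapEntries (lo i) (hi i) rfl h) + P.single F T := by
  have e : (piBar F α i (P.single F T) : α.StdTableau →₀ F) =
      P.single F (T.swapEntries (lo i) (hi i) rfl h) := by
    refine ((congrArg (piBar F α i) (P.single_def F T)).trans (piBar_single F i T)).trans ?_
    rw [dif_pos h]
    exact (P.single_def F _).symm
  exact (pi_smul F i _).trans (congrArg (· + P.single F T) e)

end action
end GenRibbon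
end HZero
end

noncomputable section
namespace HZero

/-! ### Homomorphisms out of the modules `P_α` -/

section
variable {F : Type u} [Field F]

/-- A linear map that sends a basis injectively into a basis is injective. -/
theorem injective_of_basis {ι ι' M N : Type*} [AddCommGroup M] [AddCommGroup N] [Module F M]
    [Module F N] (b : Module.Basis ι F M) (b' : Module.Basis ι' F N) (f : M →ₗ[F] N) {g : ι → ι'}
    (hg : Function.Injective g) (h : ∀ i, f (b i) = b' (g i)) : Function.Injective f := by
  have hli : LinearIndependent F (f ∘ b) := by
    rw [show f ∘ b = b' ∘ g from funext h]
    exact b'.linearIndependent.comp _ hg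
  refine (injective_iff_map_eq_zero f).2 fun x hx => ?_
  apply b.repr.map_eq_zero_iff.1
  rw [← b.linearCombination_repr x, LinearMap.map_finsupp_linearCombination] at hx
  exact linearIndependent_iff.1 hli _ hx

/-- A linear map that commutes with the generators of `H_n(0)` is `H_n(0)`-linear. -/
def H.linearMap {n : ℕ} {M N : Type*} [AddCommGroup M] [AddCommGroup N] [Module F M] [Module F N]
    [Module (H F n) M] [Module (H F n) N] [IsScalarTower F (H F n) M] [IsScalarTower F (H F n) N]
    (f : M →ₗ[F] N) (h : ∀ i x, f ((pi F i : H F n) • x) = (pi F i : H F n) • f x) :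
    M →ₗ[H F n] N where
  toFun := f
  map_add' := f.map_add
  map_smul' a := by
    rw [RingHom.id_apply]
    induction a using H.induction with
    | halg r => intro x; rw [algebraMap_smul, algebraMap_smul, map_smul]
    | hpi i => exact h i
    | hmul a b ha hb => intro x; rw [mul_smul, mul_smul, ha, hb]
    | hadd a b ha hb => intro x; rw [add_smul, add_smul, map_add, ha, hb]

end

namespace GenRibbon
section
variable {F : Type u} [Field F] {n : ℕ} {α : GenRibbon n}

/-- The homomorphism out of `P_α` with given values on the standard tableaux. -/
def P.lift {N : Type*} [AddCommGroup N] [Module F N] [Module (H F n) N]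
    [IsScalarTower F (H F n) N] (f : α.StdTableau → N)
    (h1 : ∀ i (T : α.StdTableau), T.box (hi i) < T.box (lo i) → (pi F i : H F n) • f T = 0)
    (h2 : ∀ i (T : α.StdTableau), T.rowOf (lo i) = T.rowOf (hi i) → (pi F i : H F n) • f T = f T)
    (h3 : ∀ i (T : α.StdTableau) (h : T.rowOf (lo i) < T.rowOf (hi i)),
      (pi F i : H F n) • f T = f (T.swapEntries (lo i) (hi i) rfl h) + f T) :
    P F α →ₗ[H F n] N :=
  H.linearMap ((P.basis F α).constr F f) fun i x => by
    have key : ∀ T, (P.basis F α).constr F f ((pi F i : H F n) • P.single F T) =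
        (pi F i : H F n) • (P.basis F α).constr F f (P.single F T) := by
      intro T
      have e : ∀ T, (P.basis F α).constr F f (P.single F T) = f T :=
        fun T => (P.basis F α).constr_basis F f T
      rcases lt_trichotomy (T.rowOf (lo i)) (T.rowOf (hi i)) with h | h | h
      · rw [pi_smul_single_of_lt F i T h, map_add, e, e, h3 i T h]
      · rw [pi_smul_single_of_eq F i T h, e, h2 i T h]
      · rw [pi_smul_single_of_gt F i T ((T.rowOf_gt i).1 h), map_zero, e,
          h1 i T ((T.rowOf_gt i).1 h)]
    exact LinearMap.congr_fun ((P.basis F α).ext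
      (f₁ := (P.basis F α).constr F f ∘ₗ Algebra.lsmul F F (P F α) (pi F i : H F n))
      (f₂ := Algebra.lsmul F F N (pi F i : H F n) ∘ₗ (P.basis F α).constr F f) key) x

@[simp] theorem P.lift_single {N : Type*} [AddCommGroup N] [Module F N] [Module (H F n) N]
    [IsScalarTower F (H F n) N] (f : α.StdTableau → N) (h1 h2 h3) (T : α.StdTableau) :
    P.lift (F := F) f h1 h2 h3 (P.single F T) = f T :=
  (P.basis F α).constr_basis F f T

/-- Homomorphisms out of `P_α` are determined by their values on the standard tableaux. -/
theorem P.hom_ext {N : Type*} [AddCommGroup N] [Module F N] [Module (H F n) N]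
    [IsScalarTower F (H F n) N] {f g : P F α →ₗ[H F n] N}
    (h : ∀ T, f (P.single F T) = g (P.single F T)) : f = g := by
  have := (P.basis F α).ext (f₁ := f.restrictScalars F) (f₂ := g.restrictScalars F) h
  exact LinearMap.ext fun x => LinearMap.congr_fun this x

instance : Finite α.StdTableau :=
  Finite.of_injective (StdTableau.perm (α := α)) fun _ _ h => StdTableau.ext h

instance : Module.Finite F (P F α) := Module.Finite.of_basis (P.basis F α)

instance : Module.Finite (H F n) (P F α) := Module.Finite.of_restrictScalars_finite F (H F n) _

/-! ### Comparing shapes -/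

/-- A shape obtained from `α` by replacing some of the gaps by ascending steps. -/
def GapToUp (α α' : GenRibbon n) : Prop :=
  ∀ q, α'.step q = α.step q ∨ (α.step q = Step.gap ∧ α'.step q = Step.up)

/-- A shape obtained from `α` by replacing some of the gaps by steps to the right. -/
def GapToRight (α α' : GenRibbon n) : Prop :=
  ∀ q, α'.step q = α.step q ∨ (α.step q = Step.gap ∧ α'.step q = Step.right)

variable {α' : GenRibbon n}

theorem GapToUp.isSemistandard (h : GapToUp α α') {X : Type*} [LinearOrder X] {T : Fin n → X}
    (hT : α'.IsSemistandard T) : α.IsSemistandard T := by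
  rw [isSemistandard_iff] at hT ⊢
  intro q
  rcases h q with e | e
  · rw [← e]; exact hT q
  · simp [e.1]

theorem GapToRight.isSemistandard (h : GapToRight α α') {X : Type*} [LinearOrder X]
    {T : Fin n → X} (hT : α'.IsSemistandard T) : α.IsSemistandard T := by
  rw [isSemistandard_iff] at hT ⊢
  intro q
  rcases h q with e | e
  · rw [← e]; exact hT q
  · simp [e.1]

/-- The two shapes have the same steps to the right, and these are all that sharing a row depends
on. For `GapToRight` this fails, since new right steps appear; hence the extra case in `P.toRight`.
-/
theorem GapToUp.rowOf_eq_iff (h : GapToUp α α') (T : α'.StdTableau) (T' : α.StdTableau)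
    (e : T'.perm = T.perm) (i : Fin (n - 1)) :
    T'.rowOf (lo i) = T'.rowOf (hi i) ↔ T.rowOf (lo i) = T.rowOf (hi i) := by
  rw [StdTableau.rowOf_eq_iff, StdTableau.rowOf_eq_iff, StdTableau.box, StdTableau.box,
    StdTableau.box, StdTableau.box, e]
  refine exists_congr fun q => and_congr_left fun _ => ?_
  rcases h q with e | e
  · rw [e]
  · simp [e.1, e.2]

/-- The inclusion `P_{α'} → P_α`, where `α'` is obtained from `α` by replacing gaps by ascending
steps. -/
def P.ofUp (h : GapToUp α α') : P F α' →ₗ[H F n] P F α :=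
  P.lift (fun T => P.single F ⟨T.perm, h.isSemistandard T.semistandard⟩)
    (fun i T hi => pi_smul_single_of_gt F i _ hi)
    (fun i T hi => pi_smul_single_of_eq F i _ ((h.rowOf_eq_iff T _ rfl i).2 hi))
    (fun i T hi => by
      refine pi_smul_single_of_lt F i _ ?_
      rw [StdTableau.rowOf_lt] at hi ⊢
      exact ⟨hi.1, fun he => hi.2 ((h.rowOf_eq_iff T _ rfl i).1 he)⟩)

open Classical in
/-- The projection `P_α → P_{α'}`, where `α'` is obtained from `α` by replacing gaps by steps to
the right. -/
def P.toRight (h : GapToRight α α') : P F α →ₗ[H F n] P F α' :=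
  P.lift (fun T => if hT : α'.IsSemistandard T.perm then P.single F ⟨T.perm, hT⟩ else 0)
    (fun i T hi => by
      split_ifs with hT
      · exact pi_smul_single_of_gt F i _ hi
      · exact smul_zero _)
    (fun i T he => by
      split_ifs with hT
      · refine pi_smul_single_of_eq F i _ ?_
        rw [StdTableau.rowOf_eq_iff] at he ⊢
        obtain ⟨q, hq, h1, h2⟩ := he
        refine ⟨q, ?_, h1, h2⟩
        rcases h q with e | e
        · rw [e, hq]
        · exact e.2
      · exact smul_zero _)
    (fun i T hlt => by
      have hbox := ((T.rowOf_lt i).1 hlt).1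
      by_cases hT : α'.IsSemistandard T.perm
      · rw [dif_pos hT]
        let T1 : α'.StdTableau := ⟨T.perm, hT⟩
        by_cases he : T1.rowOf (lo i) = T1.rowOf (hi i)
        -- Here the two entries sit at the ends of a right step of `α'` although `α` puts them in
        -- different rows. Exchanging them creates a descent there, so the exchanged tableau is sent
        -- to zero, matching the fact that `π_i` fixes the image of `T`.
        · rw [pi_smul_single_of_eq F i _ he, dif_neg, zero_add]
          intro hs
          obtain ⟨q, hq, h1, h2⟩ := (T1.rowOf_eq_iff i).1 he
          have := (((α'.isSemistandard_iff _).1 hs) q).1 hq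
          rw [← h1, ← h2] at this
          simp only [StdTableau.swapEntries, T1, StdTableau.box, Equiv.trans_apply,
            Equiv.apply_symm_apply, Equiv.swap_apply_left, Equiv.swap_apply_right,
            Fin.le_def, val_hi, val_lo] at this
          omega
        · have h' : T1.rowOf (lo i) < T1.rowOf (hi i) := (T1.rowOf_lt i).2 ⟨hbox, he⟩
          rw [pi_smul_single_of_lt F i _ h']
          have hs : α'.IsSemistandard (T.swapEntries (lo i) (hi i) rfl hlt).perm :=
            (T1.swapEntries (lo i) (hi i) rfl h').semistandard
          rw [dif_pos hs]
          rfl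
      -- A forbidden descent of `T` survives the exchange: the exchange reverses the order of the
      -- pair `lo i`, `hi i` only, and that pair is not a descent because `lo i` occurs first in
      -- reading order.
      · rw [dif_neg hT, dif_neg, smul_zero, add_zero]
        intro hs
        refine hT ((α'.isSemistandard_iff _).2 fun q => ⟨fun hq => ?_, fun hq => ?_⟩)
        · have h1 := (((α'.isSemistandard_iff _).1 hs) q).1 hq
          by_contra hlt'
          have h2 := swap_lt_swap (a := lo i) (b := hi i) rfl (not_le.1 hlt') fun hc => by
            have e1 : T.box (lo i) = GenRibbon.hi q := by rw [← hc.1]; exact T.perm.symm_apply_apply _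
            have e2 : T.box (hi i) = GenRibbon.lo q := by rw [← hc.2]; exact T.perm.symm_apply_apply _
            rw [e1, e2, Fin.lt_def, val_hi, val_lo] at hbox
            omega
          exact h1.not_gt h2
        · rcases h q with e | e
          · exact T.lt_of_up (e ▸ hq)
          · rw [e.2] at hq; cases hq)

theorem P.ofUp_single (h : GapToUp α α') (T : α'.StdTableau) :
    P.ofUp h (P.single F T) = P.single F ⟨T.perm, h.isSemistandard T.semistandard⟩ :=
  P.lift_single ..

theorem P.toRight_single_of_pos (h : GapToRight α α') (T : α.StdTableau)
    (hT : α'.IsSemistandard T.perm) :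
    P.toRight h (P.single F T) = P.single F ⟨T.perm, hT⟩ :=
  (P.lift_single ..).trans (dif_pos hT)

theorem P.toRight_single_of_neg (h : GapToRight α α') (T : α.StdTableau)
    (hT : ¬ α'.IsSemistandard T.perm) : P.toRight h (P.single F T) = 0 :=
  (P.lift_single ..).trans (dif_neg hT)

theorem P.toRight_surjective (h : GapToRight α α') : Function.Surjective (P.toRight (F := F) h) := by
  rw [← LinearMap.range_eq_top]
  have : (P.toRight (F := F) h).range.restrictScalars F = ⊤ := by
    rw [eq_top_iff, ← (P.basis F α').span_eq, Submodule.span_le]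
    rintro _ ⟨T, rfl⟩
    exact ⟨P.single F ⟨T.perm, h.isSemistandard T.semistandard⟩,
      P.toRight_single_of_pos h _ T.semistandard⟩
  exact Submodule.restrictScalars_injective F _ _ this

/-! ### Resolving a gap -/

variable (α) in
/-- Replacing one step. -/
def setStep (p : Fin (n - 1)) (s : Step) : GenRibbon n := ⟨Function.update α.step p s⟩

@[simp] theorem setStep_same (p : Fin (n - 1)) (s : Step) : (α.setStep p s).step p = s :=
  Function.update_self ..

theorem setStep_ne {p q : Fin (n - 1)} (h : q ≠ p) (s : Step) :
    (α.setStep p s).step q = α.step q :=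
  Function.update_of_ne h ..

@[simp] theorem setStep_setStep (p : Fin (n - 1)) (s t : Step) :
    (α.setStep p s).setStep p t = α.setStep p t := by
  simp [setStep]

@[simp] theorem setStep_self (p : Fin (n - 1)) : α.setStep p (α.step p) = α := by
  simp [setStep]

theorem gapToUp_setStep {p : Fin (n - 1)} (hp : α.step p = Step.gap) :
    GapToUp α (α.setStep p Step.up) := fun q => by
  by_cases h : q = p
  · subst h; simp [hp]
  · exact Or.inl (setStep_ne h _)

theorem gapToRight_setStep {p : Fin (n - 1)} (hp : α.step p = Step.gap) :
    GapToRight α (α.setStep p Step.right) := fun q => by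
  by_cases h : q = p
  · subst h; simp [hp]
  · exact Or.inl (setStep_ne h _)

theorem isSemistandard_setStep {p : Fin (n - 1)} {X : Type*} [LinearOrder X]
    {T : Fin n → X} (hT : α.IsSemistandard T) (s : Step) :
    (α.setStep p s).IsSemistandard T ↔
      (s = Step.right → T (lo p) ≤ T (hi p)) ∧ (s = Step.up → T (hi p) < T (lo p)) := by
  rw [isSemistandard_iff] at hT ⊢
  constructor
  · intro h
    simpa using h p
  · intro h q
    by_cases hq : q = p
    · subst hq
      simpa using h
    · rw [setStep_ne hq]
      exact hT q

theorem P.ofUp_injective (h : GapToUp α α') : Function.Injective (P.ofUp (F := F) h) :=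
  injective_of_basis (P.basis F α') (P.basis F α) ((P.ofUp h).restrictScalars F)
    (g := fun T => ⟨T.perm, h.isSemistandard T.semistandard⟩)
    (fun T T' hT => StdTableau.ext
      (congrArg StdTableau.perm (a₁ := ⟨T.perm, _⟩) (a₂ := ⟨T'.perm, _⟩) hT))
    (P.ofUp_single h)

/-- A standard filling of `α` either descends at the gap, and is then a basis element coming from
the upward resolution, or ascends there, and then survives in the other resolution. Sorting basis
elements this way gives linear maps `r` and `j`, not equivariant in general, with `ofUp ∘ r + j ∘
toRight = id`; exactness follows from this identity and `toRight ∘ ofUp = 0`. -/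
theorem P.exact_ofUp_toRight {p : Fin (n - 1)} (hp : α.step p = Step.gap) :
    Function.Exact (P.ofUp (F := F) (gapToUp_setStep hp))
      (P.toRight (F := F) (gapToRight_setStep hp)) := by
  classical
  let r : P F α →ₗ[F] P F (α.setStep p Step.up) := (P.basis F α).constr F fun T =>
    if hT : (α.setStep p Step.up).IsSemistandard T.perm then P.single F ⟨T.perm, hT⟩ else 0
  let j : P F (α.setStep p Step.right) →ₗ[F] P F α :=
    (P.basis F (α.setStep p Step.right)).constr F fun T =>
      P.single F ⟨T.perm, (gapToRight_setStep hp).isSemistandard T.semistandard⟩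
  have hr : ∀ T, r (P.single F T) =
      if hT : (α.setStep p Step.up).IsSemistandard T.perm then P.single F ⟨T.perm, hT⟩ else 0 :=
    fun T => (P.basis F α).constr_basis F _ T
  have hj : ∀ T, j (P.single F T) =
      P.single F ⟨T.perm, (gapToRight_setStep hp).isSemistandard T.semistandard⟩ :=
    fun T => (P.basis F _).constr_basis F _ T
  have key : (P.ofUp (F := F) (gapToUp_setStep hp)).restrictScalars F ∘ₗ r +
      j ∘ₗ (P.toRight (F := F) (gapToRight_setStep hp)).restrictScalars F = LinearMap.id := by
    refine (P.basis F α).ext fun T => ?_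
    change P.ofUp (gapToUp_setStep hp) (r (P.single F T)) +
      j (P.toRight (gapToRight_setStep hp) (P.single F T)) = P.single F T
    have hne : T.perm (lo p) ≠ T.perm (hi p) := fun e => by
      have := congrArg Fin.val (T.perm.injective e)
      simp at this
    rw [hr]
    rcases lt_or_gt_of_ne hne with h | h
    · rw [dif_neg, map_zero, zero_add, P.toRight_single_of_pos _ _
        ((isSemistandard_setStep T.semistandard _).2 ⟨fun _ => h.le, by simp⟩), hj]
      rw [isSemistandard_setStep T.semistandard]
      exact fun hc => (hc.2 rfl).not_gt h
    · rw [dif_pos ((isSemistandard_setStep T.semistandard _).2 ⟨by simp, fun _ => h⟩),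
        P.ofUp_single, P.toRight_single_of_neg, map_zero, add_zero]
      rw [isSemistandard_setStep T.semistandard]
      exact fun hc => (hc.1 rfl).not_gt h
  intro x
  constructor
  · intro hx
    refine ⟨r x, ?_⟩
    have := LinearMap.congr_fun key x
    simp only [LinearMap.add_apply, LinearMap.comp_apply, LinearMap.restrictScalars_apply, hx,
      map_zero, add_zero, LinearMap.id_apply] at this
    exact this
  · rintro ⟨y, rfl⟩
    have : P.toRight (F := F) (gapToRight_setStep hp) ∘ₗ P.ofUp (gapToUp_setStep hp) = 0 := by
      refine P.hom_ext fun T => ?_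
      rw [LinearMap.comp_apply, P.ofUp_single, P.toRight_single_of_neg]
      · rfl
      · rw [isSemistandard_setStep ((gapToUp_setStep hp).isSemistandard T.semistandard)]
        exact fun hc => (hc.1 rfl).not_gt (T.lt_of_up (setStep_same ..))
    exact LinearMap.congr_fun this y

/-- `P_α` is an extension of `P_{α'}` by `P_{α''}`, where `α''` and `α'` are obtained by resolving
one gap; it splits if `P_{α'}` is projective. -/
theorem P.gap_equiv {p : Fin (n - 1)} (hp : α.step p = Step.gap)
    [Module.Projective (H F n) (P F (α.setStep p Step.right))] :
    Nonempty (P F α ≃ₗ[H F n]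
      P F (α.setStep p Step.up) × P F (α.setStep p Step.right)) := by
  obtain ⟨s, hs⟩ := Module.projective_lifting_property
    (P.toRight (F := F) (gapToRight_setStep hp)) LinearMap.id (P.toRight_surjective _)
  exact ⟨((P.exact_ofUp_toRight hp).splitSurjectiveEquiv (P.ofUp_injective _) ⟨s, hs⟩).1⟩

end
end GenRibbon
end HZero
end

noncomputable section
namespace HZero
namespace GenRibbon

/-! ### Shapes without ascending steps -/

section
variable {n : ℕ} {α : GenRibbon n}

/-- All components of `α` are rows. -/
def NoUp (α : GenRibbon n) : Prop := ∀ q, α.step q ≠ Step.up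

/-- The generalized ribbon whose components are single boxes. -/
def antichain (n : ℕ) : GenRibbon n := ⟨fun _ => Step.gap⟩

theorem antichain_noUp : (antichain n).NoUp := fun _ => by simp [antichain]

theorem antichain_isSemistandard {X : Type*} [LinearOrder X] (T : Fin n → X) :
    (antichain n).IsSemistandard T := by
  rw [isSemistandard_iff]; simp [antichain]

/-- The standard tableaux of the antichain are the permutations. -/
def antichainEquiv (n : ℕ) : (antichain n).StdTableau ≃ Equiv.Perm (Fin n) where
  toFun T := T.perm
  invFun σ := ⟨σ, antichain_isSemistandard _⟩
  left_inv _ := rfl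
  right_inv _ := rfl

theorem NoUp.gapToRight (h : α.NoUp) : GapToRight (antichain n) α := fun q => by
  have := h q
  cases e : α.step q <;> simp_all [antichain]

/-- A statistic that increases when `i` is moved to the right of `i + 1`. -/
def pot (σ : Equiv.Perm (Fin n)) : ℕ := ∑ p : Fin n, (p : ℕ) * ((σ p).rev : ℕ)

theorem pot_lt (σ : Equiv.Perm (Fin n)) (i : Fin (n - 1))
    (h : σ.symm (lo i) < σ.symm (hi i)) : pot σ < pot (σ.trans (Equiv.swap (lo i) (hi i))) := by
  set a := σ.symm (lo i) with ha
  set b := σ.symm (hi i) with hb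
  have ea : σ a = lo i := by simp [ha]
  have eb : σ b = hi i := by simp [hb]
  -- Only the positions `a` and `b` contribute to the difference, and the reversed values exchanged
  -- there differ by one.
  have key : ((pot (σ.trans (Equiv.swap (lo i) (hi i))) : ℕ) : ℤ) - pot σ = b - a := by
    simp only [pot, Nat.cast_sum, ← Finset.sum_sub_distrib]
    rw [Finset.sum_eq_add a b h.ne]
    · simp only [Equiv.trans_apply, ea, eb, Equiv.swap_apply_left, Equiv.swap_apply_right,
        Fin.val_rev, val_lo, val_hi]
      have := i.2
      push_cast [Nat.sub_add_eq]
      rw [Nat.cast_sub (by omega), Nat.cast_sub (by omega), Nat.cast_sub (by omega)]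
      push_cast
      ring
    · intro c _ hc
      rw [Equiv.trans_apply, Equiv.swap_apply_of_ne_of_ne, sub_self]
      · exact fun e => hc.1 (σ.injective (e.trans ea.symm))
      · exact fun e => hc.2 (σ.injective (e.trans eb.symm))
    · simp
    · simp
  have : (a : ℕ) < b := h
  omega

/-- A permutation other than the identity has a descent of its inverse. -/
theorem exists_descent {σ : Equiv.Perm (Fin n)} (h : σ ≠ 1) :
    ∃ i : Fin (n - 1), σ.symm (hi i) < σ.symm (lo i) := by
  by_contra! H
  refine h ?_
  have hm : StrictMono σ.symm := fun p q hpq =>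
    rel_of_consecutive (· < ·) σ.symm hpq fun r _ _ => (H r).lt_of_ne fun e => by
      have := congrArg Fin.val (σ.symm.injective e)
      simp at this
  have := Subsingleton.elim (α := Fin n ≃o Fin n)
    { toEquiv := σ.symm, map_rel_iff' := hm.le_iff_le } (OrderIso.refl _)
  have h2 : σ.symm = 1 := congrArg RelIso.toEquiv this
  rw [← Equiv.symm_symm σ, h2]
  rfl

variable {F : Type u} [Field F]

theorem NoUp.isSemistandard_one (h : α.NoUp) : α.IsSemistandard (1 : Equiv.Perm (Fin n)) :=
  (α.isSemistandard_iff _).2 fun q => ⟨fun _ => by simp [Fin.le_def], fun hq => (h q hq).elim⟩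

/-- The tableau with increasing reading word. -/
def NoUp.idTab (h : α.NoUp) : α.StdTableau := ⟨1, h.isSemistandard_one⟩

/-- A tableau other than the identity has some `i + 1` before `i` in reading order. Undoing this
exchange gives a tableau `T'` with smaller `pot`, still standard because the pair is not in order
and so does not span a right step, and `T` is recovered as `π_i T' - T'`. -/
theorem NoUp.single_mem (h : α.NoUp) (N : Submodule (H F n) (P F α))
    (hN : P.single F h.idTab ∈ N) (T : α.StdTableau) : P.single F T ∈ N := by
  induction hk : pot T.perm using Nat.strong_induction_on generalizing T with
  | _ k ih =>
    by_cases h1 : T.perm = 1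
    · rwa [show T = h.idTab from StdTableau.ext h1]
    · obtain ⟨i, hi'⟩ := exists_descent h1
      have hs : α.IsSemistandard (T.perm.trans (Equiv.swap (lo i) (hi i))) := by
        refine (α.isSemistandard_iff _).2 fun q => ⟨fun hq => ?_, fun hq => (h q hq).elim⟩
        refine (swap_lt_swap rfl (T.lt_of_right hq) fun hc => ?_).le
        rw [← hc.1, ← hc.2, Equiv.symm_apply_apply, Equiv.symm_apply_apply, Fin.lt_def] at hi'
        simp at hi'
      let T' : α.StdTableau := ⟨_, hs⟩
      have eb : ∀ e, T'.box e = T.perm.symm (Equiv.swap (lo i) (hi i) e) := fun e => by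
        simp [StdTableau.box, T']
      have hlt : T'.box (lo i) < T'.box (hi i) := by
        rw [eb, eb, Equiv.swap_apply_left, Equiv.swap_apply_right]
        exact hi'
      have hback : T.perm = T'.perm.trans (Equiv.swap (lo i) (hi i)) := by
        ext1 x; simp [T']
      have hpot : pot T'.perm < k := by
        rw [← hk, hback]
        exact pot_lt _ i hlt
      have hrow : T'.rowOf (lo i) < T'.rowOf (hi i) := by
        refine (T'.rowOf_lt i).2 ⟨hlt, fun he => ?_⟩
        obtain ⟨q, hq, h1, h2⟩ := (T'.rowOf_eq_iff i).1 he
        have := T.lt_of_right hq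
        rw [← h1, ← h2, eb, eb] at this
        simp [Fin.lt_def] at this
      have hmem := ih _ hpot T' rfl
      have h2 := N.sub_mem (N.smul_mem (pi F i) hmem) hmem
      rw [pi_smul_single_of_lt F i T' hrow, add_sub_cancel_right] at h2
      rwa [show T = T'.swapEntries _ _ rfl hrow from StdTableau.ext hback]

theorem NoUp.span_idTab (h : α.NoUp) : Submodule.span (H F n) {P.single F h.idTab} = ⊤ := by
  apply Submodule.restrictScalars_injective F
  rw [Submodule.restrictScalars_top, eq_top_iff, ← (P.basis F α).span_eq, Submodule.span_le]
  rintro _ ⟨T, rfl⟩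
  exact h.single_mem _ (Submodule.mem_span_singleton_self _) T

end

/-! ### The regular module -/

section
variable {F : Type u} [Field F]

/-- `∑ⱼ aⱼ π_n ⋯ π_{j+1}` -/
def descProd (n : ℕ) : ℕ → H F (n + 1)
  | 0 => 1
  | k + 1 => descProd n k * if h : n - 1 - k < n then pi F ⟨n - 1 - k, h⟩ else 1

theorem pi_comm' {n : ℕ} (i j : Fin (n - 1)) (h : (i : ℕ) + 1 < j ∨ (j : ℕ) + 1 < i) :
    (pi F i * pi F j : H F n) = pi F j * pi F i :=
  h.elim (pi_comm i j) fun h => (pi_comm j i h).symm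

/-- In the usual numbering `descProd n k` is `π_n π_{n-1} ⋯ π_{n-k+1}`, a product of `k` factors;
for `k ≤ n` these are the minimal coset representatives for `S_n` in `S_{n+1}`. The default value
`1` in the recursion is reached only for `n = 0`. -/
theorem descProd_succ {n k : ℕ} (h : k < n) :
    (descProd n (k + 1) : H F (n + 1)) = descProd n k * pi F ⟨n - 1 - k, by omega⟩ := by
  rw [descProd, dif_pos (by omega)]

/-- Generators with small indices commute with the descending product. -/
theorem descProd_comm {n k : ℕ} (hk : k ≤ n) (j : Fin (n + 1 - 1)) (hj : (j : ℕ) + k + 1 < n) :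
    (descProd n k : H F (n + 1)) * pi F j = pi F j * descProd n k := by
  induction k with
  | zero => simp [descProd]
  | succ k ih =>
    rw [descProd_succ (by omega), mul_assoc, pi_comm' (n := n + 1) _ j (by right; simp only; omega), ← mul_assoc,
      ih (by omega) (by omega), mul_assoc]

/-- The other generators pass through with a shift. -/
theorem descProd_shift {n k : ℕ} (hk : k ≤ n) (j j' : Fin (n + 1 - 1))
    (hjj : (j : ℕ) = j' + 1) (hj : n < (j : ℕ) + k) :
    (descProd n k : H F (n + 1)) * pi F j = pi F j' * descProd n k := by
  have := j.2
  induction k with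
  | zero => omega
  | succ k ih =>
    by_cases h : n < j + k
    · rw [descProd_succ (by omega), mul_assoc, pi_comm' (n := n + 1) _ j (by left; simp only; omega),
        ← mul_assoc, ih (by omega) h, mul_assoc]
    · obtain ⟨k, rfl⟩ : ∃ l, k = l + 1 := ⟨k - 1, by omega⟩
      have e1 : (⟨n - 1 - k, by omega⟩ : Fin (n + 1 - 1)) = j := Fin.ext (by simp; omega)
      have e2 : (⟨n - 1 - (k + 1), by omega⟩ : Fin (n + 1 - 1)) = j' := Fin.ext (by simp; omega)
      rw [descProd_succ (by omega), descProd_succ (by omega), e1, e2]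
      have hb : pi F j' * pi F j * pi F j' = (pi F j * pi F j' * pi F j : H F (n + 1)) :=
        pi_braid j' j hjj.symm
      rw [mul_assoc, mul_assoc, ← mul_assoc (pi F j), ← hb, ← mul_assoc, ← mul_assoc,
        descProd_comm (by omega) j' (by omega), mul_assoc, mul_assoc, mul_assoc]

/-- `H_{n+1}(0)` is spanned by the left cosets of the parabolic subalgebra `H_n(0)`. -/
def cosetMap (n : ℕ) : (Fin (n + 1) → H F n) →ₗ[F] H F (n + 1) :=
  ∑ k : Fin (n + 1), (LinearMap.mulRight F (descProd n k)) ∘ₗ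
    (parLeft (F := F) (n := 1) rfl).toLinearMap ∘ₗ LinearMap.proj k

theorem mem_range_cosetMap {n : ℕ} (a : H F n) {k : ℕ} (hk : k ≤ n) :
    parLeft (F := F) (n := 1) rfl a * descProd n k ∈ LinearMap.range (cosetMap (F := F) n) := by
  classical
  refine ⟨Pi.single ⟨k, by omega⟩ a, ?_⟩
  rw [cosetMap, LinearMap.sum_apply, Finset.sum_eq_single ⟨k, by omega⟩]
  · simp
  · intro b _ hb
    simp [Pi.single_eq_of_ne hb]
  · simp

/-- The range contains `1` and is stable under right multiplication by generators. Multiplying `π_n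
⋯ π_{n-k+1}` by a generator has one of four effects: a small index commutes to the left into
`H_n(0)`, the next index lengthens the product, the last index is absorbed by idempotence, and a
larger index passes to the left lowered by one, by the braid relation. -/
theorem cosetMap_surjective (n : ℕ) : Function.Surjective (cosetMap (F := F) n) := by
  have key : ∀ x : H F (n + 1), ∀ w ∈ LinearMap.range (cosetMap (F := F) n),
      w * x ∈ LinearMap.range (cosetMap (F := F) n) := by
    intro x
    induction x using H.induction with
    | halg r => intro w hw; rw [← Algebra.commutes, ← Algebra.smul_def]; exact Submodule.smul_mem _ _ hw
    | hmul a b ha hb => intro w hw; rw [← mul_assoc]; exact hb _ (ha _ hw)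
    | hadd a b ha hb => intro w hw; rw [mul_add]; exact add_mem (ha _ hw) (hb _ hw)
    | hpi j =>
      rintro _ ⟨a, rfl⟩
      rw [cosetMap, LinearMap.sum_apply, Finset.sum_mul]
      refine sum_mem fun k _ => ?_
      simp only [LinearMap.comp_apply, LinearMap.proj_apply, LinearMap.mulRight_apply,
        AlgHom.toLinearMap_apply]
      generalize a k = b
      obtain ⟨k, hk⟩ := k
      have hj := j.2
      rw [mul_assoc]
      simp only
      have hpl : ∀ j' : Fin (n - 1), parLeft (F := F) (n := 1) rfl (pi F j' : H F n) =
          pi F (n := n + 1) ⟨j', by omega⟩ := fun j' => by rw [parLeft, H.lift_pi]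
      rcases lt_trichotomy ((j : ℕ) + k + 1) n with h | h | h
      · rw [descProd_comm (by omega) j h, ← mul_assoc]
        have := mem_range_cosetMap (F := F) (b * pi F ⟨j, by omega⟩) (k := k) (by omega)
        rwa [map_mul, hpl] at this
      · have e : (⟨n - 1 - k, by omega⟩ : Fin (n + 1 - 1)) = j := Fin.ext (by simp; omega)
        rw [← e, ← descProd_succ (by omega)]
        exact mem_range_cosetMap b (by omega)
      · by_cases h' : (j : ℕ) + k = n
        · obtain ⟨k, rfl⟩ : ∃ l, k = l + 1 := ⟨k - 1, by omega⟩
          have e : (⟨n - 1 - k, by omega⟩ : Fin (n + 1 - 1)) = j := Fin.ext (by simp; omega)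
          rw [descProd_succ (by omega), e, mul_assoc, pi_idem, ← e, ← descProd_succ (by omega)]
          exact mem_range_cosetMap b (by omega)
        · rw [descProd_shift (by omega) j ⟨j - 1, by omega⟩ (by simp; omega) (by omega),
            ← mul_assoc]
          have := mem_range_cosetMap (F := F) (b * pi F ⟨j - 1, by omega⟩) (k := k) (by omega)
          rwa [map_mul, hpl] at this
  intro x
  have h1 : (1 : H F (n + 1)) ∈ LinearMap.range (cosetMap (F := F) n) := by
    have := mem_range_cosetMap (F := F) (1 : H F n) (Nat.zero_le n)
    rwa [map_one, one_mul, descProd] at this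
  have := key x 1 h1
  rwa [one_mul] at this

instance H.finite_field (n : ℕ) : Module.Finite F (H F n) := by
  induction n with
  | zero =>
    refine Module.Finite.of_surjective (Algebra.linearMap F (H F 0)) fun x => ?_
    induction x using H.induction with
    | halg r => exact ⟨r, rfl⟩
    | hpi i => exact i.elim0
    | hmul a b ha hb =>
      obtain ⟨r, rfl⟩ := ha
      obtain ⟨s, rfl⟩ := hb
      exact ⟨r * s, by simp⟩
    | hadd a b ha hb =>
      obtain ⟨r, rfl⟩ := ha
      obtain ⟨s, rfl⟩ := hb
      exact ⟨r + s, by simp⟩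
  | succ n ih => exact Module.Finite.of_surjective _ (cosetMap_surjective n)

theorem H.finrank_le (n : ℕ) : Module.finrank F (H F n) ≤ n.factorial := by
  induction n with
  | zero =>
    have hs : Function.Surjective (Algebra.linearMap F (H F 0)) := by
      intro x
      induction x using H.induction with
      | halg r => exact ⟨r, rfl⟩
      | hpi i => exact i.elim0
      | hmul a b ha hb =>
        obtain ⟨r, rfl⟩ := ha
        obtain ⟨s, rfl⟩ := hb
        exact ⟨r * s, by simp⟩
      | hadd a b ha hb =>
        obtain ⟨r, rfl⟩ := ha
        obtain ⟨s, rfl⟩ := hb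
        exact ⟨r + s, by simp⟩
    exact (LinearMap.finrank_le_finrank_of_surjective hs).trans (by simp)
  | succ n ih =>
    refine (LinearMap.finrank_le_finrank_of_surjective (cosetMap_surjective n)).trans ?_
    rw [Module.finrank_pi_fintype]
    simp only [Finset.sum_const, Finset.card_univ, Fintype.card_fin, smul_eq_mul,
      Nat.factorial_succ]
    exact Nat.mul_le_mul_left _ ih

variable (F) in
/-- The regular module is `P_α` for the antichain `α`. -/
def regularEquiv (n : ℕ) : H F n ≃ₗ[H F n] P F (antichain n) :=
  LinearEquiv.ofBijective
    (LinearMap.toSpanSingleton (H F n) (P F (antichain n)) (P.single F antichain_noUp.idTab)) <| by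
    have hs : Function.Surjective
        (LinearMap.toSpanSingleton (H F n) (P F (antichain n)) (P.single F antichain_noUp.idTab)) := by
      rw [← LinearMap.range_eq_top, LinearMap.range_toSpanSingleton, NoUp.span_idTab]
    refine ⟨?_, hs⟩
    have hd : Module.finrank F (P F (antichain n)) = n.factorial := by
      rw [Module.finrank_eq_nat_card_basis (P.basis F (antichain n)),
        Nat.card_congr (antichainEquiv n), Nat.card_perm, Nat.card_fin]
    -- The upper bound from the cosets meets the lower bound from the surjection, so the surjection
    -- is injective as well.
    have he : Module.finrank F (H F n) = Module.finrank F (P F (antichain n)) :=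
      le_antisymm ((H.finrank_le n).trans hd.ge)
        (LinearMap.finrank_le_finrank_of_surjective (f := (LinearMap.toSpanSingleton (H F n) (P F (antichain n))
          (P.single F antichain_noUp.idTab)).restrictScalars F) hs)
    exact (LinearMap.injective_iff_surjective_of_finrank_eq_finrank he
      (f := (LinearMap.toSpanSingleton (H F n) (P F (antichain n))
          (P.single F antichain_noUp.idTab)).restrictScalars F)).2 hs

instance {n : ℕ} : Module.Projective (H F n) (P F (antichain n)) :=
  Module.Projective.of_equiv (regularEquiv F n)

/-! ### Projectivity -/

variable {n : ℕ} {α : GenRibbon n}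

variable (α) in
open Classical in
/-- The permutations of the boxes that preserve the rows. -/
def rowStabilizer : Finset (Equiv.Perm (Fin n)) :=
  Finset.univ.filter fun u => ∀ p, α.row (u p) = α.row p

theorem mem_rowStabilizer {u : Equiv.Perm (Fin n)} :
    u ∈ α.rowStabilizer ↔ ∀ p, α.row (u p) = α.row p := by
  simp [rowStabilizer]

theorem rowStabilizer_symm {u : Equiv.Perm (Fin n)} (hu : u ∈ α.rowStabilizer) (p : Fin n) :
    α.row (u.symm p) = α.row p := by
  have := mem_rowStabilizer.1 hu (u.symm p)
  rwa [Equiv.apply_symm_apply, eq_comm] at this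

/-- A filling of single boxes. -/
def ofPerm (σ : Equiv.Perm (Fin n)) : (antichain n).StdTableau := (antichainEquiv n).symm σ

theorem box_ofPerm (σ : Equiv.Perm (Fin n)) (e : Fin n) : (ofPerm σ).box e = σ.symm e := rfl

theorem ofPerm_rowOf_lt (σ : Equiv.Perm (Fin n)) (i : Fin (n - 1))
    (h : σ.symm (lo i) < σ.symm (hi i)) : (ofPerm σ).rowOf (lo i) < (ofPerm σ).rowOf (hi i) := by
  refine (StdTableau.rowOf_lt _ i).2 ⟨h, fun he => ?_⟩
  obtain ⟨q, hq, _⟩ := (StdTableau.rowOf_eq_iff _ i).1 he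
  simp [antichain] at hq

theorem pi_smul_ofPerm (σ : Equiv.Perm (Fin n)) (i : Fin (n - 1))
    (h : σ.symm (lo i) < σ.symm (hi i)) : (pi F i : H F n) • P.single F (ofPerm σ) =
      P.single F (ofPerm (σ.trans (Equiv.swap (lo i) (hi i)))) + P.single F (ofPerm σ) :=
  pi_smul_single_of_lt F i _ (ofPerm_rowOf_lt σ i h)

theorem lt_of_row_lt {p q : Fin n} (h : α.row p < α.row q) : p < q := by
  by_contra h'
  exact (α.row_mono (not_lt.1 h')).not_gt h

variable (F α) in
/-- The homomorphism from `P_α` to the regular module that symmetrizes the rows. -/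
def P.rowSymm : P F α →ₗ[H F n] P F (antichain n) :=
  P.lift (fun T => ∑ u ∈ α.rowStabilizer, P.single F (ofPerm (u.trans T.perm)))
    (fun i T h => by
      rw [Finset.smul_sum]
      refine Finset.sum_eq_zero fun u hu => pi_smul_single_of_gt F i _ (lt_of_row_lt (α := α) ?_)
      rw [box_ofPerm, box_ofPerm, Equiv.symm_trans_apply, Equiv.symm_trans_apply,
        rowStabilizer_symm hu, rowStabilizer_symm hu]
      exact (T.rowOf_gt i).2 h)
    (fun i T h => by
      classical
      set s : Equiv.Perm (Fin n) := Equiv.swap (T.box (lo i)) (T.box (hi i)) with hs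
      have hsT : ∀ u : Equiv.Perm (Fin n), (u.trans s).trans T.perm =
          (u.trans T.perm).trans (Equiv.swap (lo i) (hi i)) := by
        intro u
        ext1 x
        have := T.perm.swap_apply_apply (T.box (lo i)) (T.box (hi i))
        rw [StdTableau.perm_box, StdTableau.perm_box] at this
        rw [this]
        simp [hs]
      have hsrow : ∀ p, α.row (s p) = α.row p := by
        intro p
        rw [hs, Equiv.swap_apply_def]
        split_ifs with h1 h2
        · rw [h1]; exact h.symm
        · rw [h2]; exact h
        · rfl
      have hss : ∀ u : Equiv.Perm (Fin n), (u.trans s).trans s = u := fun u => by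
        ext1 x; simp [hs]
      have hmem : ∀ u ∈ α.rowStabilizer, u.trans s ∈ α.rowStabilizer := fun u hu => by
        rw [mem_rowStabilizer] at hu ⊢
        intro p
        rw [Equiv.trans_apply, hsrow, hu]
      -- Composition with `s` pairs the row permutations satisfying `A` with those that do not. The
      -- generator kills the summands outside `A` and sends a summand in `A` to itself plus its
      -- partner, so the symmetrized sum is fixed.
      let A : Equiv.Perm (Fin n) → Prop := fun u => u.symm (T.box (lo i)) < u.symm (T.box (hi i))
      have hA : ∀ u, A (u.trans s) ↔ ¬ A u := fun u => by
        have hne : u.symm (T.box (lo i)) ≠ u.symm (T.box (hi i)) := fun e =>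
          T.box_ne i (u.symm.injective e)
        simp only [A, Equiv.symm_trans_apply, hs, Equiv.symm_swap, Equiv.swap_apply_left,
          Equiv.swap_apply_right, not_lt]
        exact ⟨le_of_lt, fun h => h.lt_of_ne hne.symm⟩
      rw [Finset.smul_sum, ← Finset.sum_filter_add_sum_filter_not _ A,
        ← Finset.sum_filter_add_sum_filter_not (f := fun u => P.single F (ofPerm (u.trans T.perm)))
          _ A]
      have h1 : ∑ u ∈ α.rowStabilizer with ¬ A u,
          (pi F i : H F n) • P.single F (ofPerm (u.trans T.perm)) = 0 := by
        refine Finset.sum_eq_zero fun u hu => pi_smul_single_of_gt F i _ ?_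
        have := (hA u).2 (Finset.mem_filter.1 hu).2
        simp only [A, Equiv.symm_trans_apply, hs, Equiv.symm_swap, Equiv.swap_apply_left,
          Equiv.swap_apply_right] at this
        exact this
      have h2 : ∑ u ∈ α.rowStabilizer with A u,
          (pi F i : H F n) • P.single F (ofPerm (u.trans T.perm)) =
          ∑ u ∈ α.rowStabilizer with A u,
            (P.single F (ofPerm ((u.trans s).trans T.perm)) +
              P.single F (ofPerm (u.trans T.perm))) :=
        Finset.sum_congr rfl fun u hu => by
          rw [pi_smul_ofPerm _ i (Finset.mem_filter.1 hu).2, hsT]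
      rw [h1, h2, add_zero, Finset.sum_add_distrib, add_comm]
      congr 1
      refine Finset.sum_nbij' (fun u => u.trans s) (fun u => u.trans s) ?_ ?_ ?_ ?_ ?_
      · intro u hu
        rw [Finset.mem_filter] at hu ⊢
        exact ⟨hmem u hu.1, fun hc => (hA u).1 hc hu.2⟩
      · intro u hu
        rw [Finset.mem_filter] at hu ⊢
        exact ⟨hmem u hu.1, (hA u).2 hu.2⟩
      · exact fun u _ => hss u
      · exact fun u _ => hss u
      · exact fun u _ => rfl)
    (fun i T h => by
      rw [Finset.smul_sum, ← Finset.sum_add_distrib]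
      refine Finset.sum_congr rfl fun u hu => ?_
      rw [pi_smul_ofPerm]
      · rfl
      · refine lt_of_row_lt (α := α) ?_
        rw [Equiv.symm_trans_apply, Equiv.symm_trans_apply,
          rowStabilizer_symm hu, rowStabilizer_symm hu]
        exact h)

/-- Only the trivial row permutation preserves standardness. -/
theorem eq_one_of_rowStabilizer (T : α.StdTableau) {u : Equiv.Perm (Fin n)}
    (hu : u ∈ α.rowStabilizer) (h : α.IsSemistandard (u.trans T.perm)) : u = 1 := by
  have hinc : ∀ T : α.StdTableau, ∀ {p q : Fin n}, p < q → α.row p = α.row q →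
      T.perm p < T.perm q := fun T p q hpq hr =>
    rel_of_consecutive (· < ·) T.perm hpq fun r h1 h2 =>
      T.lt_of_right ((α.row_eq_iff hpq.le).1 hr r h1 h2)
  have hm : StrictMono u := by
    intro p q hpq
    rcases (α.row_mono hpq.le).lt_or_eq with hr | hr
    · refine lt_of_row_lt (α := α) ?_
      rwa [mem_rowStabilizer.1 hu, mem_rowStabilizer.1 hu]
    · have h1 : T.perm (u p) < T.perm (u q) := hinc ⟨_, h⟩ hpq hr
      by_contra h2
      rcases (not_lt.1 h2).lt_or_eq with h3 | h3
      · refine (hinc T h3 ?_).not_gt h1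
        rw [mem_rowStabilizer.1 hu, mem_rowStabilizer.1 hu, hr]
      · exact hpq.ne (u.injective h3).symm
  have := Subsingleton.elim (α := Fin n ≃o Fin n)
    { toEquiv := u, map_rel_iff' := hm.le_iff_le } (OrderIso.refl _)
  exact congrArg RelIso.toEquiv this

variable (F) in
-- Symmetrizing along rows and then discarding the nonstandard fillings is the identity, since
-- within the row class of a tableau only the tableau itself is standard. So the module is a retract
-- of the regular one. Every row permutation appears with coefficient one, so no division is needed
-- and the characteristic of the field plays no role.
theorem NoUp.projective (h : α.NoUp) : Module.Projective (H F n) (P F α) := by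
  refine Module.Projective.of_split (P.rowSymm F α) (P.toRight (F := F) h.gapToRight)
    (P.hom_ext (F := F) fun T => ?_)
  rw [LinearMap.comp_apply, LinearMap.id_apply, P.rowSymm, P.lift_single, map_sum,
    Finset.sum_eq_single 1]
  · exact P.toRight_single_of_pos (F := F) h.gapToRight 
      (ofPerm (Equiv.trans (1 : Equiv.Perm (Fin n)) T.perm)) T.semistandard
  · exact fun u hu hne =>
      P.toRight_single_of_neg (F := F) _ _ fun hs => hne (eq_one_of_rowStabilizer T hu hs)
  · exact fun hc => (hc (mem_rowStabilizer.2 fun p => rfl)).elim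

variable (α) in
open Classical in
/-- The number of ascending steps. -/
def numUp : ℕ := (Finset.univ.filter fun q => α.step q = Step.up).card

open Classical in
theorem numUp_setStep {p : Fin (n - 1)} (hp : α.step p = Step.up) {s : Step} (hs : s ≠ Step.up) :
    (α.setStep p s).numUp < α.numUp := by
  refine Finset.card_lt_card ((Finset.ssubset_iff_of_subset fun q hq => ?_).2 ⟨p, ?_, ?_⟩)
  · simp only [Finset.mem_filter, Finset.mem_univ, true_and] at hq ⊢
    by_cases h : q = p
    · rw [h, hp]
    · rwa [setStep_ne h] at hq
  · simpa using hp
  · simpa using hs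

/-- Induction on the number of ascending steps. -/
theorem upInduction {C : GenRibbon n → Prop} (h0 : ∀ α, α.NoUp → C α)
    (h1 : ∀ α p, α.step p = Step.gap → C α → C (α.setStep p Step.right) →
      C (α.setStep p Step.up)) (α : GenRibbon n) : C α := by
  induction hk : α.numUp using Nat.strong_induction_on generalizing α with
  | _ k ih =>
    by_cases h : α.NoUp
    · exact h0 α h
    · simp only [NoUp, not_forall, not_not] at h
      obtain ⟨p, hp⟩ := h
      -- Reopen an ascending step into a gap: both this shape and the one with a right step there
      -- have fewer ascending steps, and closing the gap upwards gives back `α`.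
      have := h1 (α.setStep p Step.gap) p (by simp)
        (ih _ (hk ▸ numUp_setStep hp (by simp)) _ rfl)
        (by rw [setStep_setStep]; exact ih _ (hk ▸ numUp_setStep hp (by simp)) _ rfl)
      rwa [setStep_setStep, ← hp, setStep_self] at this

/-- Of the three modules at a gap, the quotient is projective by induction, so the extension splits;
the middle one is projective by induction too, and the submodule is then a direct summand of it. -/
instance P.projective : Module.Projective (H F n) (P F α) := by
  induction α using upInduction with
  | h0 α h => exact h.projective F
  | h1 α p hp ha hr =>
    obtain ⟨e⟩ := P.gap_equiv (F := F) hp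
    have := Module.Projective.of_equiv e
    exact Module.Projective.of_split
      (LinearMap.inl (H F n) (P F (α.setStep p Step.up)) (P F (α.setStep p Step.right)))
      (LinearMap.fst _ _ _) (LinearMap.fst_comp_inl _ _ _)

end
end GenRibbon
end HZero
end

noncomputable section
namespace HZero

/-! ### External tensor products -/

section
variable {F : Type u} [Field F] {A B : Type*} {M N L : Type*} [Ring A] [Ring B] [Algebra F A]
  [Algebra F B] [AddCommGroup M] [AddCommGroup N] [Module F M] [Module F N] [Module A M]
  [Module B N] [IsScalarTower F A M] [IsScalarTower F B N] [AddCommGroup L]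
  [Module (A ⊗[F] B) L]

/-- A homomorphism out of an external tensor product. -/
def ExtTensor.hom (f : M ⊗[F] N →+ L)
    (h : ∀ (a : A) (b : B) (x : M) (y : N),
      f ((a • x) ⊗ₜ (b • y)) = (a ⊗ₜ[F] b) • f (x ⊗ₜ y)) :
    ExtTensor F A B M N →ₗ[A ⊗[F] B] L where
  toFun := f
  map_add' := f.map_add
  map_smul' t z := by
    let f' : ExtTensor F A B M N →+ L := f
    change f' (t • z) = t • f' z
    induction t with
    | zero => rw [zero_smul, zero_smul, map_zero]
    | add s t hs ht => rw [add_smul, map_add, hs, ht, add_smul]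
    | tmul a b =>
      let p : M ⊗[F] N →+ L :=
        f'.comp (DistribSMul.toAddMonoidHom (ExtTensor F A B M N) (a ⊗ₜ[F] b))
      let q : M ⊗[F] N →+ L := (DistribSMul.toAddMonoidHom L (a ⊗ₜ[F] b)).comp f
      refine DFunLike.congr_fun (AddMonoidHom.ext fun w => ?_ : p = q) z
      induction w using TensorProduct.induction_on with
      | zero => rw [map_zero, map_zero]
      | add x y hx hy => rw [map_add, map_add, hx, hy]
      | tmul x y => exact h a b x y

end

namespace GenRibbon

/-! ### Decompositions -/

section
variable {n : ℕ} {α : GenRibbon n}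

theorem IsSemistandard.comp_iff {X Y : Type*} [LinearOrder X] [LinearOrder Y] {f : X → Y}
    (hf : StrictMono f) (T : Fin n → X) :
    α.IsSemistandard (fun p => f (T p)) ↔ α.IsSemistandard T := by
  simp only [IsSemistandard, hf.le_iff_le, hf.lt_iff_lt]

/-- A step other than a gap can only be inherited from the same two boxes being consecutive in `α`.
Gaps are excluded because they also arise from omitted boxes. -/
theorem restrict_step_eq_iff {k : ℕ} (e : Fin k ↪o Fin n) (q' : Fin (k - 1)) {s : Step}
    (hs : s ≠ Step.gap) : (α.restrict e).step q' = s ↔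
      ∃ q : Fin (n - 1), e (lo q') = lo q ∧ e (hi q') = hi q ∧ α.step q = s := by
  change (if h : ((e (lo q') : Fin n) : ℕ) + 1 = e (hi q') then
      α.step ⟨e (lo q'), by have := (e (hi q')).2; omega⟩ else Step.gap) = s ↔ _
  constructor
  · intro h
    split_ifs at h with h'
    · exact ⟨⟨e (lo q'), by have := (e (hi q')).2; omega⟩, rfl, Fin.ext h'.symm, h⟩
    · exact (hs h.symm).elim
  · rintro ⟨q, h1, h2, h3⟩
    rw [dif_pos (by rw [h1, h2]; rfl), ← h3]
    congr 1
    exact Fin.ext (congrArg (Fin.val (n := n)) h1)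

/-- An order embedding can place nothing between two consecutive boxes, so they are already
consecutive in the subsequence. -/
theorem exists_eq_lo_hi {k : ℕ} (e : Fin k ↪o Fin n) {a b : Fin k} {q : Fin (n - 1)}
    (ha : e a = lo q) (hb : e b = hi q) : ∃ q' : Fin (k - 1), a = lo q' ∧ b = hi q' := by
  have hab : a < b := by
    rw [← e.lt_iff_lt, ha, hb, Fin.lt_def]
    simp
  refine ⟨⟨a, by omega⟩, rfl, ?_⟩
  by_contra hne
  have h1 : a < hi ⟨a, by omega⟩ := by rw [Fin.lt_def]; simp
  have h2 : hi ⟨a, by omega⟩ < b := lt_of_le_of_ne (by rw [Fin.le_def, val_hi]; exact hab)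
    fun h => hne h.symm
  have h3 := e.lt_iff_lt.2 h1
  have h4 := e.lt_iff_lt.2 h2
  rw [ha, Fin.lt_def, val_lo] at h3
  rw [hb, Fin.lt_def, val_hi] at h4
  omega

/-- Restriction to a set of boxes preserves semistandardness. -/
theorem IsSemistandard.restrict {X : Type*} [LinearOrder X] {T : Fin n → X}
    (h : α.IsSemistandard T) {k : ℕ} (e : Fin k ↪o Fin n) :
    (α.restrict e).IsSemistandard fun p => T (e p) := by
  rw [isSemistandard_iff] at h ⊢
  refine fun q' => ⟨fun hq => ?_, fun hq => ?_⟩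
  · obtain ⟨q, h1, h2, h3⟩ := (restrict_step_eq_iff e q' (by simp)).1 hq
    rw [h1, h2]
    exact (h q).1 h3
  · obtain ⟨q, h1, h2, h3⟩ := (restrict_step_eq_iff e q' (by simp)).1 hq
    rw [h1, h2]
    exact (h q).2 h3

namespace Decomp
variable {m k : ℕ} (d : α.Decomp m k)

/-- The boxes filled with `β`, in reading order. -/
def eL : Fin m ↪o Fin n := d.S.orderEmbOfFin d.card_left

/-- The boxes filled with `γ`, in reading order. -/
def eR : Fin k ↪o Fin n := d.Sᶜ.orderEmbOfFin d.card_right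

theorem eL_mem (p : Fin m) : d.eL p ∈ d.S := Finset.orderEmbOfFin_mem ..

theorem eR_notMem (p : Fin k) : d.eR p ∉ d.S :=
  Finset.mem_compl.1 (Finset.orderEmbOfFin_mem d.Sᶜ d.card_right p)

theorem exists_eL {p : Fin n} (h : p ∈ d.S) : ∃ a, d.eL a = p := by
  have : p ∈ Set.range d.eL := by rw [eL, Finset.range_orderEmbOfFin]; exact h
  exact this

theorem exists_eR {p : Fin n} (h : p ∉ d.S) : ∃ a, d.eR a = p := by
  have : p ∈ Set.range d.eR := by
    rw [eR, Finset.range_orderEmbOfFin]; exact Finset.mem_coe.2 (Finset.mem_compl.2 h)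
  exact this

theorem lo_mem {q : Fin (n - 1)} (hq : α.step q = Step.right) (h : hi q ∈ d.S) : lo q ∈ d.S :=
  d.row_le _ _ ((α.row_lo_eq_iff q).2 hq)
    (α.col_lt (r := q) le_rfl (Nat.lt_succ_self _) (by simp [hq])) h

theorem hi_mem {q : Fin (n - 1)} (hq : α.step q = Step.up) (h : lo q ∈ d.S) : hi q ∈ d.S :=
  d.col_le _ _ ((α.col_lo_eq_iff q).2 hq).symm
    (α.row_lt (r := q) le_rfl (Nat.lt_succ_self _) (by simp [hq])) h

/-- If the entries of `β` are smaller than those of `γ`, a filling of `α` is semistandard iff its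
restrictions to `β` and `γ` are. -/
theorem isSemistandard_iff {X : Type*} [LinearOrder X] {T : Fin n → X}
    (hT : ∀ p ∈ d.S, ∀ q ∉ d.S, T p < T q) : α.IsSemistandard T ↔
      d.left.IsSemistandard (fun p => T (d.eL p)) ∧
        d.right.IsSemistandard (fun p => T (d.eR p)) := by
  refine ⟨fun h => ⟨h.restrict d.eL, h.restrict d.eR⟩, fun ⟨h1, h2⟩ => ?_⟩
  rw [GenRibbon.isSemistandard_iff] at h1 h2 ⊢
  intro q
  by_cases hl : lo q ∈ d.S <;> by_cases hh : hi q ∈ d.S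
  · obtain ⟨a, ha⟩ := d.exists_eL hl
    obtain ⟨b, hb⟩ := d.exists_eL hh
    obtain ⟨q', rfl, rfl⟩ := exists_eq_lo_hi d.eL ha hb
    have := h1 q'
    rw [ha, hb] at this
    exact ⟨fun hq => this.1 ((restrict_step_eq_iff d.eL q' (by simp)).2 ⟨q, ha, hb, hq⟩),
      fun hq => this.2 ((restrict_step_eq_iff d.eL q' (by simp)).2 ⟨q, ha, hb, hq⟩)⟩
  -- At a step leading from `β` into `γ` the horizontal condition is automatic, and the step cannot
  -- go upwards since a box above one of `β` belongs to `β`. The next case is the mirror image.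
  · exact ⟨fun _ => (hT _ hl _ hh).le, fun hq => (hh (d.hi_mem hq hl)).elim⟩
  · exact ⟨fun hq => (hl (d.lo_mem hq hh)).elim, fun _ => hT _ hh _ hl⟩
  · obtain ⟨a, ha⟩ := d.exists_eR hl
    obtain ⟨b, hb⟩ := d.exists_eR hh
    obtain ⟨q', rfl, rfl⟩ := exists_eq_lo_hi d.eR ha hb
    have := h2 q'
    rw [ha, hb] at this
    exact ⟨fun hq => this.1 ((restrict_step_eq_iff d.eR q' (by simp)).2 ⟨q, ha, hb, hq⟩),
      fun hq => this.2 ((restrict_step_eq_iff d.eR q' (by simp)).2 ⟨q, ha, hb, hq⟩)⟩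

/-- The boxes of `α`, split into those of `β` and those of `γ`. -/
def boxEquiv : Fin m ⊕ Fin k ≃ Fin n := finSumEquivOfFinset d.card_left d.card_right

@[simp] theorem boxEquiv_inl (a : Fin m) : d.boxEquiv (Sum.inl a) = d.eL a := rfl
@[simp] theorem boxEquiv_inr (a : Fin k) : d.boxEquiv (Sum.inr a) = d.eR a := rfl

end Decomp

/-- The entries `0, …, m - 1` and `m, …, m + k - 1`. -/
def entryEquiv {m k n : ℕ} (h : m + k = n) : Fin m ⊕ Fin k ≃ Fin n :=
  finSumFinEquiv.trans (finCongr h)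

@[simp] theorem entryEquiv_inl {m k n : ℕ} (h : m + k = n) (a : Fin m) :
    ((entryEquiv h (Sum.inl a) : Fin n) : ℕ) = a := rfl
@[simp] theorem entryEquiv_inr {m k n : ℕ} (h : m + k = n) (a : Fin k) :
    ((entryEquiv h (Sum.inr a) : Fin n) : ℕ) = m + a := rfl

variable {m k : ℕ}

theorem strictMono_inl (h : m + k = n) : StrictMono fun a => entryEquiv h (Sum.inl a) :=
  fun a b hab => by rw [Fin.lt_def]; simpa using hab

theorem strictMono_inr (h : m + k = n) : StrictMono fun a => entryEquiv h (Sum.inr a) :=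
  fun a b hab => by rw [Fin.lt_def]; simpa using hab

/-- Combining fillings of `β` and `γ`. -/
def mergePerm (h : m + k = n) (d : α.Decomp m k) (σ : Equiv.Perm (Fin m))
    (τ : Equiv.Perm (Fin k)) : Equiv.Perm (Fin n) :=
  d.boxEquiv.symm.trans ((Equiv.sumCongr σ τ).trans (entryEquiv h))

theorem mergePerm_eL (h : m + k = n) (d : α.Decomp m k) (σ : Equiv.Perm (Fin m))
    (τ : Equiv.Perm (Fin k)) (a : Fin m) :
    mergePerm h d σ τ (d.eL a) = entryEquiv h (Sum.inl (σ a)) := by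
  rw [mergePerm, Equiv.trans_apply, ← d.boxEquiv_inl, Equiv.symm_apply_apply]
  rfl

theorem mergePerm_eR (h : m + k = n) (d : α.Decomp m k) (σ : Equiv.Perm (Fin m))
    (τ : Equiv.Perm (Fin k)) (a : Fin k) :
    mergePerm h d σ τ (d.eR a) = entryEquiv h (Sum.inr (τ a)) := by
  rw [mergePerm, Equiv.trans_apply, ← d.boxEquiv_inr, Equiv.symm_apply_apply]
  rfl

/-- The entries below `m` recover the decomposition; this is what makes combining tableaux injective
across different decompositions. -/
theorem mergePerm_lt_iff (h : m + k = n) (d : α.Decomp m k) (σ : Equiv.Perm (Fin m))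
    (τ : Equiv.Perm (Fin k)) (p : Fin n) : (mergePerm h d σ τ p : ℕ) < m ↔ p ∈ d.S := by
  by_cases hp : p ∈ d.S
  · obtain ⟨a, rfl⟩ := d.exists_eL hp
    simp [mergePerm_eL, hp]
  · obtain ⟨a, rfl⟩ := d.exists_eR hp
    simp [mergePerm_eR, hp]

theorem mergePerm_isSemistandard_iff (h : m + k = n) (d : α.Decomp m k) (σ : Equiv.Perm (Fin m))
    (τ : Equiv.Perm (Fin k)) : α.IsSemistandard (mergePerm h d σ τ) ↔
      d.left.IsSemistandard σ ∧ d.right.IsSemistandard τ := by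
  rw [d.isSemistandard_iff]
  · simp only [mergePerm_eL, mergePerm_eR]
    rw [IsSemistandard.comp_iff (strictMono_inl h), IsSemistandard.comp_iff (strictMono_inr h)]
  · intro p hp q hq
    rw [← mergePerm_lt_iff h d σ τ] at hp hq
    rw [Fin.lt_def]
    omega

/-- Combining standard tableaux of shapes `β` and `γ`. -/
def merge (h : m + k = n) (t : Σ d : α.Decomp m k, d.left.StdTableau × d.right.StdTableau) :
    α.StdTableau :=
  ⟨mergePerm h t.1 t.2.1.perm t.2.2.perm,
    (mergePerm_isSemistandard_iff h t.1 _ _).2 ⟨t.2.1.semistandard, t.2.2.semistandard⟩⟩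

theorem Decomp.ext_S {d d' : α.Decomp m k} (h : d.S = d'.S) : d = d' := by
  cases d; cases d'; cases h; rfl

theorem merge_injective (h : m + k = n) : Function.Injective (merge (α := α) h) := by
  rintro ⟨d, T1, T2⟩ ⟨d', T1', T2'⟩ he
  have hp : mergePerm h d T1.perm T2.perm = mergePerm h d' T1'.perm T2'.perm :=
    congrArg StdTableau.perm he
  obtain rfl : d = d' := by
    refine Decomp.ext_S (Finset.ext fun p => ?_)
    rw [← mergePerm_lt_iff h d T1.perm T2.perm, ← mergePerm_lt_iff h d' T1'.perm T2'.perm, hp]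
  have h1 : T1 = T1' := StdTableau.ext <| Equiv.ext fun a => by
    have := Equiv.congr_fun hp (d.eL a)
    rw [mergePerm_eL, mergePerm_eL] at this
    exact Sum.inl_injective ((entryEquiv h).injective this)
  have h2 : T2 = T2' := StdTableau.ext <| Equiv.ext fun a => by
    have := Equiv.congr_fun hp (d.eR a)
    rw [mergePerm_eR, mergePerm_eR] at this
    exact Sum.inr_injective ((entryEquiv h).injective this)
  rw [h1, h2]

/-- The decomposition of `α` given by the entries less than `m` of a tableau. -/
def StdTableau.decomp (h : m + k = n) (T : α.StdTableau) : α.Decomp m k where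
  S := Finset.univ.filter fun p => (T.perm p : ℕ) < m
  row_le p q hr hc := by
    simp only [Finset.mem_filter, Finset.mem_univ, true_and]
    exact (Fin.le_def.1 (T.semistandard.1 p q hr hc)).trans_lt
  col_le p q hc hr := by
    simp only [Finset.mem_filter, Finset.mem_univ, true_and]
    exact (Fin.lt_def.1 (T.semistandard.2 p q hc hr)).trans
  card_left := by
    rw [Finset.card_equiv (t := Finset.univ.filter fun p : Fin n => (p : ℕ) < m) T.perm (by simp),
      Fin.card_filter_val_lt]
    omega
  card_right := by
    rw [Finset.card_compl, Finset.card_equiv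
      (t := Finset.univ.filter fun p : Fin n => (p : ℕ) < m) T.perm (by simp),
      Fin.card_filter_val_lt, Fintype.card_fin]
    omega

/-- Take the decomposition cut out by the entries below `m`. Relative to the splittings of boxes and
of entries, the tableau becomes a permutation of `Fin m ⊕ Fin k` that preserves the left summand,
hence a pair of permutations. -/
theorem merge_surjective (h : m + k = n) : Function.Surjective (merge (α := α) h) := by
  intro T
  set d := T.decomp (k := k) h with hd
  have hS : ∀ p, p ∈ d.S ↔ (T.perm p : ℕ) < m := fun p => by
    simp [hd, StdTableau.decomp]
  let ρ : Equiv.Perm (Fin m ⊕ Fin k) := d.boxEquiv.trans (T.perm.trans (entryEquiv h).symm)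
  have hρ : ρ ∈ (Equiv.Perm.sumCongrHom (Fin m) (Fin k)).range := by
    refine Equiv.Perm.mem_sumCongrHom_range_of_perm_mapsTo_inl ?_
    rintro _ ⟨a, rfl⟩
    have h1 := (hS _).1 (d.eL_mem a)
    rcases hc : ρ (Sum.inl a) with b | b
    · exact ⟨b, rfl⟩
    · have h2 : T.perm (d.eL a) = entryEquiv h (Sum.inr b) := by rw [← hc]; simp [ρ]
      rw [h2] at h1
      simp at h1
  obtain ⟨⟨σ, τ⟩, hst⟩ := hρ
  have hT : mergePerm h d σ τ = T.perm := by
    ext1 p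
    obtain ⟨x, rfl⟩ := d.boxEquiv.surjective p
    have : Equiv.sumCongr σ τ x = ρ x := Equiv.congr_fun hst x
    simp only [mergePerm, Equiv.trans_apply, Equiv.symm_apply_apply, this, ρ,
      Equiv.apply_symm_apply]
  have hs := (mergePerm_isSemistandard_iff h d σ τ).1 (hT ▸ T.semistandard)
  exact ⟨⟨d, ⟨σ, hs.1⟩, ⟨τ, hs.2⟩⟩, StdTableau.ext hT⟩

/-- Standard tableaux of shape `α` are pairs of standard tableaux of the parts of a
decomposition. -/
def mergeEquiv (h : m + k = n) :
    (Σ d : α.Decomp m k, d.left.StdTableau × d.right.StdTableau) ≃ α.StdTableau :=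
  Equiv.ofBijective (merge h) ⟨merge_injective h, merge_surjective h⟩

/-! ### The action of the parabolic subalgebra -/

section
variable (e : Fin m ↪o Fin n) (T : α.StdTableau) (T' : (α.restrict e).StdTableau)
  {i : Fin (n - 1)} {i' : Fin (m - 1)} (h1 : T.box (lo i) = e (T'.box (lo i')))
  (h2 : T.box (hi i) = e (T'.box (hi i')))
include h1 h2

theorem box_lt_restrict : T.box (hi i) < T.box (lo i) ↔ T'.box (hi i') < T'.box (lo i') := by
  rw [h1, h2, e.lt_iff_lt]

/-- Consecutive entries share a row only across a right step, and the right steps of the restricted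
shape are exactly those of `α` between retained boxes. So the three cases of the action are the same
for the part as for the whole, although the row numbers change. -/
theorem rowOf_eq_restrict :
    T.rowOf (lo i) = T.rowOf (hi i) ↔ T'.rowOf (lo i') = T'.rowOf (hi i') := by
  rw [StdTableau.rowOf_eq_iff, StdTableau.rowOf_eq_iff, h1, h2]
  constructor
  · rintro ⟨q, hq, ha, hb⟩
    obtain ⟨q', e1, e2⟩ := exists_eq_lo_hi e ha hb
    refine ⟨q', (restrict_step_eq_iff e q' (by simp)).2 ⟨q, ?_, ?_, hq⟩, e1, e2⟩
    · rw [← e1, ha]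
    · rw [← e2, hb]
  · rintro ⟨q', hq', e1, e2⟩
    obtain ⟨q, ha, hb, hq⟩ := (restrict_step_eq_iff e q' (by simp)).1 hq'
    exact ⟨q, hq, by rw [e1, ha], by rw [e2, hb]⟩

theorem rowOf_lt_restrict :
    T.rowOf (lo i) < T.rowOf (hi i) ↔ T'.rowOf (lo i') < T'.rowOf (hi i') := by
  rw [StdTableau.rowOf_lt, StdTableau.rowOf_lt, rowOf_eq_restrict e T T' h1 h2, h1, h2,
    e.lt_iff_lt]

end

theorem merge_box_inl (h : m + k = n) (d : α.Decomp m k) (T1 : d.left.StdTableau)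
    (T2 : d.right.StdTableau) (a : Fin m) :
    (merge h ⟨d, T1, T2⟩).box (entryEquiv h (Sum.inl a)) = d.eL (T1.box a) := by
  apply (merge h ⟨d, T1, T2⟩).perm.injective
  rw [StdTableau.perm_box]
  exact ((mergePerm_eL h d T1.perm T2.perm (T1.box a)).trans (by rw [StdTableau.perm_box])).symm

theorem merge_box_inr (h : m + k = n) (d : α.Decomp m k) (T1 : d.left.StdTableau)
    (T2 : d.right.StdTableau) (a : Fin k) :
    (merge h ⟨d, T1, T2⟩).box (entryEquiv h (Sum.inr a)) = d.eR (T2.box a) := by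
  apply (merge h ⟨d, T1, T2⟩).perm.injective
  rw [StdTableau.perm_box]
  exact ((mergePerm_eR h d T1.perm T2.perm (T2.box a)).trans (by rw [StdTableau.perm_box])).symm

/-- The index of `π_{i+1}` in the left factor of the parabolic subalgebra. -/
def idxL (h : m + k = n) (i : Fin (m - 1)) : Fin (n - 1) := ⟨i, by omega⟩
/-- The index of `π_{i+1}` in the right factor of the parabolic subalgebra. -/
def idxR (h : m + k = n) (i : Fin (k - 1)) : Fin (n - 1) := ⟨m + i, by omega⟩

theorem lo_idxL (h : m + k = n) (i : Fin (m - 1)) :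
    lo (idxL h i) = entryEquiv h (Sum.inl (lo i)) := rfl
theorem hi_idxL (h : m + k = n) (i : Fin (m - 1)) :
    hi (idxL h i) = entryEquiv h (Sum.inl (hi i)) := rfl
theorem lo_idxR (h : m + k = n) (i : Fin (k - 1)) :
    lo (idxR h i) = entryEquiv h (Sum.inr (lo i)) := rfl
theorem hi_idxR (h : m + k = n) (i : Fin (k - 1)) :
    hi (idxR h i) = entryEquiv h (Sum.inr (hi i)) := rfl

theorem merge_swap_left (h : m + k = n) (d : α.Decomp m k) (T1 : d.left.StdTableau)
    (T2 : d.right.StdTableau) (i : Fin (m - 1)) (hlt) (hlt') :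
    (merge h ⟨d, T1, T2⟩).swapEntries (lo (idxL h i)) (hi (idxL h i)) rfl hlt =
      merge h ⟨d, T1.swapEntries (lo i) (hi i) rfl hlt', T2⟩ := by
  refine StdTableau.ext (Equiv.ext fun p => ?_)
  obtain ⟨x, rfl⟩ := d.boxEquiv.surjective p
  change Equiv.swap (entryEquiv h (Sum.inl (lo i))) (entryEquiv h (Sum.inl (hi i))) (mergePerm h d T1.perm T2.perm _) = mergePerm h d _ _ _
  rcases x with a | a
  · rw [d.boxEquiv_inl, mergePerm_eL, mergePerm_eL,
      (entryEquiv h).injective.swap_apply, Sum.inl_injective.swap_apply]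
    rfl
  · rw [d.boxEquiv_inr, mergePerm_eR, mergePerm_eR, Equiv.swap_apply_of_ne_of_ne]
    · exact fun e => by simpa using (entryEquiv h).injective e
    · exact fun e => by simpa using (entryEquiv h).injective e

theorem merge_swap_right (h : m + k = n) (d : α.Decomp m k) (T1 : d.left.StdTableau)
    (T2 : d.right.StdTableau) (i : Fin (k - 1)) (hlt) (hlt') :
    (merge h ⟨d, T1, T2⟩).swapEntries (lo (idxR h i)) (hi (idxR h i)) rfl hlt =
      merge h ⟨d, T1, T2.swapEntries (lo i) (hi i) rfl hlt'⟩ := by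
  refine StdTableau.ext (Equiv.ext fun p => ?_)
  obtain ⟨x, rfl⟩ := d.boxEquiv.surjective p
  change Equiv.swap (entryEquiv h (Sum.inr (lo i))) (entryEquiv h (Sum.inr (hi i))) (mergePerm h d T1.perm T2.perm _) = mergePerm h d _ _ _
  rcases x with a | a
  · rw [d.boxEquiv_inl, mergePerm_eL, mergePerm_eL, Equiv.swap_apply_of_ne_of_ne]
    · exact fun e => by simpa using (entryEquiv h).injective e
    · exact fun e => by simpa using (entryEquiv h).injective e
  · rw [d.boxEquiv_inr, mergePerm_eR, mergePerm_eR,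
      (entryEquiv h).injective.swap_apply, Sum.inr_injective.swap_apply]
    rfl

section
variable (F : Type u) [Field F]

theorem parLeft_pi (h : m + k = n) (i : Fin (m - 1)) :
    parLeft h (pi F i : H F m) = pi F (idxL h i) := H.lift_pi ..

theorem parRight_pi (h : m + k = n) (i : Fin (k - 1)) :
    parRight h (pi F i : H F k) = pi F (idxR h i) := H.lift_pi ..

/-- Combining standard tableaux of `β` and `γ`, extended linearly. -/
def mergeMap (h : m + k = n) (d : α.Decomp m k) :
    P F d.left ⊗[F] P F d.right →ₗ[F] P F α :=
  ((P.basis F d.left).tensorProduct (P.basis F d.right)).constr F fun t =>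
    P.single F (merge h ⟨d, t⟩)

theorem mergeMap_single (h : m + k = n) (d : α.Decomp m k) (T1 : d.left.StdTableau)
    (T2 : d.right.StdTableau) : mergeMap F h d (P.single F T1 ⊗ₜ P.single F T2) =
      P.single F (merge h ⟨d, T1, T2⟩) := by
  have := ((P.basis F d.left).tensorProduct (P.basis F d.right)).constr_basis F
    (fun t => P.single F (merge h ⟨d, t⟩)) (T1, T2)
  rwa [Module.Basis.tensorProduct_apply] at this

theorem mergeMap_injective (h : m + k = n) (d : α.Decomp m k) :
    Function.Injective (mergeMap F h d) :=
  injective_of_basis ((P.basis F d.left).tensorProduct (P.basis F d.right)) (P.basis F α) _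
    (g := fun t => merge h ⟨d, t⟩)
    (fun t t' ht => by simpa using merge_injective h ht)
    (fun t => ((P.basis F d.left).tensorProduct (P.basis F d.right)).constr_basis F _ t)

theorem mergeMap_pi_left (h : m + k = n) (d : α.Decomp m k) (i : Fin (m - 1))
    (x : P F d.left) (y : P F d.right) : mergeMap F h d (((pi F i : H F m) • x) ⊗ₜ y) =
      parLeft h (pi F i : H F m) • mergeMap F h d (x ⊗ₜ y) := by
  have key : mergeMap F h d ∘ₗ
      (Algebra.lsmul F F (P F d.left) (pi F i : H F m)).rTensor (P F d.right) =
      Algebra.lsmul F F (P F α) (parLeft h (pi F i : H F m)) ∘ₗ mergeMap F h d := by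
    refine ((P.basis F d.left).tensorProduct (P.basis F d.right)).ext fun ⟨T1, T2⟩ => ?_
    rw [Module.Basis.tensorProduct_apply]
    change mergeMap F h d (((pi F i : H F m) • P.single F T1) ⊗ₜ P.single F T2) =
      parLeft h (pi F i : H F m) • mergeMap F h d (P.single F T1 ⊗ₜ P.single F T2)
    have h1 := merge_box_inl h d T1 T2 (lo i)
    have h2 := merge_box_inl h d T1 T2 (hi i)
    rw [← lo_idxL] at h1
    rw [← hi_idxL] at h2
    rw [parLeft_pi, mergeMap_single]
    rcases lt_trichotomy (T1.rowOf (lo i)) (T1.rowOf (hi i)) with hc | hc | hc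
    · have hc' := (rowOf_lt_restrict d.eL _ T1 h1 h2).2 hc
      rw [pi_smul_single_of_lt F _ _ hc, pi_smul_single_of_lt F _ _ hc', TensorProduct.add_tmul,
        map_add, mergeMap_single, mergeMap_single, merge_swap_left h d T1 T2 i hc' hc]
    · rw [pi_smul_single_of_eq F _ _ hc,
        pi_smul_single_of_eq F _ _ ((rowOf_eq_restrict d.eL _ T1 h1 h2).2 hc), mergeMap_single]
    · have hc := (T1.rowOf_gt i).1 hc
      rw [pi_smul_single_of_gt F _ _ hc,
        pi_smul_single_of_gt F _ _ ((box_lt_restrict d.eL _ T1 h1 h2).2 hc),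
        TensorProduct.zero_tmul, map_zero]
  exact LinearMap.congr_fun key (x ⊗ₜ y)

theorem mergeMap_pi_right (h : m + k = n) (d : α.Decomp m k) (i : Fin (k - 1))
    (x : P F d.left) (y : P F d.right) : mergeMap F h d (x ⊗ₜ ((pi F i : H F k) • y)) =
      parRight h (pi F i : H F k) • mergeMap F h d (x ⊗ₜ y) := by
  have key : mergeMap F h d ∘ₗ
      (Algebra.lsmul F F (P F d.right) (pi F i : H F k)).lTensor (P F d.left) =
      Algebra.lsmul F F (P F α) (parRight h (pi F i : H F k)) ∘ₗ mergeMap F h d := by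
    refine ((P.basis F d.left).tensorProduct (P.basis F d.right)).ext fun ⟨T1, T2⟩ => ?_
    rw [Module.Basis.tensorProduct_apply]
    change mergeMap F h d (P.single F T1 ⊗ₜ ((pi F i : H F k) • P.single F T2)) =
      parRight h (pi F i : H F k) • mergeMap F h d (P.single F T1 ⊗ₜ P.single F T2)
    have h1 := merge_box_inr h d T1 T2 (lo i)
    have h2 := merge_box_inr h d T1 T2 (hi i)
    rw [← lo_idxR] at h1
    rw [← hi_idxR] at h2
    rw [parRight_pi, mergeMap_single]
    rcases lt_trichotomy (T2.rowOf (lo i)) (T2.rowOf (hi i)) with hc | hc | hc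
    · have hc' := (rowOf_lt_restrict d.eR _ T2 h1 h2).2 hc
      rw [pi_smul_single_of_lt F _ _ hc, pi_smul_single_of_lt F _ _ hc', TensorProduct.tmul_add,
        map_add, mergeMap_single, mergeMap_single, merge_swap_right h d T1 T2 i hc' hc]
    · rw [pi_smul_single_of_eq F _ _ hc,
        pi_smul_single_of_eq F _ _ ((rowOf_eq_restrict d.eR _ T2 h1 h2).2 hc), mergeMap_single]
    · have hc := (T2.rowOf_gt i).1 hc
      rw [pi_smul_single_of_gt F _ _ hc,
        pi_smul_single_of_gt F _ _ ((box_lt_restrict d.eR _ T2 h1 h2).2 hc),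
        TensorProduct.tmul_zero, map_zero]
  exact LinearMap.congr_fun key (x ⊗ₜ y)

theorem mergeMap_left (h : m + k = n) (d : α.Decomp m k) (a : H F m)
    (x : P F d.left) (y : P F d.right) : mergeMap F h d ((a • x) ⊗ₜ y) =
      parLeft h a • mergeMap F h d (x ⊗ₜ y) := by
  induction a using H.induction generalizing x with
  | halg r => rw [AlgHom.commutes, algebraMap_smul, algebraMap_smul, ← TensorProduct.smul_tmul',
      map_smul]
  | hpi i => exact mergeMap_pi_left F h d i x y
  | hmul a b ha hb => rw [mul_smul, ha, hb, map_mul, mul_smul]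
  | hadd a b ha hb => rw [add_smul, TensorProduct.add_tmul, map_add, ha, hb, map_add, add_smul]

theorem mergeMap_right (h : m + k = n) (d : α.Decomp m k) (a : H F k)
    (x : P F d.left) (y : P F d.right) : mergeMap F h d (x ⊗ₜ (a • y)) =
      parRight h a • mergeMap F h d (x ⊗ₜ y) := by
  induction a using H.induction generalizing y with
  | halg r => rw [AlgHom.commutes, algebraMap_smul, algebraMap_smul, TensorProduct.tmul_smul,
      map_smul]
  | hpi i => exact mergeMap_pi_right F h d i x y
  | hmul a b ha hb => rw [mul_smul, ha, hb, map_mul, mul_smul]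
  | hadd a b ha hb => rw [add_smul, TensorProduct.tmul_add, map_add, ha, hb, map_add, add_smul]

/-- Combining standard tableaux is a homomorphism of modules over `H_m(0) ⊗ H_k(0)`. -/
def mergeHom (h : m + k = n) (d : α.Decomp m k) :
    ExtTensor F (H F m) (H F k) (P F d.left) (P F d.right) →ₗ[H F m ⊗[F] H F k]
      Res F (par F h) (P F α) :=
  ExtTensor.hom (mergeMap F h d).toAddMonoidHom fun a b x y => by
    change mergeMap F h d ((a • x) ⊗ₜ (b • y)) = par F h (a ⊗ₜ b) • mergeMap F h d (x ⊗ₜ y)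
    rw [mergeMap_left, mergeMap_right, ← mul_smul]
    rfl

open Classical in
/-- The restriction of `P_α` to a parabolic subalgebra. -/
def resEquiv (h : m + k = n) (α : GenRibbon n) :
    (⨁ d : α.Decomp m k, ExtTensor F (H F m) (H F k) (P F d.left) (P F d.right))
      ≃ₗ[H F m ⊗[F] H F k] Res F (par F h) (P F α) :=
  LinearEquiv.ofBijective (DirectSum.toModule _ _ _ fun d => mergeHom F h d) <| by
    let E : α.Decomp m k → Type u :=
      fun d => ExtTensor F (H F m) (H F k) (P F d.left) (P F d.right)
    let G : (⨁ d, E d) →ₗ[F] P F α := DirectSum.toModule F _ (P F α) fun d => mergeMap F h d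
    let b : ∀ d, d.left.StdTableau × d.right.StdTableau → E d :=
      fun d t => P.single F t.1 ⊗ₜ[F] P.single F t.2
    let K : P F α →ₗ[F] ⨁ d, E d := (P.basis F α).constr F fun T =>
      DirectSum.lof F _ E ((mergeEquiv h).symm T).1 (b _ ((mergeEquiv h).symm T).2)
    have hG : ∀ d t, G (DirectSum.lof F _ E d (b d t)) = P.single F (mergeEquiv h ⟨d, t⟩) :=
      fun d t => (DirectSum.toModule_lof F d _).trans (mergeMap_single F h d t.1 t.2)
    have hK : ∀ T, K (P.single F T) =
        DirectSum.lof F _ E ((mergeEquiv h).symm T).1 (b _ ((mergeEquiv h).symm T).2) :=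
      fun T => (P.basis F α).constr_basis F _ T
    have h1 : G ∘ₗ K = LinearMap.id := (P.basis F α).ext fun T => by
      change G (K (P.single F T)) = P.single F T
      rw [hK, hG, Sigma.eta, Equiv.apply_symm_apply]
    have h2 : K ∘ₗ G = LinearMap.id := DirectSum.linearMap_ext F fun d => by
      refine ((P.basis F d.left).tensorProduct (P.basis F d.right)).ext fun t => ?_
      rw [Module.Basis.tensorProduct_apply']
      change K (G (DirectSum.lof F _ E d (b d t))) = DirectSum.lof F _ E d (b d t)
      rw [hG, hK, Equiv.symm_apply_apply]
    exact Function.bijective_iff_has_inverse.2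
      ⟨K, fun x => LinearMap.congr_fun h2 x, fun x => LinearMap.congr_fun h1 x⟩

end
end
end GenRibbon
end HZero
end

noncomputable section
namespace HZero

/-! ### The parabolic subalgebras -/

section
variable (F : Type u) [Field F]

theorem range_par {m n N : ℕ} (h : m + n = N) : (par F h).range = parabolic F m N := by
  apply le_antisymm
  · have hL : ∀ a : H F m, parLeft h a ∈ parabolic F m N := by
      intro a
      induction a using H.induction with
      | halg r => rw [AlgHom.commutes]; exact Subalgebra.algebraMap_mem _ r
      | hpi i =>
        rw [GenRibbon.parLeft_pi]
        refine Algebra.subset_adjoin ⟨_, ?_, rfl⟩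
        simp only [GenRibbon.idxL]
        omega
      | hmul a b ha hb => rw [map_mul]; exact mul_mem ha hb
      | hadd a b ha hb => rw [map_add]; exact add_mem ha hb
    have hR : ∀ a : H F n, parRight h a ∈ parabolic F m N := by
      intro a
      induction a using H.induction with
      | halg r => rw [AlgHom.commutes]; exact Subalgebra.algebraMap_mem _ r
      | hpi i =>
        rw [GenRibbon.parRight_pi]
        refine Algebra.subset_adjoin ⟨_, ?_, rfl⟩
        simp only [GenRibbon.idxR]
        omega
      | hmul a b ha hb => rw [map_mul]; exact mul_mem ha hb
      | hadd a b ha hb => rw [map_add]; exact add_mem ha hb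
    rintro _ ⟨t, rfl⟩
    change par F h t ∈ _
    induction t with
    | zero => rw [map_zero]; exact zero_mem _
    | add s t hs ht => rw [map_add]; exact add_mem hs ht
    | tmul a b => exact mul_mem (hL a) (hR b)
  · refine Algebra.adjoin_le ?_
    rintro _ ⟨i, hi, rfl⟩
    rcases Nat.lt_or_ge ((i : ℕ) + 1) m with h' | h'
    · refine ⟨pi F ⟨i, by omega⟩ ⊗ₜ 1, ?_⟩
      change parLeft h _ * parRight h 1 = _
      rw [map_one, mul_one, GenRibbon.parLeft_pi]
      rfl
    · refine ⟨1 ⊗ₜ pi F ⟨i - m, by omega⟩, ?_⟩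
      change parLeft h 1 * parRight h _ = _
      rw [map_one, one_mul, GenRibbon.parRight_pi]
      congr 1
      simp only [GenRibbon.idxR, Fin.ext_iff]
      omega

/-- `H_m(0) ⊗ H_n(0)` acts faithfully on the tensor product of the regular modules. -/
theorem eq_zero_of_smul_antichain {m n : ℕ} (t : H F m ⊗[F] H F n)
    (ht : ∀ z : ExtTensor F (H F m) (H F n) (GenRibbon.P F (GenRibbon.antichain m))
      (GenRibbon.P F (GenRibbon.antichain n)), t • z = 0) : t = 0 := by
  let e := TensorProduct.congr ((GenRibbon.regularEquiv F m).restrictScalars F)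
    ((GenRibbon.regularEquiv F n).restrictScalars F)
  have key : ∀ t : H F m ⊗[F] H F n, e t =
      (t • (show ExtTensor F (H F m) (H F n) (GenRibbon.P F (GenRibbon.antichain m))
      (GenRibbon.P F (GenRibbon.antichain n)) from
        GenRibbon.P.single F GenRibbon.antichain_noUp.idTab ⊗ₜ[F]
          GenRibbon.P.single F GenRibbon.antichain_noUp.idTab)) := by
    intro t
    induction t with
    | zero => rw [map_zero, zero_smul]; rfl
    | add s t hs ht => rw [map_add, add_smul, hs, ht]; rfl
    | tmul a b => rfl
  -- By `key`, the linear isomorphism `e` is the orbit map of the tensor product of the two cyclic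
  -- generators, so an element acting by zero is itself zero.
  apply e.injective
  rw [key, ht, map_zero]
  rfl

/-- Every part of a shape of isolated boxes again consists of isolated boxes. So the restriction of
such a module contains the tensor product of two regular modules, on which an element of the kernel
of `par` acts by zero; that action is faithful. -/
theorem par_injective {m n N : ℕ} (h : m + n = N) : Function.Injective (par F h) := by
  classical
  let α := GenRibbon.antichain N
  let d : α.Decomp m n := (⟨1, GenRibbon.antichain_isSemistandard _⟩ : α.StdTableau).decomp h
  have hl : ∀ {k : ℕ} (e : Fin k ↪o Fin N), α.restrict e = GenRibbon.antichain k := by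
    intro k e
    ext q
    simp [GenRibbon.restrict, α, GenRibbon.antichain]
  rw [injective_iff_map_eq_zero]
  intro t ht
  have h0 : ∀ z : ExtTensor F (H F m) (H F n) (GenRibbon.P F d.left) (GenRibbon.P F d.right),
      t • z = 0 := by
    intro z
    apply GenRibbon.mergeMap_injective F h d
    have e1 : GenRibbon.mergeMap F h d (t • z) = par F h t • GenRibbon.mergeMap F h d z :=
      (GenRibbon.mergeHom F h d).map_smul t z
    rw [e1, ht, zero_smul]
    exact (map_zero (GenRibbon.mergeMap F h d)).symm
  have hdl : d.left = GenRibbon.antichain m := hl _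
  have hdr : d.right = GenRibbon.antichain n := hl _
  rw [hdl, hdr] at h0
  exact eq_zero_of_smul_antichain F t h0

end

/-! ### Characters and multiplicities -/

section
variable {F A : Type u} [Field F] [Ring A] [Algebra F A]

/-- The `A`-linear maps from `M` to the one-dimensional module given by the character `χ`. -/
def charDual (χ : A →ₐ[F] F) (M : Type*) [AddCommGroup M] [Module A M] : Submodule F (M → F) where
  carrier := {f | (∀ x y, f (x + y) = f x + f y) ∧ ∀ a x, f (a • x) = χ a * f x}
  zero_mem' := by simp
  add_mem' := by
    rintro f g ⟨hf1, hf2⟩ ⟨hg1, hg2⟩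
    refine ⟨fun x y => ?_, fun a x => ?_⟩
    · simp only [Pi.add_apply, hf1, hg1]; ring
    · simp only [Pi.add_apply, hf2, hg2]; ring
  smul_mem' := by
    rintro c f ⟨hf1, hf2⟩
    refine ⟨fun x y => ?_, fun a x => ?_⟩
    · simp only [Pi.smul_apply, hf1, smul_eq_mul]; ring
    · simp only [Pi.smul_apply, hf2, smul_eq_mul]; ring

/-- The dimension of the space of homomorphisms to a one-dimensional module. -/
def mult (χ : A →ₐ[F] F) (M : Type*) [AddCommGroup M] [Module A M] : ℕ :=
  Module.finrank F (charDual χ M)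

section
variable (χ : A →ₐ[F] F) {M N : Type*} [AddCommGroup M] [Module A M] [AddCommGroup N] [Module A N]

variable {χ} in
theorem charDual.map_zero {f : M → F} (hf : f ∈ charDual χ M) : f 0 = 0 := by
  have := hf.1 0 0
  simpa using this

/-- Elements of `charDual χ M` as additive maps. -/
def charDual.hom {χ : A →ₐ[F] F} (f : charDual χ M) : M →+ F where
  toFun := f.1
  map_zero' := charDual.map_zero f.2
  map_add' := f.2.1

theorem charDual.hom_smul {χ : A →ₐ[F] F} (f : charDual χ M) (a : A) (x : M) :
    charDual.hom f (a • x) = χ a * charDual.hom f x := f.2.2 a x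

/-- The space `charDual χ M` is functorial in `M`. -/
def charDual.comap (g : M →ₗ[A] N) : charDual χ N →ₗ[F] charDual χ M where
  toFun f := ⟨fun x => f.1 (g x),
    fun x y => (congrArg f.1 (g.map_add x y)).trans (f.2.1 _ _),
    fun a x => (congrArg f.1 (g.map_smul a x)).trans (f.2.2 _ _)⟩
  map_add' _ _ := rfl
  map_smul' _ _ := rfl

/-- Isomorphic modules have isomorphic spaces `charDual`. -/
def charDual.congr (e : M ≃ₗ[A] N) : charDual χ N ≃ₗ[F] charDual χ M :=
  LinearEquiv.ofLinearMap (charDual.comap χ e.toLinearMap) (charDual.comap χ e.symm.toLinearMap)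
    (by ext f x; simp [charDual.comap]) (by ext f x; simp [charDual.comap])

theorem mult_congr (e : M ≃ₗ[A] N) : mult χ M = mult χ N :=
  (LinearEquiv.finrank_eq (charDual.congr χ e)).symm

/-- An equivariant functional is determined by its values on finitely many generators. Without this
finiteness `finrank` could take its default value zero, and `mult` would be neither additive nor
able to detect nonzero functionals. -/
instance charDual.finite [Module.Finite A M] : Module.Finite F (charDual χ M) := by
  obtain ⟨s, hs⟩ := Module.Finite.fg_top (R := A) (M := M)
  let r : charDual χ M →ₗ[F] (s → F) :=
    { toFun := fun f x => f.1 x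
      map_add' := fun _ _ => rfl
      map_smul' := fun _ _ => rfl }
  refine Module.Finite.of_injective r fun f g h => ?_
  ext x
  have hx : x ∈ Submodule.span A (s : Set M) := hs ▸ Submodule.mem_top
  induction hx using Submodule.span_induction with
  | mem x hx => exact congrFun h ⟨x, hx⟩
  | zero => rw [charDual.map_zero f.2, charDual.map_zero g.2]
  | add x y _ _ hx hy => rw [f.2.1, g.2.1, hx, hy]
  | smul a x _ hx => rw [f.2.2, g.2.2, hx]

/-- `charDual` of a product. -/
def charDual.prod : (charDual χ M × charDual χ N) ≃ₗ[F] charDual χ (M × N) :=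
  LinearEquiv.ofLinearMap
    ((charDual.comap χ (LinearMap.fst A M N)).coprod (charDual.comap χ (LinearMap.snd A M N)))
    ((charDual.comap χ (LinearMap.inl A M N)).prod (charDual.comap χ (LinearMap.inr A M N)))
    (by
      ext f x
      change f.1 (x.1, 0) + f.1 (0, x.2) = f.1 x
      rw [← f.2.1]
      simp)
    (by
      refine LinearMap.ext fun f => Prod.ext (Subtype.ext (funext fun x => ?_))
        (Subtype.ext (funext fun x => ?_))
      · change f.1.1 x + f.2.1 0 = f.1.1 x
        rw [charDual.map_zero f.2.2, add_zero]
      · change f.1.1 0 + f.2.1 x = f.2.1 x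
        rw [charDual.map_zero f.1.2, zero_add])

theorem mult_prod [Module.Finite A M] [Module.Finite A N] :
    mult χ (M × N) = mult χ M + mult χ N := by
  rw [mult, ← (charDual.prod χ).finrank_eq, Module.finrank_prod]
  rfl

theorem mult_of_subsingleton [Subsingleton M] : mult χ M = 0 := by
  have : Subsingleton (charDual χ M) := ⟨fun f g => Subtype.ext (funext fun x => by
    rw [Subsingleton.elim x 0, charDual.map_zero f.2, charDual.map_zero g.2])⟩
  exact Module.finrank_zero_of_subsingleton

/-- `charDual` of a finite direct sum. -/
def charDual.pi {ι : Type*} [DecidableEq ι] (M : ι → Type*) [∀ i, AddCommGroup (M i)]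
    [∀ i, Module A (M i)] : charDual χ (⨁ i, M i) ≃ₗ[F] ∀ i, charDual χ (M i) :=
  LinearEquiv.ofBijective
    (LinearMap.pi fun i => charDual.comap χ (DirectSum.lof A ι M i)) <| by
    constructor
    · intro f g h
      have : charDual.hom f = charDual.hom g := DirectSum.addHom_ext fun i y =>
        congrFun (congrArg Subtype.val (congrFun h i)) y
      exact Subtype.ext (funext fun x => DFunLike.congr_fun this x)
    · intro f
      refine ⟨⟨DirectSum.toAddMonoid fun i => charDual.hom (f i), map_add _, fun a x => ?_⟩, ?_⟩
      · induction x using DirectSum.induction_on with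
        | zero => simp
        | of i x =>
          rw [← DirectSum.lof_eq_of A, ← map_smul, DirectSum.lof_eq_of, DirectSum.lof_eq_of,
            DirectSum.toAddMonoid_of, DirectSum.toAddMonoid_of, charDual.hom_smul]
        | add x y hx hy => rw [smul_add, _root_.map_add, hx, hy, _root_.map_add, mul_add]
      · funext i
        ext x
        exact DirectSum.toAddMonoid_of _ i x

theorem mult_directSum {ι : Type*} [Fintype ι] (M : ι → Type*) [∀ i, AddCommGroup (M i)]
    [∀ i, Module A (M i)] [∀ i, Module.Finite A (M i)] :
    mult χ (⨁ i, M i) = ∑ i, mult χ (M i) := by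
  classical
  rw [mult, (charDual.pi χ M).finrank_eq, Module.finrank_pi_fintype]
  rfl

end
end
end HZero
end

noncomputable section
namespace HZero

/-! ### Grothendieck groups -/

section
variable {F A : Type u} [Field F] [Ring A] [Algebra F A]

variable (F A) in
/-- A finitely generated projective module as an object of the category. -/
def FGProj.mk' (X : Type u) [AddCommGroup X] [Module A X] [Module.Finite A X]
    [Module.Projective A X] : FGProj F A :=
  letI : Module F X := Module.compHom X (algebraMap F A)
  haveI : IsScalarTower F A X := ⟨fun r a x => by
    rw [Algebra.smul_def, mul_smul]
    rfl⟩
  ⟨X⟩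

/-- The underlying module of `FGProj.mk' F A X` is `X`. -/
def FGProj.mkEquiv (X : Type u) [AddCommGroup X] [Module A X] [Module.Finite A X]
    [Module.Projective A X] : FGProj.mk' F A X ≃ₗ[A] X := LinearEquiv.refl A X

theorem K0.cls_eq_add {M L N : FGProj F A} (e : M ≃ₗ[A] L × N) :
    K0.cls M = K0.cls L + K0.cls N := by
  have : QuotientAddGroup.mk' (AddSubgroup.closure (k0Relations F A))
      (FreeAbelianGroup.of M - FreeAbelianGroup.of L - FreeAbelianGroup.of N) = 0 := by
    refine (QuotientAddGroup.eq_zero_iff _).2 (AddSubgroup.subset_closure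
      ⟨L, M, N, e.symm.toLinearMap ∘ₗ LinearMap.inl A L N,
        LinearMap.snd A L N ∘ₗ e.toLinearMap, ?_, ?_, ?_, rfl⟩)
    · exact e.symm.injective.comp LinearMap.inl_injective
    · exact (LinearMap.snd_surjective (R := A)).comp e.surjective
    · intro x
      constructor
      · intro hx
        refine ⟨(e x).1, e.injective ?_⟩
        exact (e.apply_symm_apply _).trans (Prod.ext rfl hx.symm)
      · rintro ⟨y, rfl⟩
        exact congrArg Prod.snd (e.apply_symm_apply (y, 0))
  rw [map_sub, map_sub, sub_sub, sub_eq_zero] at this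
  exact this

theorem K0.cls_of_subsingleton (M : FGProj F A) [Subsingleton M] : K0.cls M = 0 := by
  have : K0.cls M = K0.cls M + K0.cls M := K0.cls_eq_add
    { toFun := fun x => (x, x)
      invFun := Prod.fst
      map_add' := fun _ _ => rfl
      map_smul' := fun _ _ => rfl
      left_inv := fun _ => rfl
      right_inv := fun _ => Subsingleton.elim _ _ }
  exact left_eq_add.1 this

/-- Short exact sequences of projective modules split. -/
theorem exists_prod_equiv {L M N : FGProj F A} (f : L →ₗ[A] M) (g : M →ₗ[A] N)
    (hf : Function.Injective f) (hg : Function.Surjective g) (h : Function.Exact f g) :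
    Nonempty (M ≃ₗ[A] L × N) := by
  obtain ⟨s, hs⟩ := Module.projective_lifting_property g LinearMap.id hg
  exact ⟨(h.splitSurjectiveEquiv hf ⟨s, hs⟩).1⟩

/-- Additive invariants of projective modules factor through the Grothendieck group. -/
def K0.lift {X : Type*} [AddCommGroup X] (f : FGProj F A → X)
    (hf : ∀ {M L N : FGProj F A}, (M ≃ₗ[A] L × N) → f M = f L + f N) : K0 F A →+ X :=
  QuotientAddGroup.lift _ (FreeAbelianGroup.lift f) <| by
    rw [AddSubgroup.closure_le]
    rintro _ ⟨L, M, N, i, p, hi, hp, he, rfl⟩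
    obtain ⟨e⟩ := exists_prod_equiv i p hi hp he
    change FreeAbelianGroup.lift f _ = 0
    rw [map_sub, map_sub, FreeAbelianGroup.lift_apply_of, FreeAbelianGroup.lift_apply_of,
      FreeAbelianGroup.lift_apply_of, hf e]
    abel

@[simp] theorem K0.lift_cls {X : Type*} [AddCommGroup X] (f : FGProj F A → X) (hf)
    (M : FGProj F A) : K0.lift f hf (K0.cls M) = f M := FreeAbelianGroup.lift_apply_of f M

theorem K0.induction {C : K0 F A → Prop} (h0 : C 0) (hcls : ∀ M, C (K0.cls M))
    (hneg : ∀ x, C x → C (-x)) (hadd : ∀ x y, C x → C y → C (x + y)) (x : K0 F A) : C x := by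
  obtain ⟨y, rfl⟩ := QuotientAddGroup.mk'_surjective _ x
  induction y using FreeAbelianGroup.induction_on with
  | zero => exact h0
  | of M => exact hcls M
  | neg M => exact hneg _ (hcls M)
  | add x y hx hy => exact hadd _ _ hx hy

/-- The multiplicity of a character as a function on the Grothendieck group. -/
def K0.mult (χ : A →ₐ[F] F) : K0 F A →+ ℤ :=
  K0.lift (fun M => (HZero.mult χ M : ℤ)) fun {M L N} e => by
    rw [mult_congr χ e, mult_prod]
    push_cast
    rfl

@[simp] theorem K0.mult_cls (χ : A →ₐ[F] F) (M : FGProj F A) :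
    K0.mult χ (K0.cls M) = (HZero.mult χ M : ℤ) := K0.lift_cls ..

theorem K0.isClassOf_mk' (X : Type u) [AddCommGroup X] [Module A X] [Module.Finite A X]
    [Module.Projective A X] : (K0.cls (FGProj.mk' F A X)).IsClassOf X :=
  ⟨_, ⟨FGProj.mkEquiv X⟩, rfl⟩

theorem K0.IsClassOf.mult_eq {x : K0 F A} {X : Type*} [AddCommGroup X] [Module A X]
    (h : x.IsClassOf X) (χ : A →ₐ[F] F) : K0.mult χ x = (HZero.mult χ X : ℤ) := by
  obtain ⟨M, ⟨e⟩, rfl⟩ := h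
  rw [K0.mult_cls, mult_congr χ e]

/-! ### Algebras all of whose simple modules are one-dimensional -/

variable (F A) in
/-- Every nonzero module contains a common eigenvector. -/
def HasEigenvectors : Prop := ∀ (M : Type u) [AddCommGroup M] [Module A M] [Nontrivial M],
  ∃ (χ : A →ₐ[F] F) (v : M), v ≠ 0 ∧ ∀ a : A, a • v = algebraMap F A (χ a) • v

/-- A proper submodule of a finitely generated module lies in the kernel of a nonzero homomorphism
to a one-dimensional module. -/
theorem HasEigenvectors.exists_charDual (hA : HasEigenvectors F A) {M : Type u} [AddCommGroup M]
    [Module A M] [Module.Finite A M] {N : Submodule A M} (hN : N ≠ ⊤) :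
    ∃ (χ : A →ₐ[F] F), ∃ f ∈ charDual χ M, f ≠ 0 ∧ ∀ x ∈ N, f x = 0 := by
  -- The quotient by a maximal submodule containing `N` is simple, hence spanned by any eigenvector
  -- `v` in it. The coordinate along `v` is the required functional.
  obtain ⟨N', hN', hle⟩ := (eq_top_or_exists_le_coatom N).resolve_left hN
  have hsimple : IsSimpleModule A (M ⧸ N') := isSimpleModule_iff_isCoatom.2 hN'
  have := IsSimpleModule.nontrivial A (M ⧸ N')
  obtain ⟨χ, v, hv, hχ⟩ := hA (M ⧸ N')
  have hspan : ∀ q : M ⧸ N', ∃ c : F, algebraMap F A c • v = q := by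
    intro q
    obtain ⟨a, rfl⟩ := Submodule.mem_span_singleton.1
      ((IsSimpleModule.span_singleton_eq_top A hv).symm ▸ Submodule.mem_top :
        q ∈ Submodule.span A {v})
    exact ⟨χ a, (hχ a).symm⟩
  have hinj : ∀ c : F, algebraMap F A c • v = 0 → c = 0 := by
    intro c hc
    by_contra h0
    apply hv
    rw [← one_smul A v, ← map_one (algebraMap F A), ← inv_mul_cancel₀ h0, map_mul, mul_smul, hc,
      smul_zero]
  choose g hg using hspan
  have huniq : ∀ q c, algebraMap F A c • v = q → g q = c := fun q c h => by
    have := hinj (g q - c) (by rw [map_sub, sub_smul, hg, h, sub_self])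
    exact sub_eq_zero.1 this
  refine ⟨χ, fun x => g (N'.mkQ x), ⟨fun x y => ?_, fun a x => ?_⟩, ?_, fun x hx => ?_⟩
  · refine huniq _ _ ?_
    rw [map_add, add_smul, hg, hg, map_add]
  · refine huniq _ _ ?_
    rw [mul_comm, map_mul, mul_smul, ← hχ, ← mul_smul, Algebra.commutes, mul_smul, hg, map_smul]
  · intro h0
    obtain ⟨x, hx⟩ := N'.mkQ_surjective v
    have h1 : g (N'.mkQ x) = 1 := huniq _ _ (by rw [map_one, one_smul, hx])
    have h2 := congrFun h0 x
    rw [h1] at h2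
    exact one_ne_zero h2
  · refine huniq _ _ ?_
    rw [map_zero, zero_smul, eq_comm, Submodule.mkQ_apply, Submodule.Quotient.mk_eq_zero]
    exact hle hx

/-- The one-dimensional module given by a character. -/
def CharMod (_ : A →ₐ[F] F) : Type u := F

instance (χ : A →ₐ[F] F) : AddCommGroup (CharMod χ) := inferInstanceAs (AddCommGroup F)
instance (χ : A →ₐ[F] F) : Module A (CharMod χ) := Module.compHom F χ.toRingHom

/-- Elements of `charDual χ M` as homomorphisms of modules. -/
def charDual.toCharMod {χ : A →ₐ[F] F} {M : Type*} [AddCommGroup M] [Module A M]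
    (f : charDual χ M) : M →ₗ[A] CharMod χ where
  toFun := f.1
  map_add' := f.2.1
  map_smul' := f.2.2

variable (F A) in
/-- Projective indecomposable modules dual to the one-dimensional modules. -/
structure DualSystem (I : Type) [Fintype I] [DecidableEq I] where
  /-- the characters -/
  χ : I → A →ₐ[F] F
  /-- the projective modules -/
  P : I → FGProj F A
  eigen : HasEigenvectors F A
  finite : Module.Finite F A
  surj : Function.Surjective χ
  mult_eq : ∀ i j, mult (χ j) (P i) = if i = j then 1 else 0

namespace DualSystem
variable {I : Type} [Fintype I] [DecidableEq I] (D : DualSystem F A I)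
include D

/-- A homomorphism to `P i` that does not vanish on the top is surjective. -/
theorem surjective_of_charDual (i : I) {M : Type u} [AddCommGroup M] [Module A M]
    (h : M →ₗ[A] D.P i) (g : charDual (D.χ i) (D.P i)) (hne : ∃ x, g.1 (h x) ≠ 0) :
    Function.Surjective h := by
  rw [← LinearMap.range_eq_top]
  by_contra hr
  obtain ⟨χ, f, hf, hf0, hfr⟩ := D.eigen.exists_charDual hr
  obtain ⟨j, rfl⟩ := D.surj χ
  have hd := D.mult_eq i j
  have hpos : 0 < mult (D.χ j) (D.P i) := by
    have : Nontrivial (charDual (D.χ j) (D.P i)) :=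
      ⟨⟨⟨f, hf⟩, 0, fun e => hf0 (congrArg Subtype.val e)⟩⟩
    exact Module.finrank_pos
  obtain rfl : i = j := by
    by_contra hij
    rw [hd, if_neg hij] at hpos
    exact lt_irrefl _ hpos
  rw [if_pos rfl] at hd
  -- Both `f` and `g` lie in a one-dimensional space, so `g` is a multiple of `f` and vanishes on
  -- the range of `h`, contrary to assumption.
  obtain ⟨c, hc⟩ := (finrank_eq_one_iff_of_nonzero' (⟨f, hf⟩ : charDual (D.χ i) (D.P i))
    (fun e => hf0 (congrArg Subtype.val e))).1 hd g
  obtain ⟨x, hx⟩ := hne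
  apply hx
  rw [← hc]
  change c * f (h x) = 0
  rw [hfr _ (LinearMap.mem_range_self h x), mul_zero]

/-- A projective module with a homomorphism to a one-dimensional module has the corresponding
`P i` as a summand. -/
theorem exists_summand (M : FGProj F A) (i : I) (hi : mult (D.χ i) M ≠ 0) :
    ∃ M' : FGProj F A, Nonempty (M ≃ₗ[A] D.P i × M') ∧
      Module.finrank F M' < Module.finrank F M := by
  have := D.finite
  have hM : Module.Finite F M := Module.Finite.trans A M
  have hP : Module.Finite F (D.P i) := Module.Finite.trans A (D.P i)
  obtain ⟨f, hf⟩ : ∃ f : charDual (D.χ i) M, f ≠ 0 := by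
    by_contra! h
    have : Subsingleton (charDual (D.χ i) M) := ⟨fun a b => by rw [h a, h b]⟩
    exact hi Module.finrank_zero_of_subsingleton
  obtain ⟨g, hg⟩ : ∃ f : charDual (D.χ i) (D.P i), f ≠ 0 := by
    by_contra! h
    have : Subsingleton (charDual (D.χ i) (D.P i)) := ⟨fun a b => by rw [h a, h b]⟩
    have h0 : mult (D.χ i) (D.P i) = 0 := Module.finrank_zero_of_subsingleton
    rw [D.mult_eq, if_pos rfl] at h0
    exact one_ne_zero h0
  have hne : ∀ {X : Type u} [AddCommGroup X] [Module A X] {f : charDual (D.χ i) X}, f ≠ 0 →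
      ∃ x, f.1 x ≠ 0 := fun {X _ _ f} h => by
    by_contra! h'
    exact h (Subtype.ext (funext h'))
  obtain ⟨y, hy⟩ := hne hg
  have hgs : Function.Surjective (charDual.toCharMod g) := by
    intro c
    refine ⟨algebraMap F A ((show F from c) * (g.1 y)⁻¹) • y, ?_⟩
    have h1 : g.1 (algebraMap F A ((show F from c) * (g.1 y)⁻¹) • y) = c := by
      rw [g.2.2, AlgHom.commutes, Algebra.algebraMap_self, RingHom.id_apply, mul_assoc,
        inv_mul_cancel₀ hy, mul_one]
    exact h1
  -- Projectivity of `M` lifts `f` along the surjection from `P i` onto the one-dimensional module.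
  -- The lift is onto because `f` is nonzero, and it splits because `P i` is projective.
  obtain ⟨h, hh⟩ := Module.projective_lifting_property (charDual.toCharMod g)
    (charDual.toCharMod f) hgs
  have hsurj : Function.Surjective h := by
    refine D.surjective_of_charDual i h g ?_
    obtain ⟨x, hx⟩ := hne hf
    refine ⟨x, fun e => hx ?_⟩
    exact (LinearMap.congr_fun hh x).symm.trans e
  obtain ⟨s, hs⟩ := Module.projective_lifting_property h LinearMap.id hsurj
  have e : M ≃ₗ[A] (LinearMap.ker h) × D.P i :=
    ((LinearMap.exact_subtype_ker_map h).splitSurjectiveEquiv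
      (Submodule.injective_subtype _) ⟨s, hs⟩).1
  have hproj : Module.Projective A (M.carrier) := M.projective
  have hfin : Module.Finite A (M.carrier) := M.finite
  have : Module.Projective A (LinearMap.ker h) :=
    Module.Projective.of_split (e.symm.toLinearMap ∘ₗ LinearMap.inl A _ _)
      (LinearMap.fst A _ _ ∘ₗ e.toLinearMap) (LinearMap.ext fun x => by simp)
  have : Module.Finite A (LinearMap.ker h) :=
    Module.Finite.of_surjective (LinearMap.fst A _ _ ∘ₗ e.toLinearMap)
      ((LinearMap.fst_surjective (R := A)).comp e.surjective)
  obtain ⟨M', ⟨e'⟩⟩ : ∃ M' : FGProj F A, Nonempty (M' ≃ₗ[A] LinearMap.ker h) :=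
    ⟨FGProj.mk' F A _, ⟨FGProj.mkEquiv _⟩⟩
  have e2 : M ≃ₗ[A] D.P i × M' := e.trans ((LinearEquiv.prodComm A _ _).trans
    ((LinearEquiv.refl A _).prodCongr e'.symm))
  refine ⟨M', ⟨e2⟩, ?_⟩
  have hM' : Module.Finite F M' := Module.Finite.trans A M'
  rw [(e2.restrictScalars F).finrank_eq, Module.finrank_prod]
  have : Nontrivial (D.P i) := ⟨⟨y, 0, fun e => hy (by rw [e, charDual.map_zero g.2])⟩⟩
  have : 0 < Module.finrank F (D.P i) := Module.finrank_pos
  omega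

theorem exists_mult_ne_zero (M : FGProj F A) [Nontrivial M] : ∃ i, mult (D.χ i) M ≠ 0 := by
  obtain ⟨χ, f, hf, hf0, -⟩ := D.eigen.exists_charDual (M := M) (N := ⊥) bot_ne_top
  obtain ⟨j, rfl⟩ := D.surj χ
  have : Nontrivial (charDual (D.χ j) M) :=
    ⟨⟨⟨f, hf⟩, 0, fun e => hf0 (congrArg Subtype.val e)⟩⟩
  exact ⟨j, Module.finrank_pos.ne'⟩

/-- A nonzero projective module has some `P i` as a summand; splitting it off lowers the dimension.
-/
theorem cls_mem_closure (M : FGProj F A) :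
    K0.cls M ∈ AddSubgroup.closure (Set.range fun i => K0.cls (D.P i)) := by
  induction hk : Module.finrank F M using Nat.strong_induction_on generalizing M with
  | _ k ih =>
    rcases subsingleton_or_nontrivial M with h | h
    · rw [K0.cls_of_subsingleton]
      exact zero_mem _
    · obtain ⟨i, hi⟩ := D.exists_mult_ne_zero M
      obtain ⟨M', ⟨e⟩, hlt⟩ := D.exists_summand M i hi
      rw [K0.cls_eq_add e]
      exact add_mem (AddSubgroup.subset_closure ⟨i, rfl⟩) (ih _ (hk ▸ hlt) M' rfl)

/-- Projective modules are determined by the multiplicities of the one-dimensional modules. -/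
theorem nonempty_equiv (M N : FGProj F A) (h : ∀ i, mult (D.χ i) M = mult (D.χ i) N) :
    Nonempty (M ≃ₗ[A] N) := by
  induction hk : Module.finrank F M using Nat.strong_induction_on generalizing M N with
  | _ k ih =>
    rcases subsingleton_or_nontrivial M with hM | hM
    · rcases subsingleton_or_nontrivial N with hN | hN
      · exact ⟨LinearEquiv.ofSubsingleton _ _⟩
      · obtain ⟨i, hi⟩ := D.exists_mult_ne_zero N
        rw [← h i, mult_of_subsingleton] at hi
        exact (hi rfl).elim
    · obtain ⟨i, hi⟩ := D.exists_mult_ne_zero M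
      obtain ⟨M', ⟨e⟩, hlt⟩ := D.exists_summand M i hi
      -- The same `P i` splits off from both modules, and additivity shows that the complements have
      -- equal multiplicities again.
      obtain ⟨N', ⟨e'⟩, -⟩ := D.exists_summand N i (h i ▸ hi)
      obtain ⟨e''⟩ := ih _ (hk ▸ hlt) M' N' (fun j => by
        have := h j
        rw [mult_congr _ e, mult_congr _ e', mult_prod, mult_prod] at this
        exact Nat.add_left_cancel this) rfl
      exact ⟨e.trans (((LinearEquiv.refl A _).prodCongr e'').trans e'.symm)⟩

/-- The multiplicities of the one-dimensional modules. -/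
def multHom : K0 F A →+ (I → ℤ) := AddMonoidHom.mk' (fun x i => K0.mult (D.χ i) x)
  fun x y => funext fun _ => map_add _ x y

/-- By duality the map `s` from coordinates to classes is a right inverse of `multHom`; it is onto
because the classes of the `P i` generate, so it is inverse on both sides. -/
theorem multHom_bijective : Function.Bijective D.multHom := by
  let s : (I → ℤ) → K0 F A := fun c => ∑ i, c i • K0.cls (D.P i)
  have h1 : ∀ c, D.multHom (s c) = c := by
    intro c
    funext j
    change K0.mult (D.χ j) (∑ i, c i • K0.cls (D.P i)) = c j
    simp [D.mult_eq]
  refine ⟨?_, fun c => ⟨s c, h1 c⟩⟩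
  have hs : Function.Surjective s := by
    intro x
    have hx : x ∈ AddSubgroup.closure (Set.range fun i => K0.cls (D.P i)) := by
      induction x using K0.induction with
      | h0 => exact zero_mem _
      | hcls M => exact D.cls_mem_closure M
      | hneg x hx => exact neg_mem hx
      | hadd x y hx hy => exact add_mem hx hy
    induction hx using AddSubgroup.closure_induction with
    | mem x hx =>
      obtain ⟨i, rfl⟩ := hx
      refine ⟨Pi.single i 1, ?_⟩
      simp only [s]
      rw [Finset.sum_eq_single i]
      · simp
      · intro j _ hj
        simp [Pi.single_eq_of_ne hj]
      · simp
    | zero => exact ⟨0, by simp [s]⟩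
    | add x y _ _ hx hy =>
      obtain ⟨c, rfl⟩ := hx
      obtain ⟨d, rfl⟩ := hy
      exact ⟨c + d, by simp [s, add_smul, Finset.sum_add_distrib]⟩
    | neg x _ hx =>
      obtain ⟨c, rfl⟩ := hx
      exact ⟨-c, by simp [s]⟩
  intro x y hxy
  obtain ⟨c, rfl⟩ := hs x
  obtain ⟨d, rfl⟩ := hs y
  rw [h1, h1] at hxy
  rw [hxy]

/-- The Grothendieck group is free on the classes of the modules `P i`; the coordinates are
the multiplicities of the one-dimensional modules. -/
def equiv : K0 F A ≃+ (I → ℤ) := AddEquiv.ofBijective D.multHom D.multHom_bijective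

theorem equiv_apply (x : K0 F A) (i : I) : D.equiv x i = K0.mult (D.χ i) x := rfl

theorem equiv_P (i : I) : D.equiv (K0.cls (D.P i)) = Pi.single i 1 := by
  funext j
  rw [equiv_apply, K0.mult_cls, D.mult_eq, Pi.single_apply]
  by_cases h : i = j
  · simp [h]
  · simp [h, Ne.symm h]

theorem ext {x y : K0 F A} (h : ∀ i, K0.mult (D.χ i) x = K0.mult (D.χ i) y) : x = y :=
  D.equiv.injective (funext h)

theorem isClassOf {x : K0 F A} (X : Type u) [AddCommGroup X] [Module A X] [Module.Finite A X]
    [Module.Projective A X] (h : ∀ i, K0.mult (D.χ i) x = (mult (D.χ i) X : ℤ)) :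
    x.IsClassOf X := by
  rw [D.ext (x := x) (y := K0.cls (FGProj.mk' F A X)) fun i => by
    rw [h, (K0.isClassOf_mk' X).mult_eq]]
  exact K0.isClassOf_mk' X

end DualSystem
end
end HZero
end

noncomputable section
namespace HZero

/-! ### External tensor products of projective modules -/

section
variable {F A B : Type u} [Field F] [Ring A] [Algebra F A] [Ring B] [Algebra F B]

/-- The character `χ ⊗ ψ` of `A ⊗ B`. -/
def charTensor (χ : A →ₐ[F] F) (ψ : B →ₐ[F] F) : A ⊗[F] B →ₐ[F] F :=
  Algebra.TensorProduct.lift χ ψ fun _ _ => Commute.all _ _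

@[simp] theorem charTensor_tmul (χ : A →ₐ[F] F) (ψ : B →ₐ[F] F) (a : A) (b : B) :
    charTensor χ ψ (a ⊗ₜ b) = χ a * ψ b := Algebra.TensorProduct.lift_tmul ..

theorem charTensor_surjective (θ : A ⊗[F] B →ₐ[F] F) : ∃ χ ψ, charTensor χ ψ = θ :=
  ⟨θ.comp Algebra.TensorProduct.includeLeft, θ.comp Algebra.TensorProduct.includeRight, by
    ext a
    · simp [← Algebra.TensorProduct.one_def]
    · simp [← Algebra.TensorProduct.one_def]⟩

/-- The two actions commute, so the eigenspace of a character of `A` is stable under `B`; an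
eigenvector of `B` inside it is a common eigenvector. -/
theorem HasEigenvectors.tensor (hA : HasEigenvectors F A) (hB : HasEigenvectors F B) :
    HasEigenvectors F (A ⊗[F] B) := by
  intro M _ _ _
  let iA : Module A M := Module.compHom M
    (Algebra.TensorProduct.includeLeft : A →ₐ[F] A ⊗[F] B).toRingHom
  let iB : Module B M := Module.compHom M
    (Algebra.TensorProduct.includeRight : B →ₐ[F] A ⊗[F] B).toRingHom
  have eA : ∀ (a : A) (x : M), a • x = (a ⊗ₜ[F] (1 : B)) • x := fun _ _ => rfl
  have eB : ∀ (b : B) (x : M), b • x = ((1 : A) ⊗ₜ[F] b) • x := fun _ _ => rfl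
  have ealg : ∀ (r : F) (x : M), algebraMap F A r • x = algebraMap F B r • x := by
    intro r x
    rw [eA, eB, Algebra.algebraMap_eq_smul_one, Algebra.algebraMap_eq_smul_one,
      TensorProduct.smul_tmul]
  have hcomm : ∀ (a : A) (b : B) (x : M), a • b • x = b • a • x := by
    intro a b x
    rw [eA, eB, eB, eA, ← mul_smul, ← mul_smul]
    simp
  obtain ⟨χ, v, hv, hχ⟩ := hA M
  let W : Submodule B M :=
    { carrier := {w | ∀ a : A, a • w = algebraMap F A (χ a) • w}
      zero_mem' := fun a => by rw [smul_zero, smul_zero]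
      add_mem' := fun {x y} hx hy a => by rw [smul_add, hx a, hy a, smul_add]
      smul_mem' := fun b x hx a => by rw [hcomm, hx a, hcomm] }
  have : Nontrivial W := ⟨⟨⟨v, hχ⟩, 0, fun e => hv (congrArg Subtype.val e)⟩⟩
  obtain ⟨ψ, w, hw, hψ⟩ := hB W
  refine ⟨charTensor χ ψ, w, fun e => hw (Subtype.ext e), fun t => ?_⟩
  induction t with
  | zero => simp
  | add s t hs ht => rw [add_smul, hs, ht, map_add, map_add, add_smul]
  | tmul a b =>
    have h1 : b • (w : M) = algebraMap F B (ψ b) • (w : M) := congrArg Subtype.val (hψ b)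
    have h2 : (a ⊗ₜ[F] b) • (w : M) = a • b • (w : M) := by
      rw [eA, eB, ← mul_smul]
      simp
    have h3 : a • (w : M) = algebraMap F A (χ a) • (w : M) := w.2 a
    rw [h2, h1, ← ealg, ← mul_smul, ← Algebra.commutes, mul_smul, h3, ← mul_smul, ← map_mul,
      charTensor_tmul, mul_comm (χ a), eA]
    rfl

section
variable {M N : Type*} [AddCommGroup M] [AddCommGroup N] [Module F M] [Module F N]
  [Module A M] [Module B N] [IsScalarTower F A M] [IsScalarTower F B N]

instance : IsScalarTower F (A ⊗[F] B) (ExtTensor F A B M N) where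
  smul_assoc r t z := by
    change extAction F A B M N (r • t) z = r • extAction F A B M N t z
    rw [map_smul]
    rfl

instance ExtTensor.finite_base [Module.Finite F M] [Module.Finite F N] :
    Module.Finite F (ExtTensor F A B M N) := inferInstanceAs (Module.Finite F (M ⊗[F] N))

instance ExtTensor.finite [Module.Finite F M] [Module.Finite F N] :
    Module.Finite (A ⊗[F] B) (ExtTensor F A B M N) :=
  Module.Finite.of_restrictScalars_finite F _ _

/-- Each factor is a retract of a free module. The tensor product of the two retractions exhibits `M
⊗ N` as a retract of the free module on `M × N`. -/
instance ExtTensor.projective [Module.Projective A M] [Module.Projective B N] :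
    Module.Projective (A ⊗[F] B) (ExtTensor F A B M N) := by
  obtain ⟨s, hs⟩ := (Module.projective_def (R := A) (P := M)).1 inferInstance
  obtain ⟨t, ht⟩ := (Module.projective_def (R := B) (P := N)).1 inferInstance
  let i : M ⊗[F] N →ₗ[F] (M × N →₀ A ⊗[F] B) :=
    (finsuppTensorFinsupp F F A B M N).toLinearMap ∘ₗ
      TensorProduct.map (s.restrictScalars F) (t.restrictScalars F)
  let p : (M × N →₀ A ⊗[F] B) →ₗ[A ⊗[F] B] ExtTensor F A B M N :=
    Finsupp.linearCombination _ fun q => q.1 ⊗ₜ[F] q.2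
  have hp : ∀ (f : M →₀ A) (g : N →₀ B), p (finsuppTensorFinsupp F F A B M N (f ⊗ₜ g)) =
      (Finsupp.linearCombination A id f) ⊗ₜ[F] (Finsupp.linearCombination B id g) := by
    intro f g
    induction f using Finsupp.induction_linear with
    | zero => simp only [TensorProduct.zero_tmul, map_zero]; rfl
    | add f f' hf hf' =>
      rw [TensorProduct.add_tmul, map_add, map_add, hf, hf', map_add, TensorProduct.add_tmul]; rfl
    | single x a =>
      induction g using Finsupp.induction_linear with
      | zero => simp only [TensorProduct.tmul_zero, map_zero]; rfl
      | add g g' hg hg' =>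
        rw [TensorProduct.tmul_add, map_add, map_add, hg, hg', map_add, TensorProduct.tmul_add]; rfl
      | single y b =>
        rw [finsuppTensorFinsupp_single, Finsupp.linearCombination_single,
          Finsupp.linearCombination_single]
        exact Finsupp.linearCombination_single ..
  have hi : ∀ (f : M →₀ A) (g : N →₀ B) (a : A) (b : B),
      finsuppTensorFinsupp F F A B M N ((a • f) ⊗ₜ (b • g)) =
        (a ⊗ₜ[F] b) • finsuppTensorFinsupp F F A B M N (f ⊗ₜ g) := by
    intro f g a b
    ext ⟨x, y⟩
    simp
  refine Module.Projective.of_split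
    (ExtTensor.hom i.toAddMonoidHom fun a b x y => ?_) p (LinearMap.ext fun z => ?_)
  · change finsuppTensorFinsupp F F A B M N (s (a • x) ⊗ₜ t (b • y)) = _
    rw [map_smul, map_smul, hi]
    rfl
  · change (show M ⊗[F] N from p (i z)) = z
    induction z using TensorProduct.induction_on with
    | zero => rw [map_zero, map_zero]; rfl
    | add x y hx hy => rw [map_add, map_add]; exact congrArg₂ (· + ·) hx hy
    | tmul x y => exact (hp _ _).trans (congrArg₂ _ (hs x) (ht y))

variable (χ : A →ₐ[F] F) (ψ : B →ₐ[F] F)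

/-- The product of functionals. -/
def charDual.tmul (f : charDual χ M) (g : charDual ψ N) :
    charDual (charTensor χ ψ) (ExtTensor F A B M N) := by
  let f' : M →ₗ[F] F :=
    { toFun := f.1
      map_add' := f.2.1
      map_smul' := fun r x => by
        rw [← algebraMap_smul A r x, f.2.2, AlgHom.commutes]; rfl }
  let g' : N →ₗ[F] F :=
    { toFun := g.1
      map_add' := g.2.1
      map_smul' := fun r x => by
        rw [← algebraMap_smul B r x, g.2.2, AlgHom.commutes]; rfl }
  let m : M ⊗[F] N →ₗ[F] F := LinearMap.mul' F F ∘ₗ TensorProduct.map f' g'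
  let m' := ExtTensor.hom (L := CharMod (charTensor χ ψ)) m.toAddMonoidHom fun a b x y => by
    change f.1 (a • x) * g.1 (b • y) = charTensor χ ψ (a ⊗ₜ b) * (f.1 x * g.1 y)
    rw [f.2.2, g.2.2, charTensor_tmul]
    ring
  exact ⟨m', m'.map_add, m'.map_smul⟩

theorem charDual.tensor_ext {f g : charDual (charTensor χ ψ) (ExtTensor F A B M N)}
    (h : ∀ x y, f.1 (x ⊗ₜ[F] y : M ⊗[F] N) = g.1 (x ⊗ₜ[F] y : M ⊗[F] N)) : f = g := by
  refine Subtype.ext (funext fun z => ?_)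
  induction z using TensorProduct.induction_on with
  | zero => exact (charDual.map_zero f.2).trans (charDual.map_zero g.2).symm
  | add x y hx hy => exact (f.2.1 x y).trans ((congrArg₂ _ hx hy).trans (g.2.1 x y).symm)
  | tmul x y => exact h x y

theorem charDual.sum_apply {L ι : Type*} [AddCommGroup L] [Module A L] [Fintype ι]
    (f : ι → charDual χ L) (x : L) :
    (∑ i, f i).1 x = ∑ i, (f i).1 x :=
  (congrFun (AddSubmonoidClass.coe_finsetSum f Finset.univ) x).trans (Finset.sum_apply _ _ _)

/-- For fixed `y`, a functional on `M ⊗ N` restricts to an element of `charDual χ M`. Its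
coordinates in a basis, as functions of `y`, lie in `charDual ψ N`, so functionals correspond to
families of elements of `charDual ψ N` indexed by that basis. -/
theorem mult_extTensor [Module.Finite A M] [Module.Finite B N] :
    mult (charTensor χ ψ) (ExtTensor F A B M N) = mult χ M * mult ψ N := by
  let b : Module.Basis (Fin (mult χ M)) F (charDual χ M) := Module.finBasis F _
  let Φ : (Fin (mult χ M) → charDual ψ N) →ₗ[F]
      charDual (charTensor χ ψ) (ExtTensor F A B M N) :=
    { toFun := fun g => ∑ i, charDual.tmul χ ψ (b i) (g i)
      map_add' := fun g g' => by
        rw [← Finset.sum_add_distrib]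
        refine Finset.sum_congr rfl fun i _ => charDual.tensor_ext χ ψ fun x y => ?_
        exact mul_add _ _ _
      map_smul' := fun c g => by
        rw [RingHom.id_apply, Finset.smul_sum]
        refine Finset.sum_congr rfl fun i _ => charDual.tensor_ext χ ψ fun x y => ?_
        exact mul_left_comm _ _ _ }
  have hΦ : ∀ g x y, (Φ g).1 (x ⊗ₜ[F] y : M ⊗[F] N) = ∑ i, (b i).1 x * (g i).1 y := by
    intro g x y
    exact charDual.sum_apply _ (fun i => charDual.tmul χ ψ (b i) (g i)) _
  have hb : ∀ (c : Fin (mult χ M) → F) (x : M), (∑ i, c i • b i).1 x = ∑ i, (b i).1 x * c i := by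
    intro c x
    rw [charDual.sum_apply]
    exact Finset.sum_congr rfl fun i _ => mul_comm _ _
  have hinj : Function.Injective Φ := by
    refine (injective_iff_map_eq_zero Φ).2 fun g hg => funext fun i =>
      Subtype.ext (funext fun y => ?_)
    have h0 : ∑ i, (g i).1 y • b i = 0 := Subtype.ext <| funext fun x => by
      rw [hb (fun i => (g i).1 y), ← hΦ, hg]
      rfl
    exact Fintype.linearIndependent_iff.1 b.linearIndependent _ h0 i
  have hsurj : Function.Surjective Φ := by
    intro f
    let sl : N → charDual χ M := fun y => ⟨fun x => f.1 (x ⊗ₜ[F] y : M ⊗[F] N),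
      fun x x' => (congrArg f.1 (TensorProduct.add_tmul x x' y)).trans (f.2.1 _ _),
      fun a x => by
        have := f.2.2 (a ⊗ₜ 1) (x ⊗ₜ[F] y : M ⊗[F] N)
        rw [charTensor_tmul, map_one, mul_one] at this
        rw [← this]
        exact congrArg f.1 (congrArg (fun z => (a • x) ⊗ₜ[F] z) (one_smul B y).symm)⟩
    have sl_add : ∀ y y', sl (y + y') = sl y + sl y' := fun y y' => Subtype.ext <| funext fun x =>
      (congrArg f.1 (TensorProduct.tmul_add x y y')).trans (f.2.1 _ _)
    have sl_smul : ∀ (c : B) y, sl (c • y) = ψ c • sl y := fun c y =>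
      Subtype.ext <| funext fun x => by
        have := f.2.2 (1 ⊗ₜ c) (x ⊗ₜ[F] y : M ⊗[F] N)
        rw [charTensor_tmul, map_one, one_mul] at this
        refine Eq.trans ?_ this
        exact congrArg f.1 (congrArg (fun z => z ⊗ₜ[F] (c • y)) (one_smul A x).symm)
    refine ⟨fun i => ⟨fun y => b.repr (sl y) i, fun y y' => ?_, fun c y => ?_⟩, ?_⟩
    · change b.repr (sl (y + y')) i = b.repr (sl y) i + b.repr (sl y') i
      rw [sl_add, map_add, Finsupp.add_apply]
    · change b.repr (sl (c • y)) i = ψ c * b.repr (sl y) i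
      rw [sl_smul, map_smul, Finsupp.smul_apply, smul_eq_mul]
    · refine charDual.tensor_ext χ ψ fun x y => ?_
      rw [hΦ, ← hb (fun i => b.repr (sl y) i), b.sum_repr]
  rw [mult, ← (LinearEquiv.ofBijective Φ ⟨hinj, hsurj⟩).finrank_eq, Module.finrank_pi_fintype,
    Finset.sum_const, Finset.card_univ, Fintype.card_fin]
  rfl

end

/-- The dual system of a tensor product. -/
def DualSystem.tensor {I J : Type} [Fintype I] [DecidableEq I] [Fintype J] [DecidableEq J]
    (D : DualSystem F A I) (E : DualSystem F B J) : DualSystem F (A ⊗[F] B) (I × J) := by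
  haveI := D.finite
  haveI := E.finite
  haveI : ∀ i, Module.Finite F (D.P i) := fun i => Module.Finite.trans A _
  haveI : ∀ i, Module.Finite F (E.P i) := fun i => Module.Finite.trans B _
  exact
  { χ := fun p => charTensor (D.χ p.1) (E.χ p.2)
    P := fun p => FGProj.mk' F (A ⊗[F] B) (ExtTensor F A B (D.P p.1) (E.P p.2))
    eigen := D.eigen.tensor E.eigen
    finite := inferInstance
    surj := fun θ => by
      obtain ⟨χ, ψ, rfl⟩ := charTensor_surjective θ
      obtain ⟨i, rfl⟩ := D.surj χ
      obtain ⟨j, rfl⟩ := E.surj ψ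
      exact ⟨(i, j), rfl⟩
    mult_eq := fun p q => by
      rw [mult_congr _ (FGProj.mkEquiv _), mult_extTensor, D.mult_eq, E.mult_eq]
      by_cases h1 : p.1 = q.1 <;> by_cases h2 : p.2 = q.2 <;> simp [h1, h2, Prod.ext_iff] }

end

/-! ### Restriction -/

section
variable {F A B : Type u} [Field F] [Ring A] [Algebra F A] [Ring B] [Algebra F B] (φ : B →ₐ[F] A)

section
variable {M N : Type*} [AddCommGroup M] [Module F M] [Module A M] [IsScalarTower F A M]
  [AddCommGroup N] [Module F N] [Module A N] [IsScalarTower F A N]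

instance : IsScalarTower F B (Res F φ M) where
  smul_assoc r b x := by
    change φ (r • b) • (show M from x) = r • (φ b • (show M from x))
    rw [map_smul, smul_assoc]

instance Res.finite [Module.Finite F M] : Module.Finite B (Res F φ M) :=
  haveI : Module.Finite F (Res F φ M) := inferInstanceAs (Module.Finite F M)
  Module.Finite.of_restrictScalars_finite F _ _

/-- Restriction of homomorphisms. -/
def Res.map (f : M →ₗ[A] N) : Res F φ M →ₗ[B] Res F φ N where
  toFun := f
  map_add' := f.map_add
  map_smul' b := f.map_smul (φ b)

/-- Restriction of isomorphisms. -/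
def Res.mapEquiv (e : M ≃ₗ[A] N) : Res F φ M ≃ₗ[B] Res F φ N :=
  { Res.map φ e.toLinearMap with
    invFun := e.symm
    left_inv := e.symm_apply_apply
    right_inv := e.apply_symm_apply }

/-- Restriction commutes with products. -/
def Res.prodEquiv : Res F φ (M × N) ≃ₗ[B] Res F φ M × Res F φ N where
  toFun x := x
  invFun x := x
  map_add' _ _ := rfl
  map_smul' _ _ := rfl
  left_inv _ := rfl
  right_inv _ := rfl

/-- If `A` is projective over `B`, restriction preserves projectivity. -/
theorem Res.projective {L : Type*} [AddCommGroup L] [Module A L]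
    [Module.Projective B (Res F φ A)] [Module.Projective A L] :
    Module.Projective B (Res F φ L) := by
  classical
  obtain ⟨s, hs⟩ := Module.projective_def'.1 (inferInstance : Module.Projective A L)
  let e : (L →₀ Res F φ A) ≃ₗ[B] Res F φ (L →₀ A) :=
    { toFun := fun x => x
      invFun := fun x => x
      map_add' := fun _ _ => rfl
      map_smul' := fun _ _ => Finsupp.ext fun _ => rfl
      left_inv := fun _ => rfl
      right_inv := fun _ => rfl }
  have : Module.Projective B (Res F φ (L →₀ A)) :=
    Module.Projective.of_equiv ((finsuppLequivDFinsupp B).symm.trans e)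
  exact Module.Projective.of_split (Res.map φ s)
    (Res.map φ (Finsupp.linearCombination A (id : L → L)))
    (LinearMap.ext fun x => LinearMap.congr_fun hs x)

end

/-! ### Induction -/

section
variable (X : Type*) [AddCommGroup X] [Module F X] [Module B X]

instance : Module F (Ind F φ X) := by unfold Ind; infer_instance
instance : IsScalarTower F A (Ind F φ X) := by unfold Ind; infer_instance

/-- The quotient map `A ⊗_F X → A ⊗_B X`. -/
def Ind.mk : A ⊗[F] X →ₗ[A] Ind F φ X := Submodule.mkQ _

theorem Ind.mk_surjective : Function.Surjective (Ind.mk φ X) := Submodule.mkQ_surjective _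

theorem Ind.mk_mul (a : A) (b : B) (x : X) :
    Ind.mk φ X ((a * φ b) ⊗ₜ[F] x) = Ind.mk φ X (a ⊗ₜ[F] (b • x)) :=
  (Submodule.Quotient.eq _).2 (Submodule.subset_span ⟨a, b, x, rfl⟩)

instance Ind.finite_base [Module.Finite F A] [Module.Finite F X] :
    Module.Finite F (Ind F φ X) :=
  Module.Finite.of_surjective ((Ind.mk φ X).restrictScalars F) (Ind.mk_surjective φ X)

instance Ind.finite [Module.Finite F A] [Module.Finite F X] : Module.Finite A (Ind F φ X) :=
  Module.Finite.of_restrictScalars_finite F _ _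

variable {X}

/-- The canonical map `X → A ⊗_B X`. -/
def Ind.of : X →ₗ[F] Ind F φ X := (Ind.mk φ X).restrictScalars F ∘ₗ TensorProduct.mk F A X 1

theorem Ind.smul_of (a : A) (x : X) : a • Ind.of φ x = Ind.mk φ X (a ⊗ₜ[F] x) := by
  change a • Ind.mk φ X (1 ⊗ₜ[F] x) = _
  rw [← map_smul, TensorProduct.smul_tmul', smul_eq_mul, mul_one]

theorem Ind.of_smul (b : B) (x : X) : Ind.of φ (b • x) = φ b • Ind.of φ x := by
  rw [Ind.smul_of, ← one_mul (φ b), Ind.mk_mul]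
  rfl

/-- The canonical map as a homomorphism of `B`-modules. -/
def Ind.ofHom : X →ₗ[B] Res F φ (Ind F φ X) where
  toFun := Ind.of φ
  map_add' := (Ind.of φ).map_add
  map_smul' := Ind.of_smul φ

variable {φ}

theorem Ind.induction {C : Ind F φ X → Prop} (h0 : C 0) (hadd : ∀ y z, C y → C z → C (y + z))
    (hsmul : ∀ (a : A) (x : X), C (a • Ind.of φ x)) (y : Ind F φ X) : C y := by
  obtain ⟨t, rfl⟩ := Ind.mk_surjective φ X y
  induction t using TensorProduct.induction_on with
  | zero => rw [map_zero]; exact h0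
  | add s t hs ht => rw [map_add]; exact hadd _ _ hs ht
  | tmul a x => rw [← Ind.smul_of]; exact hsmul a x

/-- The universal property of the induced module. -/
def Ind.lift {Y : Type*} [AddCommGroup Y] [Module F Y] [Module A Y] [IsScalarTower F A Y]
    (g : X →ₗ[F] Y) (hg : ∀ (b : B) x, g (b • x) = φ b • g x) : Ind F φ X →ₗ[A] Y :=
  Submodule.liftQ _ (TensorProduct.AlgebraTensorModule.lift
    { toFun := fun a => (Algebra.lsmul F F Y a) ∘ₗ g
      map_add' := fun a b => LinearMap.ext fun x => add_smul a b (g x)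
      map_smul' := fun a b => LinearMap.ext fun x => mul_smul a b (g x) }) <| by
    rw [Submodule.span_le]
    rintro _ ⟨a, b, x, rfl⟩
    rw [SetLike.mem_coe, LinearMap.mem_ker, map_sub, sub_eq_zero]
    change (a * φ b) • g x = a • g (b • x)
    rw [hg, mul_smul]

theorem Ind.lift_of {Y : Type*} [AddCommGroup Y] [Module F Y] [Module A Y] [IsScalarTower F A Y]
    (g : X →ₗ[F] Y) (hg : ∀ (b : B) x, g (b • x) = φ b • g x) (x : X) :
    Ind.lift g hg (Ind.of φ x) = g x := one_smul A (g x)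

theorem Ind.hom_ext {Y : Type*} [AddCommGroup Y] [Module A Y]
    {f g : Ind F φ X →ₗ[A] Y} (h : ∀ x, f (Ind.of φ x) = g (Ind.of φ x)) : f = g := by
  ext y
  induction y using Ind.induction with
  | h0 => rw [map_zero, map_zero]
  | hadd y z hy hz => rw [map_add, map_add, hy, hz]
  | hsmul a x => rw [map_smul, map_smul, h]

/-- Induction preserves projectivity. -/
instance Ind.projective [IsScalarTower F B X] [Module.Projective B X] :
    Module.Projective A (Ind F φ X) := by
  -- It suffices to split surjections onto the induced module. Over `B` the canonical map out of `X`
  -- lifts, and the universal property extends this lift to a section.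
  refine Module.Projective.of_lifting_property'' fun f hf => ?_
  obtain ⟨g, hg⟩ := Module.projective_lifting_property (Res.map φ f) (Ind.ofHom φ) hf
  let g' : X →ₗ[F] (Ind F φ X →₀ A) :=
    { toFun := g
      map_add' := g.map_add
      map_smul' := fun r x => by
        rw [← algebraMap_smul B r x]
        refine (g.map_smul (algebraMap F B r) x).trans ?_
        change φ (algebraMap F B r) • (show Ind F φ X →₀ A from g x) = r • _
        rw [AlgHom.commutes, algebraMap_smul] }
  refine ⟨Ind.lift g' fun b x => g.map_smul b x, Ind.hom_ext fun x => ?_⟩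
  exact (congrArg f (Ind.lift_of g' (fun b x => g.map_smul b x) x)).trans
    (LinearMap.congr_fun hg x)

instance (χ : A →ₐ[F] F) : Module F (CharMod χ) := inferInstanceAs (Module F F)
instance (χ : A →ₐ[F] F) : IsScalarTower F A (CharMod χ) where
  smul_assoc r a x := by
    change χ (r • a) * (show F from x) = r * (χ a * (show F from x))
    rw [map_smul, smul_eq_mul, mul_assoc]

/-- Frobenius reciprocity for one-dimensional modules. -/
theorem mult_ind [IsScalarTower F B X] (χ : A →ₐ[F] F) :
    mult χ (Ind F φ X) = mult (χ.comp φ) X := by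
  let r : charDual χ (Ind F φ X) →ₗ[F] charDual (χ.comp φ) X :=
    { toFun := fun f => ⟨fun x => f.1 (Ind.of φ x), fun x y =>
          (congrArg f.1 (map_add (Ind.of φ) x y)).trans (f.2.1 _ _),
        fun b x => (congrArg f.1 (Ind.of_smul φ b x)).trans (f.2.2 _ _)⟩
      map_add' := fun _ _ => rfl
      map_smul' := fun _ _ => rfl }
  refine (LinearEquiv.ofBijective r ⟨fun f g h => ?_, fun g => ?_⟩).finrank_eq
  · have : charDual.toCharMod f = charDual.toCharMod g :=
      Ind.hom_ext fun x => congrFun (congrArg Subtype.val h) x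
    exact Subtype.ext (funext fun x => LinearMap.congr_fun this x)
  · let g' : X →ₗ[F] CharMod χ :=
      { toFun := g.1
        map_add' := g.2.1
        map_smul' := fun c x => by
          rw [← algebraMap_smul B c x, g.2.2, AlgHom.commutes]
          rfl }
    let f := Ind.lift (φ := φ) g' fun b x => g.2.2 b x
    exact ⟨⟨f, f.map_add, f.map_smul⟩, Subtype.ext (funext fun x => Ind.lift_of g' _ x)⟩

end
end
end HZero
end

noncomputable section
namespace HZero

/-! ### The one-dimensional modules of the 0-Hecke algebra -/

section
variable {F : Type u} [Field F] {n : ℕ}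

theorem H.algHom_ext {A : Type*} [Ring A] [Algebra F A] {φ ψ : H F n →ₐ[F] A}
    (h : ∀ i, φ (pi F i) = ψ (pi F i)) : φ = ψ := by
  ext a
  induction a using H.induction with
  | halg r => rw [AlgHom.commutes, AlgHom.commutes]
  | hpi i => exact h i
  | hmul a b ha hb => rw [map_mul, map_mul, ha, hb]
  | hadd a b ha hb => rw [map_add, map_add, ha, hb]

variable (F) in
/-- The character with `π_i ↦ 0` for `i ∈ D` and `π_i ↦ 1` for `i ∉ D`. -/
def H.character (D : Finset (Fin (n - 1))) : H F n →ₐ[F] F :=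
  H.lift (fun i => if i ∈ D then 0 else 1) (fun i => by split_ifs <;> simp)
    (fun i j _ => by split_ifs <;> simp) (fun i j _ => mul_comm _ _)

@[simp] theorem H.character_pi (D : Finset (Fin (n - 1))) (i : Fin (n - 1)) :
    H.character F D (pi F i) = if i ∈ D then 0 else 1 := H.lift_pi ..

/-- Each generator is idempotent, so a character takes only the values `0` and `1` on the
generators. -/
theorem H.character_surjective : Function.Surjective (H.character F (n := n)) := by
  classical
  intro χ
  refine ⟨Finset.univ.filter fun i => χ (pi F i) = 0, H.algHom_ext fun i => ?_⟩
  have h : χ (pi F i) * χ (pi F i) = χ (pi F i) := by rw [← map_mul, pi_idem]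
  rw [H.character_pi]
  split_ifs with h0
  · exact (Finset.mem_filter.1 h0).2.symm
  · have : χ (pi F i) ≠ 0 := fun e => h0 (Finset.mem_filter.2 ⟨Finset.mem_univ _, e⟩)
    exact (mul_left_cancel₀ this (h.trans (mul_one _).symm)).symm

/-- Map the regular module onto the submodule generated by a nonzero vector, and among the
permutations with nonzero image choose one with maximal `pot`. If `i + 1` precedes `i` in it, `π_i`
kills it. Otherwise `π_i` adds the exchanged permutation, whose `pot` is larger and whose image is
therefore zero. So its image is an eigenvector with eigenvalues `0` and `1`. -/
theorem H.hasEigenvectors : HasEigenvectors F (H F n) := by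
  classical
  intro M _ _ _
  obtain ⟨m, hm⟩ := exists_ne (0 : M)
  let φ : GenRibbon.P F (GenRibbon.antichain n) →ₗ[H F n] M :=
    LinearMap.toSpanSingleton (H F n) M m ∘ₗ (GenRibbon.regularEquiv F n).symm.toLinearMap
  let g : Equiv.Perm (Fin n) → M := fun σ => φ (GenRibbon.P.single F (GenRibbon.ofPerm σ))
  have h1 : g 1 ≠ 0 := by
    have : GenRibbon.regularEquiv F n 1 = GenRibbon.P.single F (GenRibbon.ofPerm 1) :=
      one_smul (H F n) _
    have h2 : g 1 = m := by
      change φ (GenRibbon.P.single F (GenRibbon.ofPerm 1)) = m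
      rw [← this, LinearMap.comp_apply, LinearEquiv.coe_coe, LinearEquiv.symm_apply_apply,
        LinearMap.toSpanSingleton_apply, one_smul]
    rwa [h2]
  obtain ⟨σ, hσ, hmax⟩ := Set.exists_max_image {σ | g σ ≠ 0} GenRibbon.pot (Set.toFinite _) ⟨1, h1⟩
  let D : Finset (Fin (n - 1)) := Finset.univ.filter fun i =>
    σ.symm (GenRibbon.hi i) < σ.symm (GenRibbon.lo i)
  refine ⟨H.character F D, g σ, hσ, fun a => ?_⟩
  induction a using H.induction with
  | halg r => rw [AlgHom.commutes]; rfl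
  | hmul a b ha hb =>
    rw [mul_smul, hb, ← mul_smul, ← Algebra.commutes, mul_smul, ha, ← mul_smul, ← map_mul,
      map_mul (H.character F D), mul_comm]
  | hadd a b ha hb => rw [add_smul, ha, hb, map_add, map_add, add_smul]
  | hpi i =>
    rw [H.character_pi, ← map_smul φ]
    by_cases hi' : σ.symm (GenRibbon.hi i) < σ.symm (GenRibbon.lo i)
    · rw [GenRibbon.pi_smul_single_of_gt F i (GenRibbon.ofPerm σ) hi', if_pos (by simpa [D] using hi'), map_zero,
        map_zero, zero_smul]
    · have hlt : σ.symm (GenRibbon.lo i) < σ.symm (GenRibbon.hi i) := by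
        refine lt_of_le_of_ne (not_lt.1 hi') fun e => ?_
        have := congrArg Fin.val (σ.symm.injective e)
        simp at this
      have h0 : g (σ.trans (Equiv.swap (GenRibbon.lo i) (GenRibbon.hi i))) = 0 := by
        by_contra hne
        exact (hmax _ hne).not_gt (GenRibbon.pot_lt σ i hlt)
      rw [GenRibbon.pi_smul_ofPerm σ i hlt, if_neg (by simpa [D] using hlt.le), map_add, map_one,
        one_smul]
      exact (congrArg (· + g σ) h0).trans (zero_add _)

end

/-! ### Multiplicities of the one-dimensional modules in `P_α` -/

namespace GenRibbon

section
variable {n : ℕ} {α : GenRibbon n}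

/-- Two steps to the right are not descents, two steps upwards are. -/
def Compat (α : GenRibbon n) (D : Finset (Fin (n - 1))) : Prop :=
  ∀ q, (α.step q = Step.right → q ∉ D) ∧ (α.step q = Step.up → q ∈ D)

/-- The number of elements of the complement of `D` before `p`. -/
def blockIndex (D : Finset (Fin (n - 1))) (p : Fin n) : ℕ :=
  (Finset.univ.filter fun q : Fin (n - 1) => (q : ℕ) < p ∧ q ∉ D).card

theorem blockIndex_mono (D : Finset (Fin (n - 1))) {p q : Fin n} (h : p ≤ q) :
    blockIndex D p ≤ blockIndex D q :=
  Finset.card_le_card fun r hr => by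
    simp only [Finset.mem_filter, Finset.mem_univ, true_and] at hr ⊢
    exact ⟨hr.1.trans_le h, hr.2⟩

/-- The fibres of `blockIndex D` are thus the intervals obtained by joining `i` and `i + 1` for all
`i ∈ D`, that is, the orbits of the subgroup generated by the corresponding transpositions. -/
theorem blockIndex_hi (D : Finset (Fin (n - 1))) (i : Fin (n - 1)) :
    blockIndex D (hi i) = blockIndex D (lo i) + if i ∈ D then 0 else 1 := by
  unfold blockIndex
  split_ifs with h
  · rw [add_zero]
    refine congrArg Finset.card (Finset.ext fun r => ?_)
    rw [Finset.mem_filter, Finset.mem_filter]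
    simp only [Finset.mem_univ, true_and, val_lo, val_hi]
    constructor
    · rintro ⟨h1, h2⟩
      have : (r : ℕ) ≠ i := fun e => h2 (Fin.ext e ▸ h)
      exact ⟨by omega, h2⟩
    · rintro ⟨h1, h2⟩
      exact ⟨by omega, h2⟩
  · rw [← Finset.card_insert_of_notMem (a := i) (by simp)]
    refine congrArg Finset.card (Finset.ext fun r => ?_)
    rw [Finset.mem_insert, Finset.mem_filter, Finset.mem_filter]
    simp only [Finset.mem_univ, true_and, val_lo, val_hi, Fin.ext_iff]
    constructor
    · rintro ⟨h1, h2⟩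
      by_cases e : (r : ℕ) = i
      · exact Or.inl e
      · exact Or.inr ⟨by omega, h2⟩
    · rintro (h1 | ⟨h1, h2⟩)
      · exact ⟨by omega, fun hc => h (Fin.ext h1 ▸ hc)⟩
      · exact ⟨by omega, h2⟩

end

section
variable {F : Type u} [Field F] {n : ℕ} {α : GenRibbon n}

/-- The module is generated by the identity tableau, so one value determines an equivariant
functional. In particular every multiplicity is at most one. -/
theorem NoUp.charDual_ext (h : α.NoUp) {χ : H F n →ₐ[F] F} {f g : charDual χ (P F α)}
    (hfg : f.1 (P.single F h.idTab) = g.1 (P.single F h.idTab)) : f = g := by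
  have : charDual.toCharMod f = charDual.toCharMod g :=
    LinearMap.ext_on (NoUp.span_idTab (F := F) h) fun x hx => by
      rw [Set.mem_singleton_iff.1 hx]
      exact hfg
  exact Subtype.ext (funext fun x => LinearMap.congr_fun this x)

theorem character_smul (D : Finset (Fin (n - 1))) (i : Fin (n - 1)) (x : F) :
    (pi F i : H F n) • (show CharMod (H.character F D) from x) =
      (if i ∈ D then 0 else x : F) := by
  change H.character F D (pi F i) * x = _
  rw [H.character_pi]
  split_ifs <;> simp

open Classical in
/-- The signed sum over the permutations that preserve the blocks of `D`. -/
def NoUp.functional {D : Finset (Fin (n - 1))} (hD : α.Compat D) :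
    P F α →ₗ[H F n] CharMod (H.character F D) :=
  P.lift (fun T => (if ∀ p, blockIndex D (T.perm p) = blockIndex D p then
      ((Equiv.Perm.sign T.perm : ℤ) : F) else 0 : F))
    (fun i T h => by
      rw [character_smul]
      split_ifs with h1 h2
      · rfl
      -- Since `i ∉ D`, the entry `hi i` belongs to a later block than `lo i`, while its box comes
      -- earlier; a block-preserving filling cannot do this.
      · exfalso
        have e1 := h2 (T.box (lo i))
        have e2 := h2 (T.box (hi i))
        rw [StdTableau.perm_box] at e1 e2
        have h3 := blockIndex_mono D h.le
        rw [← e1, ← e2, blockIndex_hi, if_neg h1] at h3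
        omega
      · rfl)
    (fun i T h => by
      rw [character_smul]
      split_ifs with h1 h2
      -- The entries lie in one block since `i ∈ D`, but their boxes are separated by a right step,
      -- which by compatibility is not in `D` and so separates two blocks.
      · exfalso
        obtain ⟨q, hq, e1, e2⟩ := (T.rowOf_eq_iff i).1 h
        have e3 := h2 (T.box (lo i))
        have e4 := h2 (T.box (hi i))
        rw [StdTableau.perm_box] at e3 e4
        rw [e1] at e3
        rw [e2, blockIndex_hi, blockIndex_hi, if_pos h1, if_neg ((hD q).1 hq)] at e4
        omega
      · rfl
      · rfl
      · rfl)
    (fun i T h => by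
      rw [character_smul]
      have hlt := ((T.rowOf_lt i).1 h).1
      have hE : (T.swapEntries (lo i) (hi i) rfl h).perm =
        T.perm.trans (Equiv.swap (lo i) (hi i)) := rfl
      rw [hE]
      by_cases h1 : i ∈ D
      -- For `i ∈ D` the exchange stays within a block and reverses the sign, so the two terms
      -- cancel, as they must because the character vanishes on `π_i`.
      · have hs : ∀ e, blockIndex D (Equiv.swap (lo i) (hi i) e) = blockIndex D e := fun e => by
          have := blockIndex_hi D i
          rw [if_pos h1, add_zero] at this
          rw [Equiv.swap_apply_def]
          split_ifs with h2 h3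
          · rw [h2, this]
          · rw [h3, this]
          · rfl
        have hne : (lo i : Fin n) ≠ hi i := fun e => by
          have := congrArg Fin.val e
          simp at this
        simp only [Equiv.trans_apply, hs, Equiv.Perm.sign_trans, Equiv.Perm.sign_swap hne]
        rw [if_pos h1]
        by_cases hT : ∀ p, blockIndex D (T.perm p) = blockIndex D p
        · refine Eq.trans ?_ (congrArg₂ (fun a b : F => a + b) (if_pos hT) (if_pos hT)).symm
          simp
          rfl
        · refine Eq.trans ?_ (congrArg₂ (fun a b : F => a + b) (if_neg hT) (if_neg hT)).symm
          simp
          rfl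
      -- For `i ∉ D` the character is `1` on `π_i`. The exchange puts an entry of the later block
      -- into the earlier box, so the exchanged tableau does not preserve blocks and contributes
      -- zero.
      · rw [if_neg h1]
        refine (zero_add _).symm.trans (congrArg₂ (fun a b : F => a + b) (if_neg ?_) rfl).symm
        intro hc
        have e1 := hc (T.box (lo i))
        have e2 := hc (T.box (hi i))
        rw [Equiv.trans_apply, StdTableau.perm_box, Equiv.swap_apply_left, blockIndex_hi,
          if_neg h1] at e1
        rw [Equiv.trans_apply, StdTableau.perm_box, Equiv.swap_apply_right] at e2
        have := blockIndex_mono D hlt.le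
        omega)

open Classical in
-- If `D` is compatible, the signed functional takes the value `1` on the generator, and cyclicity
-- makes it unique up to scalars. If some right step `q` lies in `D`, then `π_q` fixes the generator
-- while the character is zero on `π_q`, so every functional vanishes.
theorem NoUp.mult_eq (h : α.NoUp) (D : Finset (Fin (n - 1))) :
    mult (H.character F D) (P F α) = if α.Compat D then 1 else 0 := by
  split_ifs with hD
  · let L := NoUp.functional (F := F) hD
    let f : charDual (H.character F D) (P F α) := ⟨L, L.map_add, L.map_smul⟩
    have hf : f.1 (P.single F h.idTab) = 1 := by
      refine (P.lift_single (N := CharMod (H.character F D)) _ _ _ _ _).trans ((if_pos fun p => rfl).trans ?_)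
      change ((Equiv.Perm.sign (1 : Equiv.Perm (Fin n)) : ℤ) : F) = 1
      simp
    have hf0 : f ≠ 0 := fun e => by
      rw [e] at hf
      exact zero_ne_one hf
    refine (finrank_eq_one_iff_of_nonzero' f hf0).2 fun w => ⟨w.1 (P.single F h.idTab), ?_⟩
    refine h.charDual_ext ?_
    change _ * f.1 _ = _
    rw [hf, mul_one]
  · have : Subsingleton (charDual (H.character F D) (P F α)) := by
      refine subsingleton_of_forall_eq 0 fun f => h.charDual_ext ?_
      change f.1 _ = 0
      simp only [Compat, not_forall, not_and_or, not_not] at hD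
      obtain ⟨q, ⟨hq, hqD⟩ | ⟨hq, -⟩⟩ := hD
      · have e := pi_smul_single_of_eq F q h.idTab ((α.row_lo_eq_iff q).2 hq)
        rw [← e, f.2.2, H.character_pi, if_pos hqD, zero_mul]
      · exact (h q hq).elim
    exact Module.finrank_zero_of_subsingleton

open Classical in
/-- The multiplicities of the one-dimensional modules in `P_α`. -/
theorem mult_P (α : GenRibbon n) (D : Finset (Fin (n - 1))) :
    mult (H.character F D) (P F α) = if α.Compat D then 1 else 0 := by
  induction α using upInduction with
  | h0 α h => exact h.mult_eq D
  | h1 α p hp ha hr =>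
    obtain ⟨e⟩ := P.gap_equiv (F := F) hp
    -- Multiplicities add over the split extension at the gap, so the value for the upward
    -- resolution is a difference of two known ones. A set compatible with `α` is compatible with
    -- exactly one resolution: the upward one if it contains `p`, the other if it does not.
    rw [mult_congr _ e, mult_prod, hr] at ha
    have key : ∀ s : Step, (α.setStep p s).Compat D ↔
        α.Compat D ∧ (s = Step.right → p ∉ D) ∧ (s = Step.up → p ∈ D) := fun s => by
      constructor
      · refine fun H => ⟨fun q => ?_, ?_⟩
        · by_cases hq : q = p
          · rw [hq, hp]; simp
          · have := H q
            rwa [setStep_ne hq] at this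
        · have := H p
          rwa [setStep_same] at this
      · rintro ⟨H1, H2⟩ q
        by_cases hq : q = p
        · rw [hq, setStep_same]; exact H2
        · rw [setStep_ne hq]; exact H1 q
    have k1 := key Step.right
    have k2 := key Step.up
    simp only [true_implies, reduceCtorEq, false_implies, and_true, true_and] at k1 k2
    simp only [k1, k2] at ha ⊢
    by_cases c1 : α.Compat D <;> by_cases c2 : p ∈ D <;> simp [c1, c2] at ha ⊢ <;> omega

end

/-! ### Ribbons, their descent sets and the resolutions of a shape -/

section
variable {n : ℕ}

/-- The ribbon with descent set `D`. -/
def ofSet (D : Finset (Fin (n - 1))) : GenRibbon n :=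
  ⟨fun q => if q ∈ D then Step.up else Step.right⟩

theorem isRibbon_ofSet (D : Finset (Fin (n - 1))) : (ofSet D).IsRibbon := fun q => by
  simp only [ofSet]
  split_ifs <;> simp

theorem IsRibbon.compat_iff {β : GenRibbon n} (h : β.IsRibbon) {D : Finset (Fin (n - 1))} :
    β.Compat D ↔ β = ofSet D := by
  constructor
  · refine fun H => GenRibbon.ext (funext fun q => ?_)
    have h1 := h q
    have h2 := H q
    simp only [ofSet]
    cases e : β.step q <;> simp_all
  · rintro rfl q
    simp only [ofSet]
    split_ifs <;> simp_all

theorem ofSet_injective : Function.Injective (ofSet (n := n)) := fun D E h => by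
  ext q
  have := congrFun (congrArg step h) q
  simp only [ofSet] at this
  split_ifs at this <;> simp_all

theorem ofSet_mem_resolutions {α : GenRibbon n} {D : Finset (Fin (n - 1))} :
    ofSet D ∈ α.resolutions ↔ α.Compat D := by
  constructor
  · rintro ⟨-, h⟩ q
    have h1 := h q
    simp only [ofSet] at h1
    refine ⟨fun e hq => ?_, fun e => ?_⟩
    · rw [e, if_pos hq] at h1
      simp at h1
    · by_contra hq
      rw [e, if_neg hq] at h1
      simp at h1
  · refine fun H => ⟨isRibbon_ofSet D, fun q hq => ?_⟩
    have h2 := H q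
    simp only [ofSet]
    cases e : α.step q <;> simp_all

instance : Finite Step :=
  Finite.of_injective (fun s : Step => (decide (s = Step.up), decide (s = Step.gap))) fun s t h => by
    cases s <;> cases t <;> simp_all

instance : Finite (GenRibbon n) :=
  Finite.of_injective GenRibbon.step fun _ _ h => GenRibbon.ext h

instance (α : GenRibbon n) (m k : ℕ) : Finite (α.Decomp m k) :=
  Finite.of_injective Decomp.S fun _ _ h => Decomp.ext_S h

variable {F : Type u} [Field F]

open Classical in
-- A ribbon is compatible with its own descent set only, so the left side counts the resolutions
-- with descent set `D`. There is one if `D` is compatible with `α`, and none otherwise.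
theorem sum_mult_resolutions (α : GenRibbon n) [Fintype α.resolutions] (D : Finset (Fin (n - 1))) :
    ∑ β : α.resolutions, mult (H.character F D) (P F β.1) = mult (H.character F D) (P F α) := by
  simp only [mult_P]
  by_cases h : α.Compat D
  · rw [if_pos h, Finset.sum_eq_single ⟨ofSet D, ofSet_mem_resolutions.2 h⟩]
    · rw [if_pos ((isRibbon_ofSet D).compat_iff.2 rfl)]
    · intro β _ hβ
      rw [if_neg fun hc => hβ (Subtype.ext (β.2.1.compat_iff.1 hc))]
    · simp
  · rw [if_neg h]
    refine Finset.sum_eq_zero fun β _ => if_neg fun hc => h ?_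
    rw [← ofSet_mem_resolutions, ← β.2.1.compat_iff.1 hc]
    exact β.2

end
end GenRibbon

/-! ### The dual system of the 0-Hecke algebra -/

section
variable (F : Type u) [Field F] (n : ℕ)

/-- The projective modules `P_α` of the ribbons are dual to the one-dimensional modules. -/
def H.dualSystem : DualSystem F (H F n) (Finset (Fin (n - 1))) where
  χ := H.character F
  P D := FGProj.mk' F (H F n) (GenRibbon.P F (GenRibbon.ofSet D))
  eigen := H.hasEigenvectors
  finite := inferInstance
  surj := H.character_surjective
  mult_eq D E := by
    classical
    rw [mult_congr _ (FGProj.mkEquiv _), GenRibbon.mult_P]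
    refine if_congr ?_ rfl rfl
    rw [(GenRibbon.isRibbon_ofSet D).compat_iff, GenRibbon.ofSet_injective.eq_iff]

end
end HZero
end

noncomputable section
namespace HZero

/-! ### Restriction of `P_α` -/

section
variable (F : Type u) [Field F] {m k N : ℕ} (h : m + k = N)

open GenRibbon

instance projective_res_P (α : GenRibbon N) :
    Module.Projective (H F m ⊗[F] H F k) (Res F (par F h) (P F α)) :=
  Module.Projective.of_equiv (resEquiv F h α)

/-- The regular module is `P_α` for isolated boxes, whose restriction is a direct sum of
projectives. This is the hypothesis that lets restriction act on Grothendieck groups. -/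
instance projective_res_regular :
    Module.Projective (H F m ⊗[F] H F k) (Res F (par F h) (H F N)) :=
  Module.Projective.of_equiv (Res.mapEquiv (par F h) (regularEquiv F N)).symm

theorem mult_directSum_extTensor {I : Type} [Fintype I] (β : I → GenRibbon m)
    (γ : I → GenRibbon k) (χ : H F m →ₐ[F] F) (ψ : H F k →ₐ[F] F) :
    mult (charTensor χ ψ) (⨁ i, ExtTensor F (H F m) (H F k) (P F (β i)) (P F (γ i))) =
      ∑ i, mult χ (P F (β i)) * mult ψ (P F (γ i)) := by
  rw [mult_directSum]
  exact Finset.sum_congr rfl fun i _ => mult_extTensor χ ψ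

theorem mult_res (α : GenRibbon N) [Fintype (α.Decomp m k)] (χ : H F m →ₐ[F] F)
    (ψ : H F k →ₐ[F] F) : mult (charTensor χ ψ) (Res F (par F h) (P F α)) =
      ∑ d : α.Decomp m k, mult χ (P F d.left) * mult ψ (P F d.right) := by
  rw [← mult_congr _ (resEquiv F h α), mult_directSum_extTensor]

/-- Both modules are projective over a tensor product of algebras with dual systems, so equality of
multiplicities suffices. It follows from the first description of the restriction together with
`sum_mult_resolutions` in each factor; no explicit isomorphism is constructed. -/
theorem nonempty_res_equiv (α : GenRibbon N) :
    Nonempty (Res F (par F h) (P F α) ≃ₗ[H F m ⊗[F] H F k]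
      ⨁ t : (Σ d : α.Decomp m k, d.left.resolutions × d.right.resolutions),
        ExtTensor F (H F m) (H F k) (P F t.2.1.1) (P F t.2.2.1)) := by
  classical
  have := Fintype.ofFinite (α.Decomp m k)
  have (d : α.Decomp m k) := Fintype.ofFinite d.left.resolutions
  have (d : α.Decomp m k) := Fintype.ofFinite d.right.resolutions
  obtain ⟨e⟩ := ((H.dualSystem F m).tensor (H.dualSystem F k)).nonempty_equiv
    (FGProj.mk' F _ (Res F (par F h) (P F α)))
    (FGProj.mk' F _ (⨁ t : (Σ d : α.Decomp m k, d.left.resolutions × d.right.resolutions),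
        ExtTensor F (H F m) (H F k) (P F t.2.1.1) (P F t.2.2.1))) fun D => by
      rw [mult_congr _ (FGProj.mkEquiv _), mult_congr _ (FGProj.mkEquiv _)]
      refine (mult_res F h α (H.character F D.1) (H.character F D.2)).trans (Eq.trans ?_
        (mult_directSum_extTensor F _ _ (H.character F D.1) (H.character F D.2)).symm)
      rw [Fintype.sum_sigma]
      refine Finset.sum_congr rfl fun d _ => ?_
      rw [Fintype.sum_prod_type, ← sum_mult_resolutions, ← sum_mult_resolutions,
        Finset.sum_mul_sum]
  exact ⟨((FGProj.mkEquiv _).symm.trans e).trans (FGProj.mkEquiv _)⟩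

end
end HZero
end

noncomputable section
namespace HZero

/-! ### Descents of words -/

/-- The descents of a word of length `n`. -/
def descents (n : ℕ) (w : List ℤ) : Finset (Fin (n - 1)) :=
  Finset.univ.filter fun q => w.getD (q + 1) 0 < w.getD q 0

theorem mem_descents {n : ℕ} {w : List ℤ} {q : Fin (n - 1)} :
    q ∈ descents n w ↔ w.getD (q + 1) 0 < w.getD q 0 := by simp [descents]

/-- A word with descent set `D`. -/
def wordOf {n : ℕ} (D : Finset (Fin (n - 1))) : List ℤ :=
  List.ofFn fun p : Fin n => -((Finset.univ.filter fun q => q ∈ D ∧ (q : ℕ) < p).card : ℤ)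

theorem length_wordOf {n : ℕ} (D : Finset (Fin (n - 1))) : (wordOf D).length = n :=
  List.length_ofFn

/-- The letter at `p` is minus the number of elements of `D` before `p`, so the word drops exactly
at the elements of `D`. Hence every set of positions is visible in the series. -/
theorem descents_wordOf {n : ℕ} (D : Finset (Fin (n - 1))) : descents n (wordOf D) = D := by
  ext q
  have hq := q.2
  rw [mem_descents, List.getD_eq_getElem _ _ (by rw [length_wordOf]; omega),
    List.getD_eq_getElem _ _ (by rw [length_wordOf]; omega)]
  simp only [wordOf, List.getElem_ofFn, neg_lt_neg_iff, Nat.cast_lt]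
  constructor
  · intro h
    by_contra hD
    refine h.not_ge (Finset.card_le_card fun r hr => ?_)
    rw [Finset.mem_filter] at hr ⊢
    have : (r : ℕ) ≠ q := fun e => hD (Fin.ext e ▸ hr.2.1)
    have h3 : (r : ℕ) < q + 1 := hr.2.2
    exact ⟨hr.1, hr.2.1, show (r : ℕ) < q by omega⟩
  · intro hD
    refine Finset.card_lt_card ((Finset.ssubset_iff_of_subset fun r hr => ?_).2 ⟨q, ?_, ?_⟩)
    · rw [Finset.mem_filter] at hr ⊢
      exact ⟨hr.1, hr.2.1, hr.2.2.trans (Nat.lt_succ_self _)⟩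
    · rw [Finset.mem_filter]
      exact ⟨Finset.mem_univ _, hD, Nat.lt_succ_self _⟩
    · rw [Finset.mem_filter]
      exact fun h => lt_irrefl _ h.2.2

namespace NCSeries
variable {X : Type*}

/-- The coefficient of a word. -/
def coeff (w : List X) : NCSeries X →+ ℤ where
  toFun f := f w
  map_zero' := rfl
  map_add' _ _ := rfl

theorem coeff_apply (w : List X) (f : NCSeries X) : coeff w f = f w := rfl

theorem neg_one_pow_mul_apply (k : ℕ) (f : NCSeries X) (w : List X) :
    ((-1) ^ k * f) w = (-1) ^ k * f w := by
  rcases neg_one_pow_eq_or ℤ k with h | h <;> rcases k.even_or_odd with h' | h'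
  · rw [h'.neg_one_pow, h, one_mul, one_mul]
  · rw [h'.neg_one_pow] at h; norm_num at h
  · rw [h'.neg_one_pow] at h; norm_num at h
  · rw [h'.neg_one_pow, h, neg_one_mul, neg_one_mul]; rfl

end NCSeries

namespace GenRibbon
variable {n : ℕ} (α : GenRibbon n)

open Classical in
-- Read step by step, semistandardness of a word says that right steps are not descents and upward
-- steps are.
theorem series_apply (w : List ℤ) :
    α.series w = if w.length = n ∧ α.Compat (descents n w) then 1 else 0 := by
  refine if_congr ?_ rfl rfl
  rw [← exists_prop]
  refine exists_congr fun hw => ?_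
  have e : (fun p : Fin n => w.get (p.cast hw.symm)) = fun p : Fin n => w.getD p 0 := by
    funext p
    rw [List.getD_eq_getElem _ _ (by rw [hw]; exact p.2)]
    rfl
  rw [e, isSemistandard_iff]
  refine forall_congr' fun q => ?_
  rw [mem_descents, not_lt]
  rfl

end GenRibbon

/-! ### The realization of `NSym` -/

namespace NSym

theorem hSeries_zero : hSeries 0 = 1 := by
  ext w
  rw [NCSeries.one_apply, hSeries]
  refine if_congr ⟨fun h => h.1, fun h => ⟨h, ?_⟩⟩ rfl rfl
  rw [List.length_eq_zero_iff.1 h]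
  exact List.Pairwise.nil

theorem realize_h (k : ℕ) : realize (h k) = hSeries k := lift_h hSeries hSeries_zero k

theorem pairwise_take_iff {w : List ℤ} {k : ℕ} (hk : k ≤ w.length) :
    (w.take k).Pairwise (· ≤ ·) ↔ ∀ q, q + 1 < k → w.getD q 0 ≤ w.getD (q + 1) 0 := by
  rw [← List.isChain_iff_pairwise, List.isChain_iff_getElem]
  have e : (w.take k).length = k := by rw [List.length_take, min_eq_left hk]
  refine forall_congr' fun q => ⟨fun H hq => ?_, fun H hq => ?_⟩
  · have := H (by omega)
    rwa [List.getElem_take, List.getElem_take, ← List.getD_eq_getElem _ 0 (by omega),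
      ← List.getD_eq_getElem _ 0 (by omega)] at this
  · rw [List.getElem_take, List.getElem_take, ← List.getD_eq_getElem _ 0 (by omega),
      ← List.getD_eq_getElem _ 0 (by omega)]
    exact H (by omega)

theorem ite_mul_ite_one {p q : Prop} [Decidable p] [Decidable q] [Decidable (p ∧ q)] :
    (if p then (1 : ℤ) else 0) * (if q then 1 else 0) = if p ∧ q then 1 else 0 := by
  by_cases hp : p <;> by_cases hq : q <;> simp [hp, hq]

open Classical in
/-- The coefficients of a product of complete functions: descents may occur only at the partial
sums. -/
theorem realize_prod (L : List ℕ) (w : List ℤ) : realize ((L.map h).prod) w =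
    if w.length = L.sum ∧ ∀ q, q + 1 < w.length → w.getD (q + 1) 0 < w.getD q 0 →
      ∃ i, (L.take i).sum = q + 1 then 1 else 0 := by
  induction L generalizing w with
  | nil =>
    rw [List.map_nil, List.prod_nil, map_one, NCSeries.one_apply]
    refine if_congr ⟨fun h => ⟨h, fun q hq => ?_⟩, fun h => h.1⟩ rfl rfl
    omega
  | cons k L ih =>
    rw [List.map_cons, List.prod_cons, map_mul, realize_h, NCSeries.mul_apply, List.sum_cons]
    have hz : ∀ i ∈ Finset.range (w.length + 1), i ≠ k →
        hSeries k (w.take i) * realize ((L.map h).prod) (w.drop i) = 0 := by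
      intro i hi hik
      rw [Finset.mem_range] at hi
      rw [hSeries, if_neg, zero_mul]
      rintro ⟨h1, -⟩
      rw [List.length_take] at h1
      omega
    by_cases hk : k ≤ w.length
    · rw [Finset.sum_eq_single_of_mem k (by rw [Finset.mem_range]; omega) hz, ih, hSeries,
        ite_mul_ite_one]
      refine if_congr ?_ rfl rfl
      rw [pairwise_take_iff hk]
      have hd : ∀ j, (w.drop k).getD j 0 = w.getD (k + j) 0 := fun j => by
        rw [List.getD_eq_getElem?_getD, List.getElem?_drop, ← List.getD_eq_getElem?_getD]
      simp only [List.length_drop, hd, List.length_take, min_eq_left hk, true_and]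
      constructor
      · rintro ⟨h1, h2, h3⟩
        refine ⟨by omega, fun q hq hlt => ?_⟩
        rcases lt_trichotomy (q + 1) k with h | h | h
        · exact ((h1 q h).not_gt hlt).elim
        · exact ⟨1, by simp [h]⟩
        · obtain ⟨j, rfl⟩ : ∃ j, q = k + j := ⟨q - k, by omega⟩
          obtain ⟨i, hi⟩ := h3 j (by omega) hlt
          exact ⟨i + 1, by rw [List.take_succ_cons, List.sum_cons, hi]; omega⟩
      · rintro ⟨h1, h2⟩
        refine ⟨fun q hq => ?_, by omega, fun q hq hlt => ?_⟩
        · by_contra hc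
          obtain ⟨i, hi⟩ := h2 q (by omega) (not_le.1 hc)
          rcases i with _ | i
          · simp at hi
          · rw [List.take_succ_cons, List.sum_cons] at hi
            omega
        · obtain ⟨i, hi⟩ := h2 (k + q) (by omega) hlt
          rcases i with _ | i
          · simp at hi
          · rw [List.take_succ_cons, List.sum_cons] at hi
            exact ⟨i, by omega⟩
    · rw [if_neg (fun hc => hk (by omega))]
      exact Finset.sum_eq_zero fun i hi => hz i hi (by rw [Finset.mem_range] at hi; omega)

end NSym

/-! ### Compositions and their descent sets -/

section
variable {n : ℕ}

/-- Compositions of `n` correspond to subsets of `{1, …, n - 1}`. -/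
def compSet (n : ℕ) : Composition n ≃ Finset (Fin (n - 1)) :=
  (compositionEquiv n).trans (compositionAsSetEquiv n)

theorem mem_compSet {c : Composition n} {q : Fin (n - 1)} :
    q ∈ compSet n c ↔ (⟨(q : ℕ) + 1, by omega⟩ : Fin (n + 1)) ∈ c.boundaries := by
  have h : q ∈ compSet n c ↔ (⟨1 + (q : ℕ), by omega⟩ : Fin (n + 1)) ∈ c.boundaries :=
    Set.mem_toFinset
  simp only [h, add_comm]

theorem mem_compSet_iff_sum {c : Composition n} {q : Fin (n - 1)} :
    q ∈ compSet n c ↔ ∃ i, (c.blocks.take i).sum = q + 1 := by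
  rw [mem_compSet, ← Composition.toCompositionAsSet_boundaries,
    CompositionAsSet.mem_boundaries_iff_exists_blocks_sum_take_eq,
    Composition.toCompositionAsSet_boundaries, c.card_boundaries_eq_succ_length,
    Composition.toCompositionAsSet_blocks]
  refine ⟨fun ⟨i, _, h⟩ => ⟨i, h⟩, fun ⟨i, h⟩ => ?_⟩
  by_cases hi : i < c.length + 1
  · exact ⟨i, hi, h⟩
  · refine ⟨c.length, Nat.lt_succ_self _, ?_⟩
    refine Eq.trans ?_ h
    rw [Composition.length, List.take_of_length_le le_rfl, List.take_of_length_le]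
    exact not_lt.1 fun hc => hi (hc.trans (Nat.lt_succ_self _))

theorem GenRibbon.ofComposition_eq (c : Composition n) :
    GenRibbon.ofComposition c = GenRibbon.ofSet (compSet n c) := by
  ext q
  simp only [GenRibbon.ofComposition, GenRibbon.ofSet, mem_compSet]

theorem mem_boundaries_iff {c : Composition n} {j : Fin (n + 1)} :
    j ∈ c.boundaries ↔ j = 0 ∨ j = Fin.last n ∨ ∃ q ∈ compSet n c, (j : ℕ) = q + 1 := by
  constructor
  · intro hj
    by_cases h0 : j = 0
    · exact Or.inl h0
    by_cases h1 : j = Fin.last n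
    · exact Or.inr (Or.inl h1)
    have h2 : (j : ℕ) ≠ 0 := fun e => h0 (Fin.ext e)
    have h3 : (j : ℕ) ≠ n := fun e => h1 (Fin.ext e)
    have := j.2
    refine Or.inr (Or.inr ⟨⟨j - 1, by omega⟩, ?_, by simp only; omega⟩)
    rw [mem_compSet]
    convert hj using 2
    simp only; omega
  · rintro (rfl | rfl | ⟨q, hq, e⟩)
    · exact c.toCompositionAsSet.zero_mem
    · exact c.toCompositionAsSet.getLast_mem
    · rw [mem_compSet] at hq
      convert hq using 1
      exact Fin.ext e

theorem boundaries_subset_iff {b c : Composition n} :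
    b.boundaries ⊆ c.boundaries ↔ compSet n b ⊆ compSet n c := by
  constructor
  · intro h q hq
    rw [mem_compSet] at hq ⊢
    exact h hq
  · intro h j hj
    rw [mem_boundaries_iff] at hj ⊢
    exact hj.imp_right (Or.imp_right fun ⟨q, hq, e⟩ => ⟨q, h hq, e⟩)

theorem length_sub_length {b c : Composition n} (h : b.boundaries ⊆ c.boundaries) :
    c.length - b.length = (compSet n c \ compSet n b).card := by
  have h1 : c.length - b.length = (c.boundaries \ b.boundaries).card := by
    rw [Finset.card_sdiff_of_subset h, c.card_boundaries_eq_succ_length,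
      b.card_boundaries_eq_succ_length, Nat.add_sub_add_right]
  rw [h1]
  symm
  refine Finset.card_bij (fun q _ => (⟨(q : ℕ) + 1, by omega⟩ : Fin (n + 1))) ?_ ?_ ?_
  · intro q hq
    rw [Finset.mem_sdiff, mem_compSet, mem_compSet] at hq
    rwa [Finset.mem_sdiff]
  · intro q _ r _ e
    rw [Fin.ext_iff] at e ⊢
    simpa using e
  · intro j hj
    rw [Finset.mem_sdiff, mem_boundaries_iff, mem_boundaries_iff] at hj
    push Not at hj
    obtain ⟨h1, h2, h3, h4⟩ := hj
    obtain ⟨q, hq, e⟩ := (h1.resolve_left h2).resolve_left h3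
    exact ⟨q, Finset.mem_sdiff.2 ⟨hq, fun hc => h4 q hc e⟩, Fin.ext e.symm⟩

end

namespace NSym
variable {n : ℕ}

open Classical in
theorem realize_hComp (c : Composition n) (w : List ℤ) : realize (hComp c) w =
    if w.length = n ∧ descents n w ⊆ compSet n c then 1 else 0 := by
  rw [hComp, realize_prod, c.blocks_sum]
  refine if_congr (and_congr_right fun hw => ?_) rfl rfl
  constructor
  · intro h q hq
    rw [mem_compSet_iff_sum]
    exact h q (by omega) (mem_descents.1 hq)
  · intro h q hq hlt
    exact mem_compSet_iff_sum.1 (h ((mem_descents (q := ⟨q, by omega⟩)).2 hlt))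

open Classical in
-- Inclusion-exclusion: a word occurs in `h_β` exactly when its descents lie in the set of `β`.
-- Indexing the `β` by the complement `G` of their set in that of `c` leaves an alternating sum over
-- all subsets of the set of `c` minus the descents, which vanishes unless this difference is empty.
theorem realize_s (c : Composition n) (w : List ℤ) : realize (s c) w =
    if w.length = n ∧ descents n w = compSet n c then 1 else 0 := by
  have h1 : realize (s c) w = ∑ β ∈ Finset.univ.filter fun β : Composition n =>
      β.boundaries ⊆ c.boundaries, (-1) ^ (compSet n c \ compSet n β).card *
        (if w.length = n ∧ descents n w ⊆ compSet n β then 1 else 0) := by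
    change NCSeries.coeff w (realize (s c)) = _
    rw [s, map_sum, map_sum]
    refine Finset.sum_congr rfl fun β hβ => ?_
    rw [map_mul, map_pow, map_neg, map_one, NCSeries.coeff_apply, NCSeries.neg_one_pow_mul_apply,
      realize_hComp, length_sub_length (Finset.mem_filter.1 hβ).2]
  have h2 : realize (s c) w = ∑ G ∈ (compSet n c).powerset, (-1) ^ G.card *
        (if w.length = n ∧ descents n w ⊆ compSet n c \ G then 1 else 0) := by
    rw [h1]
    refine Finset.sum_bij' (fun β _ => compSet n c \ compSet n β)
      (fun G _ => (compSet n).symm (compSet n c \ G)) ?_ ?_ ?_ ?_ ?_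
    · exact fun β _ => Finset.mem_powerset.2 Finset.sdiff_subset
    · intro G _
      rw [Finset.mem_filter, boundaries_subset_iff, Equiv.apply_symm_apply]
      exact ⟨Finset.mem_univ _, Finset.sdiff_subset⟩
    · intro β hβ
      have := boundaries_subset_iff.1 (Finset.mem_filter.1 hβ).2
      rw [Finset.sdiff_sdiff_eq_self this, Equiv.symm_apply_apply]
    · intro G hG
      rw [Equiv.apply_symm_apply, Finset.sdiff_sdiff_eq_self (Finset.mem_powerset.1 hG)]
    · intro β hβ
      have := boundaries_subset_iff.1 (Finset.mem_filter.1 hβ).2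
      rw [Finset.sdiff_sdiff_eq_self this]
  rw [h2]
  by_cases hw : w.length = n ∧ descents n w ⊆ compSet n c
  · have h3 : ∀ G ∈ (compSet n c).powerset, (-1 : ℤ) ^ G.card *
        (if w.length = n ∧ descents n w ⊆ compSet n c \ G then 1 else 0) =
        if G ⊆ compSet n c \ descents n w then (-1) ^ G.card else 0 := by
      intro G hG
      rw [mul_ite, mul_one, mul_zero]
      refine if_congr ?_ rfl rfl
      rw [and_iff_right hw.1, Finset.subset_sdiff, Finset.subset_sdiff,
        and_iff_right (Finset.mem_powerset.1 hG), and_iff_right hw.2, disjoint_comm]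
    rw [Finset.sum_congr rfl h3, ← Finset.sum_filter]
    have h4 : ((compSet n c).powerset.filter fun G => G ⊆ compSet n c \ descents n w) =
        (compSet n c \ descents n w).powerset := by
      ext G
      rw [Finset.mem_filter, Finset.mem_powerset, Finset.mem_powerset]
      exact ⟨fun h => h.2, fun h => ⟨h.trans Finset.sdiff_subset, h⟩⟩
    rw [h4, Finset.sum_powerset_neg_one_pow_card]
    refine if_congr ?_ rfl rfl
    rw [Finset.sdiff_eq_empty_iff_subset, and_iff_right hw.1]
    exact ⟨fun h => hw.2.antisymm h, fun h => h.ge⟩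
  · rw [if_neg fun hc => hw ⟨hc.1, hc.2.subset⟩]
    refine Finset.sum_eq_zero fun G _ => ?_
    rw [if_neg fun hc => hw ⟨hc.1, hc.2.trans Finset.sdiff_subset⟩, mul_zero]

/-- Products of complete functions span `NSym`. -/
theorem closure_hComp : AddSubgroup.closure {x | ∃ (n : ℕ) (c : Composition n), x = hComp c} = ⊤ := by
  set S : Set NSym := {x | ∃ (n : ℕ) (c : Composition n), x = hComp c} with hS
  have hL : ∀ L : List ℕ, (∀ k ∈ L, 0 < k) → (L.map h).prod ∈ AddSubgroup.closure S := fun L hL =>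
    AddSubgroup.subset_closure ⟨L.sum, ⟨L, fun {i} hi => hL i hi, rfl⟩, rfl⟩
  have hmul : ∀ x ∈ AddSubgroup.closure S, ∀ y ∈ AddSubgroup.closure S,
      x * y ∈ AddSubgroup.closure S := by
    intro x hx y hy
    induction hx using AddSubgroup.closure_induction with
    | zero => rw [zero_mul]; exact zero_mem _
    | neg x _ hx => rw [neg_mul]; exact neg_mem hx
    | add x x' _ _ hx hx' => rw [add_mul]; exact add_mem hx hx'
    | mem x hx =>
      induction hy using AddSubgroup.closure_induction with
      | zero => rw [mul_zero]; exact zero_mem _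
      | neg x _ hx => rw [mul_neg]; exact neg_mem hx
      | add x x' _ _ hx hx' => rw [mul_add]; exact add_mem hx hx'
      | mem y hy =>
        obtain ⟨m, b, rfl⟩ := hx
        obtain ⟨k, c, rfl⟩ := hy
        rw [hComp, hComp, ← List.prod_append, ← List.map_append]
        refine hL _ fun i hi => ?_
        rcases List.mem_append.1 hi with hi | hi
        · exact b.blocks_pos hi
        · exact c.blocks_pos hi
  refine (AddSubgroup.eq_top_iff' _).2 fun x => ?_
  induction x using NSym.induction with
  | hint r =>
    have := hL [] (by simp)
    rw [List.map_nil, List.prod_nil] at this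
    rw [← zsmul_one]
    exact zsmul_mem this r
  | hh k =>
    rcases k with _ | k
    · simpa using hL [] (by simp)
    · simpa using hL [k + 1] (by simp)
  | hmul a b ha hb => exact hmul a ha b hb
  | hadd a b ha hb => exact add_mem ha hb

/-- The ribbon functions span `NSym`. -/
theorem closure_s : AddSubgroup.closure {x | ∃ (n : ℕ) (c : Composition n), x = s c} = ⊤ := by
  rw [eq_top_iff, ← closure_hComp, AddSubgroup.closure_le]
  rintro _ ⟨n, c, rfl⟩
  induction hk : c.boundaries.card using Nat.strong_induction_on generalizing c with
  | _ k ih =>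
    have h1 : s c = hComp c + ∑ β ∈ (Finset.univ.filter fun β : Composition n =>
        β.boundaries ⊆ c.boundaries).erase c, (-1) ^ (c.length - β.length) * hComp β := by
      rw [s, ← Finset.add_sum_erase _ _ (show c ∈ Finset.univ.filter fun β : Composition n =>
        β.boundaries ⊆ c.boundaries from
        Finset.mem_filter.2 ⟨Finset.mem_univ _, Finset.Subset.refl _⟩), Nat.sub_self, pow_zero, one_mul]
    rw [← sub_eq_iff_eq_add] at h1
    rw [← h1]
    refine sub_mem (AddSubgroup.subset_closure ⟨n, c, rfl⟩) (sum_mem fun β hβ => ?_)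
    rw [Finset.mem_erase, Finset.mem_filter] at hβ
    have hlt : β.boundaries.card < k := by
      rw [← hk]
      refine Finset.card_lt_card (hβ.2.2.ssubset_of_ne fun e => hβ.1 ?_)
      apply (compositionEquiv n).injective
      exact CompositionAsSet.ext e
    have := ih _ hlt β rfl
    rcases (c.length - β.length).even_or_odd with h | h
    · rwa [h.neg_one_pow, one_mul]
    · rw [h.neg_one_pow, neg_one_mul]
      exact neg_mem this

end NSym
end HZero
end

noncomputable section
namespace HZero

/-! ### Shapes whose components are rows -/

namespace GenRibbon
variable {n : ℕ} {α : GenRibbon n}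

/-- The boxes with label below `i` form an initial segment, and such a segment ends precisely where
the label changes. Labels need not all occur: an unused one only repeats a partial sum, and in
products it contributes `h_0 = 1`. -/
theorem step_ne_right_iff {R : ℕ} {ρ : Fin n → Fin R} (hmono : Monotone ρ)
    (hstep : ∀ q, α.step q = Step.right ↔ ρ (lo q) = ρ (hi q)) (q : Fin (n - 1)) :
    α.step q ≠ Step.right ↔
      ∃ i, (Finset.univ.filter fun p => (ρ p : ℕ) < i).card = (q : ℕ) + 1 := by
  rw [Ne, hstep]
  have hle : (lo q : Fin n) ≤ hi q := Fin.le_def.2 (Nat.le_succ _)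
  constructor
  · intro hne
    refine ⟨ρ (hi q), ?_⟩
    rw [← val_hi, ← Fin.card_Iio (hi q)]
    refine congrArg Finset.card (Finset.ext fun p => ?_)
    rw [Finset.mem_filter, Finset.mem_Iio, and_iff_right (Finset.mem_univ _), ← Fin.lt_def]
    constructor
    · intro h
      by_contra hc
      exact (hmono (not_lt.1 hc)).not_gt h
    · intro h
      have h1 : p ≤ lo q := Fin.le_def.2 (Nat.lt_succ_iff.1 (Fin.lt_def.1 h))
      exact (hmono h1).trans_lt ((hmono hle).lt_of_ne hne)
  · rintro ⟨i, hi'⟩ he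
    by_cases h : (ρ (hi q) : ℕ) < i
    · have : (Finset.Iic (hi q : Fin n)).card ≤ _ := Finset.card_le_card
        (t := Finset.univ.filter fun p => (ρ p : ℕ) < i) fun p hp => by
          rw [Finset.mem_filter]
          exact ⟨Finset.mem_univ _, (Fin.le_def.1 (hmono (Finset.mem_Iic.1 hp))).trans_lt h⟩
      rw [hi', Fin.card_Iic, val_hi] at this
      omega
    · have : _ ≤ (Finset.Iio (lo q : Fin n)).card := Finset.card_le_card
        (s := Finset.univ.filter fun p => (ρ p : ℕ) < i) fun p hp => by
          rw [Finset.mem_filter] at hp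
          rw [Finset.mem_Iio]
          by_contra hc
          have := Fin.le_def.1 (hmono (not_lt.1 hc))
          rw [he] at this
          omega
      rw [hi', Fin.card_Iio, val_lo] at this
      omega

/-- The series of a shape whose components are rows is a product of complete functions. -/
theorem NoUp.series_eq (h : α.NoUp) {R : ℕ} {ρ : Fin n → Fin R} (hmono : Monotone ρ)
    (hstep : ∀ q, α.step q = Step.right ↔ ρ (lo q) = ρ (hi q)) : α.series =
      NSym.realize (List.ofFn fun r : Fin R =>
        NSym.h (Finset.univ.filter fun p => ρ p = r).card).prod := by
  classical
  ext w
  have hL : (List.ofFn fun r : Fin R => NSym.h (Finset.univ.filter fun p => ρ p = r).card) =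
      (List.ofFn fun r : Fin R => (Finset.univ.filter fun p => ρ p = r).card).map NSym.h := by
    rw [List.map_ofFn]; rfl
  have htake : ∀ i, ((List.ofFn fun r : Fin R =>
      (Finset.univ.filter fun p => ρ p = r).card).take i).sum =
        (Finset.univ.filter fun p => (ρ p : ℕ) < i).card := fun i => by
    rw [List.sum_take_ofFn, Finset.card_eq_sum_card_fiberwise (f := ρ)
      (t := Finset.univ.filter fun r : Fin R => (r : ℕ) < i)
      (fun p hp => by simpa using hp)]
    refine Finset.sum_congr rfl fun r hr => ?_
    congr 1
    ext p
    simp only [Finset.mem_filter, Finset.mem_univ, true_and] at hr ⊢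
    exact ⟨fun e => ⟨e ▸ hr, e⟩, fun e => e.2⟩
  have hsum : (List.ofFn fun r : Fin R => (Finset.univ.filter fun p => ρ p = r).card).sum = n := by
    have := htake R
    rw [List.take_of_length_le (by simp)] at this
    rw [this, Finset.filter_true_of_mem fun p _ => (ρ p).2, Finset.card_univ, Fintype.card_fin]
  rw [hL, NSym.realize_prod, series_apply, hsum]
  refine if_congr (and_congr_right fun hw => ?_) rfl rfl
  simp only [htake]
  constructor
  · intro H q hq hlt
    exact (step_ne_right_iff hmono hstep ⟨q, by omega⟩).1 fun e => (H _).1 e (mem_descents.2 hlt)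
  · intro H q
    refine ⟨fun e hq => ?_, fun e => (h q e).elim⟩
    exact (step_ne_right_iff hmono hstep q).2 (H q (by omega) (mem_descents.1 hq)) e

end GenRibbon

/-! ### The series of a class in the Grothendieck group -/

section
variable {F : Type u} [Field F]

theorem DualSystem.hom_ext {A : Type u} [Ring A] [Algebra F A] {I : Type} [Fintype I]
    [DecidableEq I] (D : DualSystem F A I) {X : Type*} [AddCommGroup X] {f g : K0 F A →+ X}
    (h : ∀ i, f (K0.cls (D.P i)) = g (K0.cls (D.P i))) : f = g := by
  ext x
  have hx : x = ∑ i, D.equiv x i • K0.cls (D.P i) := D.equiv.injective <| by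
    rw [map_sum]
    simp only [map_zsmul, D.equiv_P]
    funext j
    rw [Finset.sum_apply, Finset.sum_eq_single j]
    · simp
    · intro i _ hij
      simp [Pi.single_eq_of_ne hij.symm]
    · simp
  rw [hx, map_sum, map_sum]
  exact Finset.sum_congr rfl fun i _ => by rw [map_zsmul, map_zsmul, h]

/-- The class of the module `P_α`. -/
def K0.ofShape (F : Type u) [Field F] {n : ℕ} (α : GenRibbon n) : K0 F (H F n) :=
  K0.cls (FGProj.mk' F (H F n) (GenRibbon.P F α))

theorem K0.ofShape_isClassOf {n : ℕ} (α : GenRibbon n) :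
    (K0.ofShape F α).IsClassOf (GenRibbon.P F α) := K0.isClassOf_mk' _

theorem K0.hom_ext_ofSet {n : ℕ} {X : Type*} [AddCommGroup X] {f g : K0 F (H F n) →+ X}
    (h : ∀ D, f (K0.ofShape F (GenRibbon.ofSet D)) = g (K0.ofShape F (GenRibbon.ofSet D))) :
    f = g :=
  (H.dualSystem F n).hom_ext h

/-- The classes of the modules `P_α`, where the components of `α` are rows, generate. -/
theorem K0.hom_ext_noUp {n : ℕ} {X : Type*} [AddCommGroup X] {f g : K0 F (H F n) →+ X}
    (h : ∀ α : GenRibbon n, α.NoUp → f (K0.ofShape F α) = g (K0.ofShape F α)) : f = g := by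
  refine K0.hom_ext_ofSet fun D => ?_
  generalize GenRibbon.ofSet D = α
  induction α using GenRibbon.upInduction with
  | h0 α hα => exact h α hα
  | h1 α p hp ha hr =>
    obtain ⟨e⟩ := GenRibbon.P.gap_equiv (F := F) hp
    have hc : K0.ofShape F α = K0.ofShape F (α.setStep p Step.up) +
        K0.ofShape F (α.setStep p Step.right) :=
      K0.cls_eq_add (((FGProj.mkEquiv _).trans e).trans
        ((FGProj.mkEquiv _).symm.prodCongr (FGProj.mkEquiv _).symm))
    rw [eq_sub_of_add_eq hc.symm, map_sub, map_sub, ha, hr]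

/-- The generating series of the multiplicities of the one-dimensional modules. -/
def K0.series {n : ℕ} : K0 F (H F n) →+ NCSeries ℤ :=
  AddMonoidHom.mk' (fun x w =>
    if w.length = n then K0.mult (H.character F (descents n w)) x else 0) fun x y => by
      ext w
      change _ = (if w.length = n then K0.mult (H.character F (descents n w)) x else 0) +
        (if w.length = n then K0.mult (H.character F (descents n w)) y else 0)
      split_ifs
      · exact map_add _ _ _
      · rfl

theorem K0.series_apply {n : ℕ} (x : K0 F (H F n)) (w : List ℤ) : K0.series x w =
    if w.length = n then K0.mult (H.character F (descents n w)) x else 0 := rfl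

/-- The coefficient at `wordOf D` is the multiplicity at `D`, and the multiplicities determine a
class. -/
theorem K0.series_injective {n : ℕ} : Function.Injective (K0.series (F := F) (n := n)) := by
  intro x y hxy
  refine (H.dualSystem F n).ext fun D => ?_
  have := congrFun hxy (wordOf D)
  rw [K0.series_apply, K0.series_apply, if_pos (length_wordOf D), if_pos (length_wordOf D),
    descents_wordOf] at this
  exact this

theorem K0.IsClassOf.series_eq {n : ℕ} {x : K0 F (H F n)} {α : GenRibbon n}
    (h : x.IsClassOf (GenRibbon.P F α)) : K0.series x = α.series := by
  classical
  ext w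
  rw [K0.series_apply, GenRibbon.series_apply, ite_and, h.mult_eq, GenRibbon.mult_P]
  push_cast
  rfl

/-! ### The graded ring -/

section
variable {m k N : ℕ} (h : m + k = N)

/-- The part of a set of positions in the left factor. -/
def leftSet (D : Finset (Fin (N - 1))) : Finset (Fin (m - 1)) :=
  Finset.univ.filter fun i => GenRibbon.idxL h i ∈ D

/-- The part of a set of positions in the right factor. -/
def rightSet (D : Finset (Fin (N - 1))) : Finset (Fin (k - 1)) :=
  Finset.univ.filter fun i => GenRibbon.idxR h i ∈ D

/-- The generator `π_m` is missing from the parabolic subalgebra, so whether the position `m`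
belongs to `D` is forgotten. Correspondingly, concatenating two words puts no condition on the
junction. -/
theorem character_comp_par (D : Finset (Fin (N - 1))) : (H.character F D).comp (par F h) =
    charTensor (H.character F (leftSet h D)) (H.character F (rightSet h D)) := by
  refine Algebra.TensorProduct.ext (H.algHom_ext fun i => ?_) (H.algHom_ext fun i => ?_)
  · simp [par, GenRibbon.parLeft_pi, leftSet]
  · simp [par, GenRibbon.parRight_pi, rightSet]

theorem leftSet_descents {w : List ℤ} (hw : w.length = N) :
    leftSet h (descents N w) = descents m (w.take m) := by
  ext i
  have := i.2
  simp only [leftSet, Finset.mem_filter, Finset.mem_univ, true_and, mem_descents]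
  rw [List.getD_eq_getElem (w.take m) 0 (by rw [List.length_take]; omega),
    List.getD_eq_getElem (w.take m) 0 (by rw [List.length_take]; omega), List.getElem_take,
    List.getElem_take, ← List.getD_eq_getElem w 0 (by omega), ← List.getD_eq_getElem w 0 (by omega)]
  rfl

theorem rightSet_descents {w : List ℤ} :
    rightSet h (descents N w) = descents k (w.drop m) := by
  ext i
  simp only [rightSet, Finset.mem_filter, Finset.mem_univ, true_and, mem_descents]
  simp only [List.getD_eq_getElem?_getD, List.getElem?_drop]
  rfl

end

/-- The product of classes. -/
def K0.mul {m k : ℕ} (x : K0 F (H F m)) (y : K0 F (H F k)) : K0 F (H F (m + k)) :=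
  (H.dualSystem F (m + k)).equiv.symm fun D =>
    K0.mult (H.character F (leftSet rfl D)) x * K0.mult (H.character F (rightSet rfl D)) y

theorem K0.mult_mul {m k : ℕ} (x : K0 F (H F m)) (y : K0 F (H F k))
    (D : Finset (Fin (m + k - 1))) : K0.mult (H.character F D) (K0.mul x y) =
      K0.mult (H.character F (leftSet rfl D)) x * K0.mult (H.character F (rightSet rfl D)) y :=
  congrFun ((H.dualSystem F (m + k)).equiv.apply_symm_apply fun D =>
    K0.mult (H.character F (leftSet rfl D)) x * K0.mult (H.character F (rightSet rfl D)) y) D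

/-- Only the cut after `m` letters contributes to the Cauchy product, and the descents of the two
factors are the left and right parts of the descents of the word. Since `K0.mul` is prescribed
through multiplicities, the ring axioms can be verified in `NCSeries`; that the product is induction
is the content of `K0.isClassOf_mul`. -/
theorem K0.series_mul {m k : ℕ} (x : K0 F (H F m)) (y : K0 F (H F k)) :
    K0.series (K0.mul x y) = K0.series x * K0.series y := by
  ext w
  rw [NCSeries.mul_apply, K0.series_apply, K0.mult_mul]
  have hz : ∀ i ∈ Finset.range (w.length + 1), i ≠ m →
      K0.series x (w.take i) * K0.series y (w.drop i) = 0 := by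
    intro i hi hik
    rw [Finset.mem_range] at hi
    rw [K0.series_apply, if_neg (by rw [List.length_take]; omega), zero_mul]
  by_cases hm : m ≤ w.length
  · rw [Finset.sum_eq_single_of_mem m (by rw [Finset.mem_range]; omega) hz, K0.series_apply,
      K0.series_apply, if_pos (show (w.take m).length = m by rw [List.length_take]; omega),
      List.length_drop]
    by_cases hw : w.length = m + k
    · rw [if_pos hw, if_pos (by omega), leftSet_descents _ hw, rightSet_descents]
    · rw [if_neg hw, if_neg (by omega), mul_zero]
  · rw [if_neg (by omega), Finset.sum_eq_zero]
    exact fun i hi => hz i hi (by rw [Finset.mem_range] at hi; omega)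

/-- The unit class. -/
def K0.one : K0 F (H F 0) := (H.dualSystem F 0).equiv.symm fun _ => 1

theorem K0.series_one : K0.series (K0.one : K0 F (H F 0)) = 1 := by
  ext w
  rw [K0.series_apply, NCSeries.one_apply]
  refine if_congr Iff.rfl ?_ rfl
  exact congrFun ((H.dualSystem F 0).equiv.apply_symm_apply fun _ => 1) _

/-- Associativity and the unit laws compare degrees such as `0 + n` and `n`, which are equal only
propositionally. Series do not carry the degree in their type, so the comparison can be made there.
-/
theorem K0.sigma_ext {m k : ℕ} {x : K0 F (H F m)} {y : K0 F (H F k)} (h : m = k)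
    (hs : K0.series x = K0.series y) :
    (GradedMonoid.mk m x : GradedMonoid fun n => K0 F (H F n)) = GradedMonoid.mk k y := by
  subst h
  rw [K0.series_injective hs]

instance : GradedMonoid.GMul fun n : ℕ => K0 F (H F n) := ⟨K0.mul⟩
instance : GradedMonoid.GOne fun n : ℕ => K0 F (H F n) := ⟨K0.one⟩

instance K0.gring : DirectSum.GRing fun n : ℕ => K0 F (H F n) where
  mul := K0.mul
  one := K0.one
  mul_zero x := K0.series_injective (by rw [K0.series_mul, map_zero, map_zero, mul_zero])
  zero_mul x := K0.series_injective (by rw [K0.series_mul, map_zero, map_zero, zero_mul])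
  mul_add x y z := K0.series_injective (by simp only [K0.series_mul, map_add, mul_add])
  add_mul x y z := K0.series_injective (by simp only [K0.series_mul, map_add, add_mul])
  one_mul := fun ⟨n, x⟩ => K0.sigma_ext (zero_add n) (by
    change K0.series (K0.mul K0.one x) = _
    rw [K0.series_mul, K0.series_one, one_mul])
  mul_one := fun ⟨n, x⟩ => K0.sigma_ext (add_zero n) (by
    change K0.series (K0.mul x K0.one) = _
    rw [K0.series_mul, K0.series_one, mul_one])
  mul_assoc := fun ⟨m, x⟩ ⟨n, y⟩ ⟨k, z⟩ => K0.sigma_ext (add_assoc m n k) (by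
    change K0.series (K0.mul (K0.mul x y) z) = K0.series (K0.mul x (K0.mul y z))
    rw [K0.series_mul, K0.series_mul, K0.series_mul, K0.series_mul, mul_assoc])
  natCast r := r • K0.one
  natCast_zero := zero_smul _ _
  natCast_succ r := by rw [add_smul, one_smul]
  intCast r := r • K0.one
  intCast_ofNat r := natCast_zsmul _ _
  intCast_negSucc_ofNat r := negSucc_zsmul _ _

theorem K0Tower.of_mul_of {m k : ℕ} (x : K0 F (H F m)) (y : K0 F (H F k)) :
    K0Tower.of F m x * K0Tower.of F k y = K0Tower.of F (m + k) (K0.mul x y) :=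
  DirectSum.of_mul_of (A := fun n : ℕ => K0 F (H F n)) x y

variable (F) in
/-- The generating series on the whole tower. -/
def K0Tower.series : K0Tower F →+* NCSeries ℤ :=
  DirectSum.toSemiring (fun _ => K0.series) K0.series_one fun x y => K0.series_mul x y

theorem K0Tower.series_of (n : ℕ) (x : K0 F (H F n)) :
    K0Tower.series F (K0Tower.of F n x) = K0.series x := DirectSum.toSemiring_of ..

/-- Words of length `n` see only the component of degree `n`, so injectivity in each degree gives
injectivity on the whole tower. -/
theorem K0Tower.series_apply (x : K0Tower F) (w : List ℤ) :
    K0Tower.series F x w = K0.series (x w.length) w := by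
  induction x using DirectSum.induction_on with
  | zero => rw [map_zero, DirectSum.zero_apply, map_zero]
  | add x y hx hy => rw [map_add, NCSeries.add_apply, hx, hy, DirectSum.add_apply, map_add]; rfl
  | of n x =>
    refine (congrFun (K0Tower.series_of n x) w).trans ?_
    by_cases hw : n = w.length
    · subst hw
      rw [DirectSum.of_eq_same]
    · rw [DirectSum.of_eq_of_ne _ _ _ (Ne.symm hw), map_zero, K0.series_apply, if_neg (Ne.symm hw)]
      rfl

theorem K0Tower.series_injective : Function.Injective (K0Tower.series F) := by
  intro x y hxy
  refine DFinsupp.ext fun n => K0.series_injective ?_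
  ext w
  by_cases hw : w.length = n
  · subst hw
    exact (K0Tower.series_apply x w).symm.trans
      ((congrFun hxy w).trans (K0Tower.series_apply y w))
  · rw [K0.series_apply, K0.series_apply, if_neg hw, if_neg hw]

/-! ### The noncommutative characteristic -/

variable (F) in
/-- The homomorphism `NSym → K₀`, `h_k ↦ [P_(k)]`. -/
def ofNSym : NSym →ₐ[ℤ] K0Tower F := NSym.lift fun k : ℕ+ =>
  K0Tower.of F k (K0.ofShape F (GenRibbon.ofSet ∅))

theorem series_ofSet_empty (k : ℕ) : (GenRibbon.ofSet (n := k) ∅).series = NSym.hSeries k := by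
  rw [GenRibbon.NoUp.series_eq (R := 1) (ρ := fun _ => 0) (fun q => by simp [GenRibbon.ofSet])
    monotone_const fun q => by simp [GenRibbon.ofSet], ← NSym.realize_h]
  simp

theorem series_ofNSym (x : NSym) : K0Tower.series F (ofNSym F x) = NSym.realize x := by
  have : (RingHom.toIntAlgHom (K0Tower.series F)).comp (ofNSym F) = NSym.realize := by
    refine NSym.algHom_ext fun k => ?_
    rcases k with _ | k
    · rw [NSym.h_zero, map_one, map_one]
    · rw [NSym.realize_h]
      refine (congrArg (K0Tower.series F) (NSym.lift_gen _ _)).trans ?_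
      rw [K0Tower.series_of, (K0.ofShape_isClassOf _).series_eq, series_ofSet_empty]
      rfl
  exact DFunLike.congr_fun this x

variable (F) in
/-- The additive map `K₀ → NSym` with `[P_α] ↦ s_α` for ribbons. -/
def toNSym : K0Tower F →+ NSym := DirectSum.toAddMonoid fun n =>
  ∑ D : Finset (Fin (n - 1)),
    ((AddMonoidHom.mulRight (NSym.s ((compSet n).symm D))).comp
      (Int.castAddHom NSym)).comp (K0.mult (H.character F D))

theorem toNSym_of (n : ℕ) (x : K0 F (H F n)) : toNSym F (K0Tower.of F n x) =
    ∑ D : Finset (Fin (n - 1)), ((K0.mult (H.character F D) x : ℤ) : NSym) *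
      NSym.s ((compSet n).symm D) := by
  refine (DirectSum.toAddMonoid_of ..).trans ?_
  rw [AddMonoidHom.finsetSum_apply]
  rfl

/-- A word occurs in the realization of exactly one ribbon function of its degree, the one with its
own descent set, so the sum over all sets collapses to a single multiplicity. -/
theorem realize_toNSym (y : K0Tower F) : NSym.realize (toNSym F y) = K0Tower.series F y := by
  classical
  induction y using DirectSum.induction_on with
  | zero => rw [map_zero, map_zero, map_zero]
  | add x y hx hy => rw [map_add, map_add, map_add, hx, hy]
  | of n x =>
    refine (congrArg NSym.realize (toNSym_of n x)).trans (Eq.trans ?_ (K0Tower.series_of n x).symm)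
    ext w
    rw [map_sum, K0.series_apply]
    change NCSeries.coeff w (∑ D : Finset (Fin (n - 1)), NSym.realize _) = _
    have : ∀ D : Finset (Fin (n - 1)), NCSeries.coeff w (NSym.realize
        (((K0.mult (H.character F D) x : ℤ) : NSym) * NSym.s ((compSet n).symm D))) =
        if w.length = n ∧ descents n w = D then K0.mult (H.character F D) x else 0 := fun D => by
      rw [← zsmul_eq_mul, map_zsmul, map_zsmul, NCSeries.coeff_apply, NSym.realize_s,
        Equiv.apply_symm_apply, smul_eq_mul, mul_ite, mul_one, mul_zero]
    rw [map_sum, Finset.sum_congr rfl fun D _ => this D]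
    by_cases hw : w.length = n
    · simp [hw]
    · simp [hw]

theorem ofNSym_toNSym (y : K0Tower F) : ofNSym F (toNSym F y) = y :=
  K0Tower.series_injective (by rw [series_ofNSym, realize_toNSym])

theorem toNSym_ofComposition {n : ℕ} (c : Composition n) {x : K0 F (H F n)}
    (hx : x.IsClassOf (GenRibbon.P F (GenRibbon.ofComposition c))) :
    toNSym F (K0Tower.of F n x) = NSym.s c := by
  classical
  rw [toNSym_of, Finset.sum_eq_single (compSet n c)]
  · rw [hx.mult_eq, GenRibbon.mult_P, GenRibbon.ofComposition_eq,
      if_pos ((GenRibbon.isRibbon_ofSet _).compat_iff.2 rfl), Equiv.symm_apply_apply]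
    simp
  · intro D _ hD
    rw [hx.mult_eq, GenRibbon.mult_P, GenRibbon.ofComposition_eq, if_neg]
    · simp
    · rw [(GenRibbon.isRibbon_ofSet _).compat_iff, GenRibbon.ofSet_injective.eq_iff]
      exact Ne.symm hD
  · simp

theorem toNSym_surjective : Function.Surjective (toNSym F) := by
  rw [← AddMonoidHom.range_eq_top, eq_top_iff, ← NSym.closure_s, AddSubgroup.closure_le]
  rintro _ ⟨n, c, rfl⟩
  exact ⟨_, toNSym_ofComposition c (K0.ofShape_isClassOf _)⟩

/-- The ribbon functions span, so `toNSym` is onto, and the one-sided inverse already found is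
two-sided. In this way the additive map `[P_α] ↦ s_α` turns out to be multiplicative. -/
theorem toNSym_ofNSym (x : NSym) : toNSym F (ofNSym F x) = x := by
  obtain ⟨y, rfl⟩ := toNSym_surjective (F := F) x
  rw [ofNSym_toNSym]

variable (F) in
/-- The noncommutative characteristic as an isomorphism of rings. -/
def chAlg : K0Tower F ≃ₐ[ℤ] NSym := (AlgEquiv.ofBijective (ofNSym F) <|
  Function.bijective_iff_has_inverse.2 ⟨toNSym F, toNSym_ofNSym, ofNSym_toNSym⟩).symm

theorem chAlg_apply (y : K0Tower F) : chAlg F y = toNSym F y := by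
  rw [chAlg, AlgEquiv.symm_apply_eq]
  exact (ofNSym_toNSym y).symm

/-- No field enters the statement; the Grothendieck ring over `ℚ` serves as an auxiliary, since both
maps through which the realization factors are injective. -/
theorem NSym.realize_injective : Function.Injective NSym.realize := by
  intro x y hxy
  rw [← series_ofNSym (F := ℚ), ← series_ofNSym (F := ℚ)] at hxy
  exact (Function.LeftInverse.injective toNSym_ofNSym) (K0Tower.series_injective hxy)

end
end HZero
end

noncomputable section
namespace HZero

/-! ### Initial segments -/

section
variable {X : Type*} [LinearOrder X]

/-- Together with `initial_unique` this says that a finite chain has exactly one initial segment of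
each possible size: cutting a row into `β` and `γ` amounts to choosing how many boxes go to `β`. -/
theorem exists_initial (T : Finset X) {a : ℕ} (ha : a ≤ T.card) :
    ∃ S ⊆ T, S.card = a ∧ ∀ p ∈ T, ∀ q ∈ S, p < q → p ∈ S := by
  induction a with
  | zero => exact ⟨∅, Finset.empty_subset _, rfl, fun _ _ _ hq => by simp at hq⟩
  | succ a ih =>
    obtain ⟨S, hST, hS, h⟩ := ih (by omega)
    have hne : (T \ S).Nonempty := by
      rw [← Finset.card_pos, Finset.card_sdiff_of_subset hST]
      omega
    have hx := Finset.mem_sdiff.1 ((T \ S).min'_mem hne)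
    refine ⟨insert ((T \ S).min' hne) S, Finset.insert_subset hx.1 hST,
      by rw [Finset.card_insert_of_notMem hx.2, hS], fun p hp q hq hpq => ?_⟩
    rw [Finset.mem_insert] at hq ⊢
    rcases hq with rfl | hq
    · by_contra hc
      push Not at hc
      exact ((T \ S).min'_le p (Finset.mem_sdiff.2 ⟨hp, hc.2⟩)).not_gt hpq
    · exact Or.inr (h p hp q hq hpq)

theorem initial_unique {T S S' : Finset X} (hS : S ⊆ T) (hS' : S' ⊆ T)
    (h : ∀ p ∈ T, ∀ q ∈ S, p < q → p ∈ S) (h' : ∀ p ∈ T, ∀ q ∈ S', p < q → p ∈ S')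
    (hc : S.card = S'.card) : S = S' := by
  by_cases hsub : S ⊆ S'
  · exact Finset.eq_of_subset_of_card_le hsub hc.ge
  · obtain ⟨x, hx, hx'⟩ := Finset.not_subset.1 hsub
    refine (Finset.eq_of_subset_of_card_le (fun y hy => ?_) hc.le).symm
    rcases lt_trichotomy x y with hxy | rfl | hxy
    · exact (hx' (h' x (hS hx) y hy hxy)).elim
    · exact (hx' hy).elim
    · exact h y (hS' hy) x hx hxy

end

/-! ### The coproduct for shapes whose components are rows -/

namespace GenRibbon
variable {n : ℕ} {α : GenRibbon n}

instance (α : GenRibbon n) (m k : ℕ) : Fintype (α.Decomp m k) := Fintype.ofFinite _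

theorem row_lt_size (α : GenRibbon n) (p : Fin n) : α.row p < n := by
  have : α.row p ≤ (Finset.univ : Finset (Fin (n - 1))).card :=
    Finset.card_le_card (Finset.filter_subset _ _)
  rw [Finset.card_univ, Fintype.card_fin] at this
  have := p.2
  omega

/-- The row of a box as an element of `Fin n`. -/
def rowFin (α : GenRibbon n) (p : Fin n) : Fin n := ⟨α.row p, α.row_lt_size p⟩

theorem rowFin_eq_iff {p q : Fin n} : α.rowFin p = α.rowFin q ↔ α.row p = α.row q := Fin.ext_iff

theorem rowFin_mono (α : GenRibbon n) : Monotone α.rowFin := fun _ _ h => Fin.le_def.2 (α.row_mono h)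

theorem NoUp.col_lt_iff (h : α.NoUp) {p q : Fin n} : α.col p < α.col q ↔ p < q := by
  refine ⟨fun hc => ?_, fun hpq => α.col_lt (r := ⟨p, by omega⟩) le_rfl hpq (h _)⟩
  by_contra hn
  exact (α.col_mono (not_lt.1 hn)).not_gt hc

theorem NoUp.restrict (h : α.NoUp) {k : ℕ} (e : Fin k ↪o Fin n) : (α.restrict e).NoUp := by
  intro q hq
  obtain ⟨q', -, -, h3⟩ := (restrict_step_eq_iff e q (by simp)).1 hq
  exact h q' h3

/-- If the range of `e` is convex in each row, the rows of `α.restrict e` are the intersections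
with the rows of `α`. -/
theorem restrict_step_eq_right_iff {k : ℕ} (e : Fin k ↪o Fin n)
    (hc : ∀ a b x, a < b → e a < x → x < e b → α.row (e a) = α.row (e b) → ∃ c, e c = x)
    (q : Fin (k - 1)) : (α.restrict e).step q = Step.right ↔
      α.rowFin (e (lo q)) = α.rowFin (e (hi q)) := by
  rw [restrict_step_eq_iff e q (by simp), rowFin_eq_iff]
  constructor
  · rintro ⟨q', h1, h2, h3⟩
    rw [h1, h2]
    exact (α.row_lo_eq_iff q').2 h3
  · intro he
    have hlt : (lo q : Fin k) < hi q := Fin.lt_def.2 (Nat.lt_succ_self _)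
    have hlt' := e.lt_iff_lt.2 hlt
    have hr : ((e (lo q) : Fin n) : ℕ) + 1 = e (hi q) := by
      by_contra hne
      rw [Fin.lt_def] at hlt'
      have hb := (e (hi q)).2
      obtain ⟨c, hcx⟩ := hc _ _ ⟨(e (lo q) : ℕ) + 1, by omega⟩ hlt
        (Fin.lt_def.2 (Nat.lt_succ_self _)) (Fin.lt_def.2 (by simp only; omega)) he
      have h1 : lo q < c := e.lt_iff_lt.1 (by rw [hcx, Fin.lt_def]; exact Nat.lt_succ_self _)
      have h2 : c < hi q := e.lt_iff_lt.1 (by rw [hcx, Fin.lt_def]; simp only; omega)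
      rw [Fin.lt_def, val_lo] at h1
      rw [Fin.lt_def, val_hi] at h2
      omega
    refine ⟨⟨e (lo q), by have := (e (hi q)).2; omega⟩, rfl, Fin.ext hr.symm, ?_⟩
    exact (α.row_eq_iff hlt'.le).1 he _ le_rfl hlt'

namespace Decomp
variable {m k : ℕ}

/-- In each row the part `β` is an initial segment, hence convex, so two consecutive boxes of `β` in
the same row are adjacent in `α`. For `γ` the same holds with final segments. -/
theorem left_step_eq_right_iff (hα : α.NoUp) (d : α.Decomp m k) (q : Fin (m - 1)) :
    d.left.step q = Step.right ↔ α.rowFin (d.eL (lo q)) = α.rowFin (d.eL (hi q)) :=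
  restrict_step_eq_right_iff d.eL (fun a b x hab hax hxb hr => d.exists_eL <| by
    have h1 := α.row_mono hax.le
    have h2 := α.row_mono hxb.le
    exact d.row_le x (d.eL b) (by omega) (hα.col_lt_iff.2 hxb) (d.eL_mem b)) q

theorem right_step_eq_right_iff (hα : α.NoUp) (d : α.Decomp m k) (q : Fin (k - 1)) :
    d.right.step q = Step.right ↔ α.rowFin (d.eR (lo q)) = α.rowFin (d.eR (hi q)) :=
  restrict_step_eq_right_iff d.eR (fun a b x hab hax hxb hr => d.exists_eR fun hx => by
    have h1 := α.row_mono hax.le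
    have h2 := α.row_mono hxb.le
    exact d.eR_notMem a (d.row_le (d.eR a) x (by omega) (hα.col_lt_iff.2 hax) hx)) q

theorem card_left_row (d : α.Decomp m k) (r : Fin n) :
    (Finset.univ.filter fun p => α.rowFin (d.eL p) = r).card =
      (d.S.filter fun p => α.rowFin p = r).card := by
  refine Finset.card_bij (fun p _ => d.eL p) (fun p hp => ?_) (fun p _ q _ h => d.eL.injective h)
    fun p hp => ?_
  · rw [Finset.mem_filter] at hp ⊢
    exact ⟨d.eL_mem p, hp.2⟩
  · rw [Finset.mem_filter] at hp
    obtain ⟨a, rfl⟩ := d.exists_eL hp.1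
    exact ⟨a, Finset.mem_filter.2 ⟨Finset.mem_univ _, hp.2⟩, rfl⟩

theorem card_right_row (d : α.Decomp m k) (r : Fin n) :
    (Finset.univ.filter fun p => α.rowFin (d.eR p) = r).card =
      (d.Sᶜ.filter fun p => α.rowFin p = r).card := by
  refine Finset.card_bij (fun p _ => d.eR p) (fun p hp => ?_) (fun p _ q _ h => d.eR.injective h)
    fun p hp => ?_
  · rw [Finset.mem_filter] at hp ⊢
    exact ⟨Finset.mem_compl.2 (d.eR_notMem p), hp.2⟩
  · rw [Finset.mem_filter] at hp
    obtain ⟨a, rfl⟩ := d.exists_eR (Finset.mem_compl.1 hp.1)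
    exact ⟨a, Finset.mem_filter.2 ⟨Finset.mem_univ _, hp.2⟩, rfl⟩

theorem initial_row (hα : α.NoUp) (d : α.Decomp m k) (r : Fin n) :
    ∀ p ∈ Finset.univ.filter (fun p => α.rowFin p = r),
      ∀ q ∈ d.S.filter (fun p => α.rowFin p = r), p < q →
        p ∈ d.S.filter (fun p => α.rowFin p = r) := by
  intro p hp q hq hpq
  rw [Finset.mem_filter] at hp hq ⊢
  refine ⟨d.row_le p q ?_ (hα.col_lt_iff.2 hpq) hq.1, hp.2⟩
  rw [← rowFin_eq_iff, hp.2, hq.2]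

end Decomp

variable (F : Type u) [Field F]

theorem NoUp.toNSym_ofShape (h : α.NoUp) {R : ℕ} {ρ : Fin n → Fin R} (hmono : Monotone ρ)
    (hstep : ∀ q, α.step q = Step.right ↔ ρ (lo q) = ρ (hi q)) :
    toNSym F (K0Tower.of F n (K0.ofShape F α)) = (List.ofFn fun r : Fin R =>
      NSym.h (Finset.univ.filter fun p => ρ p = r).card).prod := by
  apply NSym.realize_injective
  rw [realize_toNSym, K0Tower.series_of, (K0.ofShape_isClassOf α).series_eq,
    h.series_eq hmono hstep]

theorem prod_ofFn_tmul {R : ℕ} (f g : Fin R → NSym) :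
    (List.ofFn fun r => f r ⊗ₜ[ℤ] g r).prod = (List.ofFn f).prod ⊗ₜ[ℤ] (List.ofFn g).prod := by
  induction R with
  | zero => simp [Algebra.TensorProduct.one_def]
  | succ R ih =>
    rw [List.ofFn_succ, List.ofFn_succ, List.ofFn_succ, List.prod_cons, List.prod_cons,
      List.prod_cons, ih, Algebra.TensorProduct.tmul_mul_tmul]

theorem comul_prod_h {R : ℕ} (ℓ : Fin R → ℕ) :
    NSym.comulHom (List.ofFn fun r => NSym.h (ℓ r)).prod =
      ∑ a ∈ Fintype.piFinset fun r => Finset.HasAntidiagonal.antidiagonal (ℓ r),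
        (List.ofFn fun r => NSym.h (a r).1).prod ⊗ₜ[ℤ] (List.ofFn fun r => NSym.h (a r).2).prod := by
  have h1 : NSym.comulHom (List.ofFn fun r => NSym.h (ℓ r)).prod =
      MultilinearMap.mkPiAlgebraFin ℤ R (NSym ⊗[ℤ] NSym) fun r =>
        ∑ p ∈ Finset.HasAntidiagonal.antidiagonal (ℓ r), NSym.h p.1 ⊗ₜ[ℤ] NSym.h p.2 := by
    rw [MultilinearMap.mkPiAlgebraFin_apply, map_list_prod, List.map_ofFn]
    simp only [← NSym.comulHom_h]
    rfl
  rw [h1, MultilinearMap.map_sum_finset]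
  refine Finset.sum_congr rfl fun a _ => ?_
  rw [MultilinearMap.mkPiAlgebraFin_apply, prod_ofFn_tmul]

/-- The coproduct of the characteristic of `P_α` where the components of `α` are rows. -/
theorem NoUp.comul_ofShape (hα : α.NoUp) :
    NSym.comulHom (toNSym F (K0Tower.of F n (K0.ofShape F α))) =
      ∑ p : Finset.HasAntidiagonal.antidiagonal n, ∑ d : α.Decomp p.1.1 p.1.2,
        toNSym F (K0Tower.of F p.1.1 (K0.ofShape F d.left)) ⊗ₜ[ℤ]
          toNSym F (K0Tower.of F p.1.2 (K0.ofShape F d.right)) := by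
  -- All `n` possible row numbers are used as labels, for `α` and for both parts of every
  -- decomposition; empty rows contribute the factor `h_0 = 1`, so the products can be compared
  -- factor by factor.
  rw [hα.toNSym_ofShape F α.rowFin_mono fun q => by rw [rowFin_eq_iff, row_lo_eq_iff],
    comul_prod_h]
  have hL : ∀ {i j : ℕ} (d : α.Decomp i j), toNSym F (K0Tower.of F i (K0.ofShape F d.left)) =
      (List.ofFn fun r : Fin n => NSym.h (d.S.filter fun p => α.rowFin p = r).card).prod :=
    fun {i j} d => by
      rw [NoUp.toNSym_ofShape (α := d.left) F (hα.restrict _) (α.rowFin_mono.comp d.eL.monotone)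
        (d.left_step_eq_right_iff hα)]
      simp only [Function.comp_apply, d.card_left_row]
  have hR : ∀ {i j : ℕ} (d : α.Decomp i j), toNSym F (K0Tower.of F j (K0.ofShape F d.right)) =
      (List.ofFn fun r : Fin n => NSym.h (d.Sᶜ.filter fun p => α.rowFin p = r).card).prod :=
    fun {i j} d => by
      rw [NoUp.toNSym_ofShape (α := d.right) F (hα.restrict _) (α.rowFin_mono.comp d.eR.monotone)
        (d.right_step_eq_right_iff hα)]
      simp only [Function.comp_apply, d.card_right_row]
  simp only [hL, hR]
  rw [← Fintype.sum_sigma' (fun (p : Finset.HasAntidiagonal.antidiagonal n)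
    (d : α.Decomp p.1.1 p.1.2) =>
      (List.ofFn fun r : Fin n => NSym.h (d.S.filter fun p => α.rowFin p = r).card).prod ⊗ₜ[ℤ]
      (List.ofFn fun r : Fin n => NSym.h (d.Sᶜ.filter fun p => α.rowFin p = r).card).prod)]
  symm
  -- A decomposition is matched with the numbers of boxes of `β` and of `γ` in each row.
  refine Finset.sum_bij (fun d _ r => ((d.2.S.filter fun p => α.rowFin p = r).card,
    (d.2.Sᶜ.filter fun p => α.rowFin p = r).card)) ?_ ?_ ?_ ?_
  · intro d _
    rw [Fintype.mem_piFinset]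
    intro r
    rw [Finset.HasAntidiagonal.mem_antidiagonal]
    simp only
    rw [← Finset.card_union_of_disjoint (Finset.disjoint_filter_filter disjoint_compl_right),
      ← Finset.filter_union, Finset.union_compl]
  · rintro ⟨⟨⟨i, j⟩, hp⟩, d⟩ - ⟨⟨⟨i', j'⟩, hp'⟩, d'⟩ - he
    have hS : d.S = d'.S := by
      ext p
      have h1 := congrArg Prod.fst (congrFun he (α.rowFin p))
      have h2 := initial_unique
        (Finset.filter_subset_filter _ (Finset.subset_univ _))
        (Finset.filter_subset_filter _ (Finset.subset_univ _))
        (d.initial_row hα (α.rowFin p)) (d'.initial_row hα (α.rowFin p)) h1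
      have h3 := Finset.ext_iff.1 h2 p
      simpa using h3
    clear he
    obtain ⟨S, a1, a2, c1, c2⟩ := d
    obtain ⟨S', a1', a2', c1', c2'⟩ := d'
    change S = S' at hS
    change S.card = i at c1
    change Sᶜ.card = j at c2
    change S'.card = i' at c1'
    change S'ᶜ.card = j' at c2'
    subst hS c1 c2 c1' c2'
    rfl
  · intro a ha
    rw [Fintype.mem_piFinset] at ha
    have hS : ∀ r, ∃ S ⊆ Finset.univ.filter (fun p => α.rowFin p = r), S.card = (a r).1 ∧
        ∀ p ∈ Finset.univ.filter (fun p => α.rowFin p = r), ∀ q ∈ S, p < q → p ∈ S := fun r =>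
      exists_initial _ (by
        have := Finset.HasAntidiagonal.mem_antidiagonal.1 (ha r)
        omega)
    choose S hsub hcard hinit using hS
    let U : Finset (Fin n) := Finset.univ.filter fun p => p ∈ S (α.rowFin p)
    have hU : ∀ p, p ∈ U ↔ p ∈ S (α.rowFin p) := fun p => by simp [U]
    have hUr : ∀ r, U.filter (fun p => α.rowFin p = r) = S r := fun r => by
      ext p
      rw [Finset.mem_filter, hU]
      constructor
      · rintro ⟨h1, rfl⟩
        exact h1
      · intro h1
        have := (Finset.mem_filter.1 (hsub r h1)).2
        exact ⟨this.symm ▸ h1, this⟩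
    have hUc : ∀ r, (Uᶜ.filter fun p => α.rowFin p = r).card = (a r).2 := fun r => by
      have h1 := Finset.HasAntidiagonal.mem_antidiagonal.1 (ha r)
      rw [← hcard r, ← hUr r] at h1
      have h2 : (Finset.univ.filter fun p => α.rowFin p = r).card =
          (U.filter fun p => α.rowFin p = r).card + (Uᶜ.filter fun p => α.rowFin p = r).card := by
        rw [← Finset.card_union_of_disjoint (Finset.disjoint_filter_filter disjoint_compl_right),
          ← Finset.filter_union, Finset.union_compl]
      omega
    refine ⟨⟨⟨(U.card, Uᶜ.card), ?_⟩, ⟨U, ?_, ?_, rfl, rfl⟩⟩, Finset.mem_univ _, ?_⟩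
    · rw [Finset.HasAntidiagonal.mem_antidiagonal]
      simp only
      rw [Finset.card_add_card_compl, Fintype.card_fin]
    · intro p q hr hc hq
      rw [hU] at hq ⊢
      rw [rowFin_eq_iff.2 hr]
      exact hinit _ p (Finset.mem_filter.2 ⟨Finset.mem_univ _, rowFin_eq_iff.2 hr⟩) q hq
        (hα.col_lt_iff.1 hc)
    -- Without ascending steps no two boxes share a column, so the column condition is vacuous.
    · intro p q hc hr
      rcases lt_trichotomy p q with h | rfl | h
      · exact ((hα.col_lt_iff.2 h).ne hc).elim
      · exact (lt_irrefl _ hr).elim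
      · exact ((hα.col_lt_iff.2 h).ne' hc).elim
    · funext r
      exact Prod.ext ((congrArg Finset.card (hUr r)).trans (hcard r)) (hUc r)
  · intro d _
    rfl

end GenRibbon
end HZero
end

noncomputable section
namespace HZero

/-! ### The external tensor product and restriction on Grothendieck groups -/

section
variable {F A B : Type u} [Field F] [Ring A] [Algebra F A] [Ring B] [Algebra F B]

section
variable {I J : Type} [Fintype I] [DecidableEq I] [Fintype J] [DecidableEq J]
  (D : DualSystem F A I) (E : DualSystem F B J)

/-- The basis of the Grothendieck group formed by the projective indecomposable modules. -/
def DualSystem.basis : Module.Basis I ℤ (K0 F A) :=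
  Module.Basis.ofEquivFun D.equiv.toIntLinearEquiv

theorem DualSystem.basis_repr (x : K0 F A) (i : I) : D.basis.repr x i = K0.mult (D.χ i) x := rfl

/-- The isomorphism `K₀(A) ⊗ K₀(B) ≅ K₀(A ⊗ B)`. -/
def DualSystem.tensorEquiv : K0 F A ⊗[ℤ] K0 F B ≃+ K0 F (A ⊗[F] B) :=
  (D.basis.tensorProduct E.basis).equivFun.toAddEquiv.trans (D.tensor E).equiv.symm

theorem DualSystem.mult_tensorEquiv (x : K0 F A) (y : K0 F B) (p : I × J) :
    K0.mult ((D.tensor E).χ p) (D.tensorEquiv E (x ⊗ₜ y)) =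
      K0.mult (D.χ p.1) x * K0.mult (E.χ p.2) y := by
  refine (congrFun ((D.tensor E).equiv.apply_symm_apply _) p).trans ?_
  change (D.basis.tensorProduct E.basis).repr (x ⊗ₜ y) p = _
  rw [Module.Basis.tensorProduct_repr_tmul_apply, basis_repr, basis_repr, smul_eq_mul, mul_comm]

/-- The isomorphism is defined by matching coordinates, and the multiplicities of an external tensor
product are the products of those of its factors. -/
theorem DualSystem.isClassOf_tensorEquiv (M : FGProj F A) (N : FGProj F B) :
    (D.tensorEquiv E (K0.cls M ⊗ₜ K0.cls N)).IsClassOf (ExtTensor F A B M N) := by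
  have := D.finite
  have := E.finite
  have : Module.Finite F M := Module.Finite.trans A M
  have : Module.Finite F N := Module.Finite.trans B N
  refine (D.tensor E).isClassOf _ fun p => ?_
  rw [mult_tensorEquiv, K0.mult_cls, K0.mult_cls]
  exact ((congrArg Nat.cast (mult_extTensor (D.χ p.1) (E.χ p.2))).trans (Nat.cast_mul ..)).symm

end

section
variable (φ : B →ₐ[F] A) [Module.Finite F A] [Module.Projective B (Res F φ A)]

/-- The restriction of a finitely generated projective module. -/
def FGProj.res (M : FGProj F A) : FGProj F B :=
  haveI : Module.Finite F M := Module.Finite.trans A M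
  haveI : Module.Projective B (Res F φ M) := Res.projective φ
  FGProj.mk' F B (Res F φ M)

/-- The underlying module of `FGProj.res φ M`. -/
def FGProj.resEquiv (M : FGProj F A) : FGProj.res φ M ≃ₗ[B] Res F φ M := LinearEquiv.refl B _

/-- Restriction on Grothendieck groups. -/
def K0.res : K0 F A →+ K0 F B := K0.lift (fun M => K0.cls (FGProj.res φ M)) fun {M L N} e =>
  K0.cls_eq_add <| (FGProj.resEquiv φ M).trans <| (Res.mapEquiv φ e).trans <|
    (Res.prodEquiv φ).trans <| (FGProj.resEquiv φ L).symm.prodCongr (FGProj.resEquiv φ N).symm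

theorem K0.IsClassOf.res {x : K0 F A} {X : Type*} [AddCommGroup X] [Module F X] [Module A X]
    [IsScalarTower F A X] (h : x.IsClassOf X) : (K0.res φ x).IsClassOf (Res F φ X) := by
  obtain ⟨M, ⟨e⟩, rfl⟩ := h
  exact ⟨FGProj.res φ M, ⟨(FGProj.resEquiv φ M).trans (Res.mapEquiv φ e)⟩, K0.lift_cls ..⟩

end
end

section
variable {F : Type u} [Field F] {m k N : ℕ}

variable (F) in
/-- The isomorphism `K₀(H_m(0)) ⊗ K₀(H_k(0)) ≅ K₀(H_m(0) ⊗ H_k(0))`. -/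
def K0.tensorEquiv (m k : ℕ) : K0 F (H F m) ⊗[ℤ] K0 F (H F k) ≃+ K0 F (H F m ⊗[F] H F k) :=
  (H.dualSystem F m).tensorEquiv (H.dualSystem F k)

/-- By Frobenius reciprocity the multiplicity of a character in the induced module is that of its
restriction to the parabolic subalgebra in `M ⊗ L`. This restriction is the tensor product of the
left and right characters, which gives exactly the formula defining `K0.mul`. -/
theorem K0.isClassOf_mul (M : FGProj F (H F m)) (L : FGProj F (H F k)) :
    (K0.mul (K0.cls M) (K0.cls L)).IsClassOf
      (Ind F (par F (rfl : m + k = m + k)) (ExtTensor F (H F m) (H F k) M L)) := by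
  have : Module.Finite F M := Module.Finite.trans (H F m) M
  have : Module.Finite F L := Module.Finite.trans (H F k) L
  refine (H.dualSystem F (m + k)).isClassOf _ fun D => ?_
  change K0.mult (H.character F D) _ = (HZero.mult (H.character F D) _ : ℤ)
  rw [K0.mult_mul, mult_ind, character_comp_par, mult_extTensor, K0.mult_cls, K0.mult_cls,
    Nat.cast_mul]

/-- Both sides have the same multiplicities: those of the restriction are sums over decompositions,
and the identification of `K₀` of a tensor product multiplies them in each term. -/
theorem K0.res_ofShape (h : m + k = N) (α : GenRibbon N) :
    (K0.tensorEquiv F m k).symm (K0.res (par F h) (K0.ofShape F α)) =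
      ∑ d : α.Decomp m k, K0.ofShape F d.left ⊗ₜ[ℤ] K0.ofShape F d.right := by
  rw [AddEquiv.symm_apply_eq, map_sum]
  refine ((H.dualSystem F m).tensor (H.dualSystem F k)).ext fun p => ?_
  rw [((K0.ofShape_isClassOf α).res (par F h)).mult_eq, map_sum]
  refine (congrArg Nat.cast (mult_res F h α (H.character F p.1) (H.character F p.2))).trans ?_
  rw [Nat.cast_sum]
  refine Finset.sum_congr rfl fun d _ => ?_
  refine Eq.trans ?_ ((H.dualSystem F m).mult_tensorEquiv (H.dualSystem F k) _ _ p).symm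
  rw [Nat.cast_mul, (K0.ofShape_isClassOf _).mult_eq, (K0.ofShape_isClassOf _).mult_eq]
  rfl

end

/-! ### Transport of Hopf algebra structures -/

section
variable {R A B : Type*} [CommRing R] [Ring A] [Algebra R A] [Ring B] [HopfAlgebra R B]
  (e : A ≃ₐ[R] B)

/-- The comultiplication of `A` transported from `B`. -/
def transportComul : A →ₗ[R] A ⊗[R] A :=
  TensorProduct.map e.symm.toLinearMap e.symm.toLinearMap ∘ₗ Coalgebra.comul ∘ₗ e.toLinearMap

theorem transportComul_symm (b : B) : transportComul e (e.symm b) =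
    TensorProduct.map e.symm.toLinearMap e.symm.toLinearMap (Coalgebra.comul (R := R) b) := by
  simp [transportComul]

/-- The coalgebra structure of `A` transported from `B`. -/
abbrev transportCoalgebra : Coalgebra R A where
  comul := transportComul e
  counit := Coalgebra.counit ∘ₗ e.toLinearMap
  coassoc := by
    refine LinearMap.ext fun a => ?_
    obtain ⟨b, rfl⟩ := e.symm.surjective a
    have h1 : ∀ t : B ⊗[R] B, (transportComul e).rTensor A
        (TensorProduct.map e.symm.toLinearMap e.symm.toLinearMap t) =
        TensorProduct.map (TensorProduct.map e.symm.toLinearMap e.symm.toLinearMap)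
          e.symm.toLinearMap (Coalgebra.comul.rTensor B t) := fun t => by
      induction t with
      | zero => simp only [map_zero]
      | add x y hx hy => simp only [map_add, hx, hy]
      | tmul x y =>
        simp only [TensorProduct.map_tmul, LinearMap.rTensor_tmul]
        exact congrArg (· ⊗ₜ[R] _) (transportComul_symm e x)
    have h2 : ∀ t : B ⊗[R] B, (transportComul e).lTensor A
        (TensorProduct.map e.symm.toLinearMap e.symm.toLinearMap t) =
        TensorProduct.map e.symm.toLinearMap
          (TensorProduct.map e.symm.toLinearMap e.symm.toLinearMap)
          (Coalgebra.comul.lTensor B t) := fun t => by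
      induction t with
      | zero => simp only [map_zero]
      | add x y hx hy => simp only [map_add, hx, hy]
      | tmul x y =>
        simp only [TensorProduct.map_tmul, LinearMap.lTensor_tmul]
        exact congrArg (_ ⊗ₜ[R] ·) (transportComul_symm e y)
    simp only [LinearMap.comp_apply, transportComul_symm, h1, h2]
    rw [← Coalgebra.coassoc_apply]
    exact LinearMap.congr_fun (TensorProduct.map_map_comp_assoc_eq ..).symm _
  rTensor_counit_comp_comul := by
    refine LinearMap.ext fun a => ?_
    obtain ⟨b, rfl⟩ := e.symm.surjective a
    have h : ∀ t : B ⊗[R] B, (Coalgebra.counit ∘ₗ e.toLinearMap).rTensor A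
        (TensorProduct.map e.symm.toLinearMap e.symm.toLinearMap t) =
        e.symm.toLinearMap.lTensor R (Coalgebra.counit.rTensor B t) := fun t => by
      induction t with
      | zero => simp only [map_zero]
      | add x y hx hy => simp only [map_add, hx, hy]
      | tmul x y => simp
    simp only [LinearMap.comp_apply, transportComul_symm, h, Coalgebra.rTensor_counit_comul]
    simp
  lTensor_counit_comp_comul := by
    refine LinearMap.ext fun a => ?_
    obtain ⟨b, rfl⟩ := e.symm.surjective a
    have h : ∀ t : B ⊗[R] B, (Coalgebra.counit ∘ₗ e.toLinearMap).lTensor A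
        (TensorProduct.map e.symm.toLinearMap e.symm.toLinearMap t) =
        e.symm.toLinearMap.rTensor R (Coalgebra.counit.lTensor B t) := fun t => by
      induction t with
      | zero => simp only [map_zero]
      | add x y hx hy => simp only [map_add, hx, hy]
      | tmul x y => simp
    simp only [LinearMap.comp_apply, transportComul_symm, h, Coalgebra.lTensor_counit_comul]
    simp

/-- The antipode of `A` transported from `B`. -/
def transportAntipode : A →ₗ[R] A :=
  e.symm.toLinearMap ∘ₗ HopfAlgebra.antipode R ∘ₗ e.toLinearMap

theorem isHopf_transport :
    letI := transportCoalgebra e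
    IsHopf R A (transportAntipode e) := by
  let _ := transportCoalgebra e
  have hc : ∀ b : B, Coalgebra.comul (R := R) (e.symm b) =
      Algebra.TensorProduct.map e.symm.toAlgHom e.symm.toAlgHom (Coalgebra.comul (R := R) b) :=
    transportComul_symm e
  have hε : ∀ b : B, Coalgebra.counit (R := R) (e.symm b) = Coalgebra.counit (R := R) b :=
    fun b => congrArg (Coalgebra.counit (R := R)) (e.apply_symm_apply b)
  refine ⟨?_, fun a b => ?_, ?_, fun a b => ?_, ?_, ?_⟩
  · rw [← map_one e.symm, hc, Bialgebra.comul_one, map_one]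
  · obtain ⟨a, rfl⟩ := e.symm.surjective a
    obtain ⟨b, rfl⟩ := e.symm.surjective b
    rw [← map_mul, hc, hc, hc, Bialgebra.comul_mul, map_mul]
  · rw [← map_one e.symm, hε, Bialgebra.counit_one]
  · obtain ⟨a, rfl⟩ := e.symm.surjective a
    obtain ⟨b, rfl⟩ := e.symm.surjective b
    rw [← map_mul, hε, hε, hε, Bialgebra.counit_mul]
  · refine LinearMap.ext fun a => ?_
    obtain ⟨b, rfl⟩ := e.symm.surjective a
    have h : ∀ t : B ⊗[R] B, LinearMap.mul' R A ((transportAntipode e).rTensor A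
        (Algebra.TensorProduct.map e.symm.toAlgHom e.symm.toAlgHom t)) =
        e.symm (LinearMap.mul' R B ((HopfAlgebra.antipode R).rTensor B t)) := fun t => by
      induction t with
      | zero => simp only [map_zero]
      | add x y hx hy => simp only [map_add, hx, hy]
      | tmul x y => simp [transportAntipode]
    rw [LinearMap.comp_apply, LinearMap.comp_apply, hc, h,
      HopfAlgebra.mul_antipode_rTensor_comul_apply, LinearMap.comp_apply, hε]
    exact e.symm.commutes _
  · refine LinearMap.ext fun a => ?_
    obtain ⟨b, rfl⟩ := e.symm.surjective a
    have h : ∀ t : B ⊗[R] B, LinearMap.mul' R A ((transportAntipode e).lTensor A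
        (Algebra.TensorProduct.map e.symm.toAlgHom e.symm.toAlgHom t)) =
        e.symm (LinearMap.mul' R B ((HopfAlgebra.antipode R).lTensor B t)) := fun t => by
      induction t with
      | zero => simp only [map_zero]
      | add x y hx hy => simp only [map_add, hx, hy]
      | tmul x y => simp [transportAntipode]
    rw [LinearMap.comp_apply, LinearMap.comp_apply, hc, h,
      HopfAlgebra.mul_antipode_lTensor_comul_apply, LinearMap.comp_apply, hε]
    exact e.symm.commutes _

/-- The isomorphism along which the coalgebra structure is transported. -/
def transportEquiv :
    letI := transportCoalgebra e
    A ≃ₐc[R] B :=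
  letI := transportCoalgebra e
  { e with
    map_smul' := map_smul e
    counit_comp := rfl
    map_comp_comul := LinearMap.ext fun a => by
      have h : ∀ t : B ⊗[R] B, TensorProduct.map e.toLinearMap e.toLinearMap
          (TensorProduct.map e.symm.toLinearMap e.symm.toLinearMap t) = t := fun t => by
        induction t with
        | zero => simp only [map_zero]
        | add x y hx hy => simp only [map_add, hx, hy]
        | tmul x y => simp
      exact h _ }

end

/-! ### Restriction as comultiplication, and uniqueness of the characteristic -/

section
variable {F : Type u} [Field F]

/-- The comultiplication of `K₀` is given by restriction. -/
theorem comul_of (n : ℕ) (x : K0 F (H F n)) :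
    transportComul (chAlg F) (K0Tower.of F n x) =
      ∑ p : Finset.HasAntidiagonal.antidiagonal n, K0Tower.of₂ F p.1.1 p.1.2
        ((K0.tensorEquiv F p.1.1 p.1.2).symm
          (K0.res (par F (Finset.HasAntidiagonal.mem_antidiagonal.1 p.2)) x)) := by
  let f : K0 F (H F n) →+ K0Tower F ⊗[ℤ] K0Tower F :=
    (transportComul (chAlg F)).toAddMonoidHom.comp (K0Tower.of F n)
  let g : K0 F (H F n) →+ K0Tower F ⊗[ℤ] K0Tower F :=
    ∑ p : Finset.HasAntidiagonal.antidiagonal n, (K0Tower.of₂ F p.1.1 p.1.2).toAddMonoidHom.comp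
      ((K0.tensorEquiv F p.1.1 p.1.2).symm.toAddMonoidHom.comp
        (K0.res (par F (Finset.HasAntidiagonal.mem_antidiagonal.1 p.2))))
  have hfg : f = g := by
    -- Both sides are additive in the class, so they need only be compared on row shapes. There the
    -- coproduct in `NSym` and the restriction are both sums over decompositions.
    refine K0.hom_ext_noUp fun α hα => ?_
    have hs : ∀ y, (chAlg F).symm (toNSym F y) = y := fun y => by
      rw [← chAlg_apply y, AlgEquiv.symm_apply_apply]
    change TensorProduct.map (chAlg F).symm.toLinearMap (chAlg F).symm.toLinearMap
      (NSym.comulHom (chAlg F (K0Tower.of F n (K0.ofShape F α)))) = g (K0.ofShape F α)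
    rw [chAlg_apply, hα.comul_ofShape F, AddMonoidHom.finsetSum_apply, map_sum]
    refine Finset.sum_congr rfl fun p _ => ?_
    refine Eq.trans ?_ (congrArg (K0Tower.of₂ F p.1.1 p.1.2) (K0.res_ofShape _ α)).symm
    rw [map_sum, map_sum]
    refine Finset.sum_congr rfl fun d _ => ?_
    exact congrArg₂ (· ⊗ₜ[ℤ] ·) (hs _) (hs _)
  refine (DFunLike.congr_fun hfg x).trans ?_
  exact AddMonoidHom.finsetSum_apply ..

/-- An additive map with `P_α ↦ s_α` for all compositions is the noncommutative characteristic. -/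
theorem eq_toNSym (f : K0Tower F →+ NSym)
    (hf : ∀ (n : ℕ) (c : Composition n) (x : K0 F (H F n)),
      x.IsClassOf (GenRibbon.P F (GenRibbon.ofComposition c)) →
        f (K0Tower.of F n x) = NSym.s c) : f = toNSym F := by
  refine DirectSum.addHom_ext fun n x => ?_
  have : f.comp (K0Tower.of F n) = (toNSym F).comp (K0Tower.of F n) := by
    refine K0.hom_ext_ofSet fun D => ?_
    have hD : GenRibbon.ofSet D = GenRibbon.ofComposition ((compSet n).symm D) := by
      rw [GenRibbon.ofComposition_eq, Equiv.apply_symm_apply]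
    rw [hD]
    have hx := K0.ofShape_isClassOf (F := F) (GenRibbon.ofComposition ((compSet n).symm D))
    exact (hf n _ _ hx).trans (toNSym_ofComposition _ hx).symm
  exact DFunLike.congr_fun this x

end
end HZero
end

/-! ### The main theorem -/

theorem mainTheorem7 (F : Type u) [Field F] :
    -- `H_m(0) ⊗ H_n(0)` is identified with the parabolic subalgebra `H_{m,n}(0)`
    (∀ (m n N : ℕ) (h : m + n = N),
      Function.Injective (par F h) ∧ (par F h).range = parabolic F m N) ∧
    -- the two descriptions of the restriction of `P_α` to `H_{m,n}(0)`
    (∀ (m n N : ℕ) (h : m + n = N) (α : GenRibbon N),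
      Nonempty (Res F (par F h) (GenRibbon.P F α) ≃ₗ[H F m ⊗[F] H F n]
        ⨁ d : α.Decomp m n,
          ExtTensor F (H F m) (H F n) (GenRibbon.P F d.left) (GenRibbon.P F d.right)) ∧
      Nonempty (Res F (par F h) (GenRibbon.P F α) ≃ₗ[H F m ⊗[F] H F n]
        ⨁ t : (Σ d : α.Decomp m n, d.left.resolutions × d.right.resolutions),
          ExtTensor F (H F m) (H F n)
            (GenRibbon.P F t.2.1.1) (GenRibbon.P F t.2.2.1))) ∧
    -- the realization of `NSym` by noncommutative power series is faithful
    Function.Injective NSym.realize ∧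
    -- `K₀(H_•(0))` is a Hopf algebra and `ch` is a Hopf algebra isomorphism
    ∃ (κ : ∀ m n : ℕ, K0 F (H F m) ⊗[ℤ] K0 F (H F n) ≃+ K0 F (H F m ⊗[F] H F n))
      (_ : DirectSum.GRing fun n : ℕ => K0 F (H F n))
      (_ : Coalgebra ℤ (K0Tower F)) (S : K0Tower F →ₗ[ℤ] K0Tower F)
      (ch : K0Tower F ≃ₐc[ℤ] NSym),
      IsHopf ℤ (K0Tower F) S ∧
      -- `κ` is the identification induced by the external tensor product
      (∀ (m n : ℕ) (M : FGProj F (H F m)) (N : FGProj F (H F n)),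
        (κ m n (K0.cls M ⊗ₜ[ℤ] K0.cls N)).IsClassOf (ExtTensor F (H F m) (H F n) M N)) ∧
      -- the product is given by induction
      (∀ (m n : ℕ) (M : FGProj F (H F m)) (N : FGProj F (H F n)),
        ∃ y : K0 F (H F (m + n)),
          y.IsClassOf (Ind F (par F (rfl : m + n = m + n)) (ExtTensor F (H F m) (H F n) M N)) ∧
          K0Tower.of F m (K0.cls M) *
            K0Tower.of F n (K0.cls N) =
          K0Tower.of F (m + n) y) ∧
      -- the coproduct is given by restriction
      (∀ (n : ℕ) (M : FGProj F (H F n)),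
        ∃ x : ∀ p : Finset.HasAntidiagonal.antidiagonal n,
            K0 F (H F p.1.1) ⊗[ℤ] K0 F (H F p.1.2),
          (∀ p, (κ p.1.1 p.1.2 (x p)).IsClassOf
            (Res F (par F (Finset.HasAntidiagonal.mem_antidiagonal.1 p.2)) M)) ∧
          Coalgebra.comul (R := ℤ) (K0Tower.of F n (K0.cls M)) =
            ∑ p : Finset.HasAntidiagonal.antidiagonal n, K0Tower.of₂ F p.1.1 p.1.2 (x p)) ∧
      -- `ch` is the noncommutative characteristic: the only additive map with `P_α ↦ s_α` for all
      -- compositions `α`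
      (∀ (n : ℕ) (c : Composition n), ∃ x : K0 F (H F n),
        x.IsClassOf (GenRibbon.P F (GenRibbon.ofComposition c)) ∧
        ch (K0Tower.of F n x) = NSym.s c) ∧
      (∀ f : K0Tower F →+ NSym,
        (∀ (n : ℕ) (c : Composition n) (x : K0 F (H F n)),
          x.IsClassOf (GenRibbon.P F (GenRibbon.ofComposition c)) →
          f (K0Tower.of F n x) = NSym.s c) →
        ∀ y, f y = ch y) ∧
      -- `ch` sends `P_α` to `s_α` for all generalized ribbons `α`
      (∀ (n : ℕ) (α : GenRibbon n), ∃ x : K0 F (H F n),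
        x.IsClassOf (GenRibbon.P F α) ∧
        NSym.realize (ch (K0Tower.of F n x)) = α.series) ∧
      -- `ch` commutes with the antipodes
      (∀ y, ch (S y) = HopfAlgebra.antipode ℤ (ch y)) := by
  classical
  refine ⟨fun m n N h => ⟨par_injective F h, range_par F h⟩,
    fun m n N h α => ⟨⟨(GenRibbon.resEquiv F h α).symm⟩, nonempty_res_equiv F h α⟩,
    NSym.realize_injective, fun m n => K0.tensorEquiv F m n, K0.gring,
    transportCoalgebra (chAlg F), transportAntipode (chAlg F), transportEquiv (chAlg F),
    isHopf_transport (chAlg F), fun m n M N => DualSystem.isClassOf_tensorEquiv _ _ M N,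
    fun m n M N => ⟨_, K0.isClassOf_mul M N, K0Tower.of_mul_of _ _⟩,
    fun n M => ⟨fun p => (K0.tensorEquiv F p.1.1 p.1.2).symm
      (K0.res (par F (Finset.HasAntidiagonal.mem_antidiagonal.1 p.2)) (K0.cls M)),
      fun p => ?_, comul_of n _⟩,
    fun n c => ⟨_, K0.ofShape_isClassOf _,
      (chAlg_apply _).trans (toNSym_ofComposition c (K0.ofShape_isClassOf _))⟩,
    fun f hf y => (DFunLike.congr_fun (eq_toNSym f hf) y).trans (chAlg_apply y).symm,
    fun n α => ⟨_, K0.ofShape_isClassOf α, ?_⟩, fun y => ?_⟩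
  · rw [AddEquiv.apply_symm_apply]
    exact K0.IsClassOf.res _ ⟨M, ⟨LinearEquiv.refl _ _⟩, rfl⟩
  · refine (congrArg NSym.realize (chAlg_apply _)).trans ?_
    rw [realize_toNSym, K0Tower.series_of, (K0.ofShape_isClassOf α).series_eq]
  -- The antipode of `K₀` is the conjugate of that of `NSym` by the characteristic, so they
  -- correspond by construction.
  · exact (chAlg F).apply_symm_apply _
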